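/- Let $n\ge 1$ and $-\frac1n<\alpha<0$. Let $\mathrm{Conv}(\mathbb R^n)$ be the set of proper, convex, lower semicontinuous functions $\mathbb R^n\to\mathbb R\cup\{+\infty\}$; for such $\varphi$ write $\mathrm{dom}\,\varphi=\{\varphi<+\infty\}$ and $\varphi^*(y)=\sup_x(\langle x,y\rangle-\varphi(x))$. For $s\in(\frac1\alpha,+\infty)$ put $\Psi_\alpha(s)=(1-\alpha s)^{1/\alpha}$, and $\Psi_\alpha(+\infty)=0$. For a function $f$ let $K_f$ be its (closed) support, $h_E(u)=\sup_{y\in E}\langle u,y\rangle$ the support function of a set $E$, $\nu_K$ the outer unit normal (Gauss map) of a closed convex set $K$ with nonempty interior, defined $\mathcal H^{n-1}$-almost everywhere on $\partial K$, and $J(f)=\int_{\mathbb R^n}f\,dx$. Let $\varphi\in\mathrm{Conv}(\mathbb R^n)$ be nonnegative and coercive, i.e. $\liminf_{|x|\to\infty}\varphi(x)/|x|>0$, and let $f=\Psi_\alpha(\varphi)=(1-\alpha\varphi)^{1/\alpha}$ (so $f\in\mathcal C^+_\alpha(\mathbb R^n)$ and $K_f=\overline{\mathrm{dom}\,\varphi}$).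 Let $\psi\in\mathrm{Conv}(\mathbb R^n)$, and suppose that there are constants $\beta_1>0$ and $\beta_2\in\mathbb R$ with $$(\mathrm{dom}\,\psi)\cap\mathrm{int}(\beta_1K_f)\ne\emptyset\quad\text{and}\quad \psi^*\le\beta_1\varphi^*+\beta_2 .$$ (1) $f$ is integrable and, for all sufficiently small $t>0$, $(\varphi^*+t\psi^*)^*>\frac1\alpha$ on $\mathbb R^n$, and $f_t:=\Psi_\alpha\big((\varphi^*+t\psi^*)^*\big)$ is integrable. The function $\psi^*(\nabla\varphi)f^{1-\alpha}$ (read as $0$ where $f=0$), with $\psi^*(\nabla\varphi)$ finite almost everywhere on $\mathrm{dom}\,\varphi$, is integrable over $\mathbb R^n$. The function $h_{\overline{\mathrm{dom}\,\psi}}(\nu_{K_f})f$, with $h_{\overline{\mathrm{dom}\,\psi}}(\nu_{K_f}(x))$ finite wherever $\nu_{K_f}(x)$ is defined, is integrable over $\partial K_f$ with respect to $\mathcal H^{n-1}$. Moreover $$\lim_{t\to0^+}\int_{\mathbb R^n}\frac{f_t(x)-f(x)}t\,dx=\int_{\mathbb R^n}\psi^*(\nabla\varphi(x))f(x)^{1-\alpha}\,dx+\int_{\partial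 K_f}h_{\overline{\mathrm{dom}\,\psi}}(\nu_{K_f}(x))f(x)\,d\mathcal H^{n-1}(x).$$ (2) If moreover $\psi>\frac1\alpha$ on $\mathbb R^n$, so that $g=\Psi_\alpha(\psi)=(1-\alpha\psi)^{1/\alpha}$ is an $\alpha$-concave function with $K_g=\overline{\mathrm{dom}\,\psi}$ (in particular if $\psi$ is nonnegative and coercive, i.e. $g\in\mathcal C_\alpha^+(\mathbb R^n)$), then with $f\oplus_\alpha t\cdot_\alpha g:=\Psi_\alpha\big((\varphi^*+t\psi^*)^*\big)$ the first variation $\delta J_\alpha(f,g):=\lim_{t\to0^+}\frac{J(f\oplus_\alpha t\cdot_\alpha g)-J(f)}t$ exists, is finite, and $$\delta J_\alpha(f,g)=\int_{\mathbb R^n}\psi^*(\nabla\varphi(x))f(x)^{1-\alpha}\,dx+\int_{\partial K_f}h_{K_g}(\nu_{K_f}(x))f(x)\,d\mathcal H^{n-1}(x).$$ -/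

import Mathlib

open Set Filter Topology MeasureTheory
open scoped Pointwise

namespace AlphaConcave

noncomputable section

/-- Euclidean space `ℝⁿ`. -/
abbrev Eucl (n : ℕ) : Type := EuclideanSpace ℝ (Fin n)

variable {n : ℕ}

/-- The effective domain of an extended-valued function. -/
def dom (φ : Eucl n → EReal) : Set (Eucl n) := {x | φ x < ⊤}

/-- `Conv(ℝⁿ)`: proper, convex, lower semicontinuous functions `ℝⁿ → ℝ ∪ {+∞}`.
The product in `EReal` obeys `0 * ⊤ = 0`, and no sum `⊤ + ⊥` can occur since `⊥` is not a value. -/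
structure IsConv (φ : Eucl n → EReal) : Prop where
  ne_bot : ∀ x, φ x ≠ ⊥
  dom_nonempty : (dom φ).Nonempty
  convex : ∀ (x y : Eucl n) (a b : ℝ), 0 ≤ a → 0 ≤ b → a + b = 1 →
    φ (a • x + b • y) ≤ (a : EReal) * φ x + (b : EReal) * φ y
  lsc : LowerSemicontinuous φ

/-- Coercivity: `liminf φ(x) / |x| > 0` as `|x| → ∞`. -/
def Coercive (φ : Eucl n → EReal) : Prop :=
  0 < liminf (fun x : Eucl n => φ x / ((‖x‖ : ℝ) : EReal)) (Bornology.cobounded (Eucl n))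

/-- The Legendre transform `φ*(y) = sup_x (⟨x, y⟩ - φ(x))`. -/
def legendre (φ : Eucl n → EReal) (y : Eucl n) : EReal :=
  ⨆ x : Eucl n, (((inner ℝ x y : ℝ) : EReal) - φ x)

/-- The generator `Ψ_α(s) = (1 - α s)^{1/α}` for `1/α < s < ∞`, and `Ψ_α(+∞) = 0`. -/
def Psi (α : ℝ) (s : EReal) : ℝ :=
  if s = ⊤ then 0 else (1 - α * s.toReal) ^ (1 / α)

/-- The base function `(1 - f^α) / α` of an `α`-concave function `f`, equal to `+∞` where `f = 0`. -/
def base (α : ℝ) (f : Eucl n → ℝ) (x : Eucl n) : EReal :=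
  if f x = 0 then ⊤ else (((1 - f x ^ α) / α : ℝ) : EReal)

/-- The function `(φ* + t ψ*)*`. -/
def combBase (φ ψ : Eucl n → EReal) (t : ℝ) : Eucl n → EReal :=
  legendre (fun y => legendre φ y + (t : EReal) * legendre ψ y)

/-- The combination `f ⊕_α t •_α g = Ψ_α ((φ* + t ψ*)*)`, with `φ`, `ψ` the bases of `f`, `g`. -/
def alphaComb (α : ℝ) (f g : Eucl n → ℝ) (t : ℝ) (x : Eucl n) : ℝ :=
  Psi α (combBase (base α f) (base α g) t x)

/-- The total mass. -/
def totalMass (f : Eucl n → ℝ) : ℝ := ∫ x, f x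

/-- The first variation `δJ_α(f, g) = lim_{t → 0⁺} (J(f ⊕_α t •_α g) - J(f)) / t` exists and
equals the real number `L`. -/
def HasFirstVariation (α : ℝ) (f g : Eucl n → ℝ) (L : ℝ) : Prop :=
  Tendsto (fun t : ℝ => (totalMass (alphaComb α f g t) - totalMass f) / t) (𝓝[>] 0) (𝓝 L)

/-- The gradient of an extended-valued function; only used at points of `int (dom φ)`, where
`φ` is real-valued, at which `φ` is differentiable. -/
def grad (φ : Eucl n → EReal) (x : Eucl n) : Eucl n :=
  gradient (fun z => (φ z).toReal) x

/-- The support function `h_E(u) = sup_{y ∈ E} ⟨u, y⟩`. -/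
def supportFun (E : Set (Eucl n)) (u : Eucl n) : EReal :=
  ⨆ y ∈ E, ((inner ℝ u y : ℝ) : EReal)

/-- `u` is an outer unit normal vector of `K` at `x`. -/
def IsUnitNormal (K : Set (Eucl n)) (x u : Eucl n) : Prop :=
  ‖u‖ = 1 ∧ ∀ y ∈ K, inner ℝ y u ≤ (inner ℝ x u : ℝ)

open Classical in
/-- The Gauss map `ν_K`: the outer unit normal at `x` where it is unique (for a closed convex set
with nonempty interior, at almost every boundary point), and `0` elsewhere. -/
def gaussMap (K : Set (Eucl n)) (x : Eucl n) : Eucl n :=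
  if h : ∃! u, IsUnitNormal K x u then h.choose else 0

/-- Integrand `ψ*(∇φ(x)) f(x)^{1-α}` (which is `0` where `f = 0`). -/
def bulkIntegrand (α : ℝ) (φ ψ : Eucl n → EReal) (f : Eucl n → ℝ) (x : Eucl n) : ℝ :=
  (legendre ψ (grad φ x)).toReal * f x ^ (1 - α)

/-- Integrand `h_D(ν_K(x)) f(x)`, to be integrated over `∂K`. -/
def bdryIntegrand (K D : Set (Eucl n)) (f : Eucl n → ℝ) (x : Eucl n) : ℝ :=
  (supportFun D (gaussMap K x)).toReal * f x

/-- `ℋ^{n-1}` restricted to the boundary of `K`, normalised so that it is the usual surface area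
(Lebesgue measure on hyperplanes). -/
def bdryMeasure (K : Set (Eucl n)) : Measure (Eucl n) :=
  (Measure.euclideanHausdorffMeasure (n - 1) : Measure (Eucl n)).restrict (frontier K)

end

end AlphaConcave

open AlphaConcave

/-! Write φ_t = (φ* + tψ*)* and K for the closed support of f. At an interior point x of dom φ where
φ is differentiable, testing the slope ∇φ(x) bounds φ_t(x) below by φ(x) - tψ*(∇φ(x)), while φ_t(x)
≤ φ(x - ty) + tψ(y) for every y. Hence φ_t(x) has right derivative -ψ*(∇φ(x)) at t = 0, and (f_t -
f)/t tends to the bulk integrand (`Dominated.tendsto_Psi_slope`).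

Outside K the function f vanishes. If 0 is interior to K, write the outer points as (1 + tτ)z with z
∈ ∂K and τ > 0. At a smooth boundary point z with normal ν, f_t((1 + tτ)z) tends to f(z) when τ⟨z,
ν⟩ < h(ν) and to 0 when τ⟨z, ν⟩ > h(ν), where h is the support function of dom ψ
(`Dominated.tendsto_Psi_boundary`). Integrating over τ leaves f(z) times the positive part of
h(ν)/⟨z, ν⟩ against the cone measure of K, which has density ⟨z, ν⟩ with respect to surface measure
(`ConvexNhd.coneMeasure_eq`). This is the boundary integral.

The passage to the limit rests on ψ* ≤ β₁φ* + β₂. The right side dominates the conjugate of a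
dilation of φ, namely β₁φ(·/β₁) - β₂, so f_t lies below the function built from that dilation. For
it everything is explicit: φ_t becomes (1 + tβ₁)φ(·/(1 + tβ₁)) - tβ₂, and scaling differentiates the
mass. Dominated convergence with varying majorants (`tendsto_lintegral_of_le_of_tendsto`) then
applies, provided the derivative of the majorant's mass is the integral of its pointwise limits.
That equality is the divergence theorem for the field f(x)x, proved ray by ray
(`lintegral_coneMeasure_Psi`, `Dominated.lintegral_dilation_limit`).

This settles the case where 0 lies in int K and in dom ψ. In general one translates φ by a and ψ by
β₁a. The mass does not change, and the two integrals change by the terms of the divergence theorem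
for a constant field, which cancel. That theorem follows from the special case as well: applied to φ
paired with itself and to a translate of this pair, the formula computes one limit in two ways
(`HasVariation.hasDivergence`). -/

namespace AlphaConcave

noncomputable section

variable {n : ℕ}

/-! ### The generator Ψ_α and integrability of f -/

section Generator

variable {α : ℝ}

@[simp] lemma Psi_top : Psi α ⊤ = 0 := by simp [Psi]

lemma Psi_coe (r : ℝ) : Psi α (r : EReal) = (1 - α * r) ^ (1 / α) := by simp [Psi]

lemma one_sub_mul_pos (hα0 : α < 0) {r : ℝ} (h : 1 / α < r) : 0 < 1 - α * r := by
  have := mul_lt_mul_of_neg_left h hα0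
  rw [mul_one_div_cancel hα0.ne] at this
  linarith

lemma one_div_lt_coe_iff {r : ℝ} : ((1 / α : ℝ) : EReal) < (r : EReal) ↔ 1 / α < r :=
  EReal.coe_lt_coe_iff

lemma one_div_lt_of_nonneg (hα0 : α < 0) {s : EReal} (hs : 0 ≤ s) :
    ((1 / α : ℝ) : EReal) < s :=
  lt_of_lt_of_le (by exact_mod_cast one_div_neg.2 hα0) hs

lemma eq_top_or_coe_of_lt {s : EReal} {a : ℝ} (hs : (a : EReal) < s) :
    s = ⊤ ∨ ∃ r : ℝ, s = r ∧ a < r := by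
  induction s with
  | bot => simp at hs
  | top => exact Or.inl rfl
  | coe r => exact Or.inr ⟨r, rfl, by exact_mod_cast hs⟩

lemma Psi_pos (hα0 : α < 0) {r : ℝ} (h : 1 / α < r) : 0 < Psi α (r : EReal) := by
  rw [Psi_coe]; exact Real.rpow_pos_of_pos (one_sub_mul_pos hα0 h) _

lemma Psi_nonneg (hα0 : α < 0) {s : EReal} (h : ((1 / α : ℝ) : EReal) < s) : 0 ≤ Psi α s := by
  obtain rfl | ⟨r, rfl, hr⟩ := eq_top_or_coe_of_lt h
  · simp
  · exact (Psi_pos hα0 hr).le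

lemma Psi_eq_zero_iff (hα0 : α < 0) {s : EReal} (h : ((1 / α : ℝ) : EReal) < s) :
    Psi α s = 0 ↔ s = ⊤ := by
  obtain rfl | ⟨r, rfl, hr⟩ := eq_top_or_coe_of_lt h
  · simp
  · simp [(Psi_pos hα0 hr).ne']

lemma Psi_anti (hα0 : α < 0) {s s' : EReal} (h : ((1 / α : ℝ) : EReal) < s) (hs : s ≤ s') :
    Psi α s' ≤ Psi α s := by
  obtain rfl | ⟨r', rfl, hr'⟩ := eq_top_or_coe_of_lt (h.trans_le hs)
  · simpa using Psi_nonneg hα0 h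
  obtain rfl | ⟨r, rfl, hr⟩ := eq_top_or_coe_of_lt h
  · simp at hs
  rw [Psi_coe, Psi_coe]
  refine Real.rpow_le_rpow_of_nonpos (one_sub_mul_pos hα0 hr) ?_ (one_div_neg.2 hα0).le
  have : r ≤ r' := by exact_mod_cast hs
  nlinarith

lemma hasDerivAt_Psi (hα0 : α < 0) {r : ℝ} (h : 1 / α < r) :
    HasDerivAt (fun r : ℝ => Psi α (r : EReal)) (-(Psi α (r : EReal)) ^ (1 - α)) r := by
  have h1 : HasDerivAt (fun r : ℝ => 1 - α * r) (-α) r := by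
    simpa using ((hasDerivAt_id r).const_mul α).const_sub 1
  have h2 := h1.rpow_const (p := 1 / α) (Or.inl (one_sub_mul_pos hα0 h).ne')
  simp only [Psi_coe]
  convert h2 using 1
  rw [← Real.rpow_mul (one_sub_mul_pos hα0 h).le, mul_sub,
    one_div_mul_cancel hα0.ne, mul_one, neg_mul, mul_one_div_cancel hα0.ne]
  ring

lemma continuousAt_Psi (hα0 : α < 0) {s : EReal} (h : ((1 / α : ℝ) : EReal) < s) :
    ContinuousAt (Psi α) s := by
  obtain rfl | ⟨r, rfl, hr⟩ := eq_top_or_coe_of_lt h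
  · rw [ContinuousAt, Psi_top]
    have hlim : Tendsto (fun r : ℝ => (1 - α * r) ^ (1 / α)) atTop (𝓝 0) := by
      have h1 : Tendsto (fun r : ℝ => 1 - α * r) atTop atTop := by
        have h0 : Tendsto (fun r : ℝ => (-α) * r) atTop atTop :=
          tendsto_id.const_mul_atTop (by linarith)
        exact (tendsto_atTop_add_const_left _ 1 h0).congr fun r => by ring
      have := (tendsto_rpow_neg_atTop (y := -(1 / α)) (by
        have := one_div_neg.2 hα0; linarith)).comp h1
      simpa [Function.comp_def] using this
    rw [Metric.tendsto_nhds]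
    intro ε hε
    obtain ⟨R, hR⟩ := eventually_atTop.1 ((tendsto_order.1 hlim).2 ε hε)
    have hR' : ∀ᶠ s : EReal in 𝓝 ⊤, ((max R 0 : ℝ) : EReal) < s :=
      lt_mem_nhds (EReal.coe_lt_top _)
    filter_upwards [hR'] with s hs
    have h0 : ((1 / α : ℝ) : EReal) < ((max R 0 : ℝ) : EReal) :=
      one_div_lt_of_nonneg hα0 (by exact_mod_cast le_max_right _ _)
    have h1 := Psi_anti hα0 h0 hs.le
    have h2 := hR (max R 0) (le_max_left _ _)
    rw [← Psi_coe] at h2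
    rw [Real.dist_eq, sub_zero, abs_of_nonneg (Psi_nonneg hα0 (h0.trans hs))]
    linarith
  · rw [ContinuousAt, EReal.nhds_coe]
    exact (hasDerivAt_Psi hα0 hr).continuousAt.tendsto

lemma measurable_Psi : Measurable (Psi α) := by
  unfold Psi
  refine Measurable.ite (measurableSet_singleton _) measurable_const ?_
  exact ((measurable_ereal_toReal.const_mul α).const_sub 1).pow_const _

lemma rpow_one_sub_isBigO (p : ℝ) :
    ∃ C > 0, ∃ δ > 0, ∀ y : ℝ, |y| < δ → |(1 + y) ^ p - 1| ≤ C * |y| := by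
  have h : HasDerivAt (fun y : ℝ => (1 + y) ^ p) (1 * p * (1 + 0) ^ (p - 1)) 0 :=
    ((hasDerivAt_id (0 : ℝ)).const_add 1).rpow_const (Or.inl (by norm_num))
  have h1 := h.differentiableAt.isBigO_sub
  obtain ⟨C, hC, hb⟩ := h1.exists_pos
  rw [Asymptotics.isBigOWith_iff] at hb
  obtain ⟨δ, hδ, hb⟩ := Metric.eventually_nhds_iff.1 hb
  refine ⟨C, hC, δ, hδ, fun y hy => ?_⟩
  simpa using hb (y := y) (by simpa using hy)

/-- Uniform first-order control of `Ψ_α` under the perturbation `s ↦ (1 + t b) s - t c`. -/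
lemma exists_abs_Psi_sub_le (hα0 : α < 0) {b : ℝ} (hb : 0 ≤ b) (c : ℝ) :
    ∃ C > 0, ∃ δ > 0, ∀ t : ℝ, 0 < t → t < δ → ∀ s : EReal, 0 ≤ s →
      ((1 / α : ℝ) : EReal) < ((1 + t * b : ℝ) : EReal) * s - ((t * c : ℝ) : EReal) ∧
      |Psi α (((1 + t * b : ℝ) : EReal) * s - ((t * c : ℝ) : EReal)) - Psi α s|
        ≤ C * t * Psi α s := by
  obtain ⟨C, hC, δ, hδ, H⟩ := rpow_one_sub_isBigO (1 / α)
  have hM : 0 < b + |α| * |c| + 1 := by positivity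
  -- The factor `b + |α| * |c| + 1` will bound |y| / t for the relative perturbation y; its last
  -- summand only keeps it positive. The range of t forces |y| < δ, as `H` requires, and |y| < 1, so
  -- that 1 + y > 0.
  refine ⟨C * (b + |α| * |c| + 1), by positivity,
    min δ 1 / (b + |α| * |c| + 1), by positivity, fun t ht0 htδ s hs => ?_⟩
  obtain rfl | ⟨r, rfl, hr⟩ := eq_top_or_coe_of_lt (one_div_lt_of_nonneg hα0 hs)
  · rw [EReal.coe_mul_top_of_pos (by positivity), EReal.top_sub_coe]
    exact ⟨EReal.coe_lt_top _, by simp⟩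
  have hr0 : 0 ≤ r := by exact_mod_cast hs
  have htM : t * (b + |α| * |c| + 1) < min δ 1 := by rwa [lt_div_iff₀ hM] at htδ
  have hcast : ((1 + t * b : ℝ) : EReal) * (r : EReal) - ((t * c : ℝ) : EReal)
      = (((1 + t * b) * r - t * c : ℝ) : EReal) := by push_cast; ring_nf
  rw [hcast]
  set A := 1 - α * r with hA
  have hA1 : 1 ≤ A := by nlinarith
  -- the relative perturbation
  set y : ℝ := -α * t * (b * r - c) / A with hy
  have hyA : A * y = -α * t * (b * r - c) := by rw [hy]; field_simp
  -- The bound does not depend on r because A = 1 + |α| r dominates both |α| r and 1.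
  have hyabs : |y| ≤ t * (b + |α| * |c| + 1) := by
    have : |A * y| ≤ A * (t * (b + |α| * |c| + 1)) := by
      rw [hyA, abs_mul, abs_mul, abs_neg, abs_of_pos ht0]
      have h1 : |b * r - c| ≤ b * r + |c| := by
        refine (abs_sub _ _).trans ?_
        rw [abs_of_nonneg (by positivity)]
      have h2 : |α| * r ≤ A := by rw [abs_of_neg hα0]; linarith
      calc |α| * t * |b * r - c| ≤ |α| * t * (b * r + |c|) := by gcongr
        _ = t * (b * (|α| * r) + |α| * |c| * 1) := by ring
        _ ≤ t * (b * A + |α| * |c| * A) := by gcongr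
        _ ≤ A * (t * (b + |α| * |c| + 1)) := by nlinarith [mul_pos ht0 (by linarith : 0 < A)]
    rw [abs_mul, abs_of_pos (by linarith : 0 < A)] at this
    exact le_of_mul_le_mul_left this (by linarith)
  have hylt : |y| < min δ 1 := hyabs.trans_lt htM
  have hy1 : 0 < 1 + y := by
    have := (abs_lt.1 (hylt.trans_le (min_le_right _ _))).1; linarith
  have hkey : 1 - α * ((1 + t * b) * r - t * c) = A * (1 + y) := by
    rw [mul_add, hyA, hA]; ring
  have hpos : 0 < A * (1 + y) := by positivity
  refine ⟨?_, ?_⟩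
  · rw [one_div_lt_coe_iff, div_lt_iff_of_neg hα0]
    nlinarith
  · rw [Psi_coe, Psi_coe, hkey, Real.mul_rpow (by linarith) hy1.le, ← hA]
    have hAp : 0 ≤ A ^ (1 / α) := Real.rpow_nonneg (by linarith) _
    rw [show A ^ (1 / α) * (1 + y) ^ (1 / α) - A ^ (1 / α)
      = A ^ (1 / α) * ((1 + y) ^ (1 / α) - 1) by ring, abs_mul, abs_of_nonneg hAp]
    have := H y (hylt.trans_le (min_le_left _ _))
    calc A ^ (1 / α) * |(1 + y) ^ (1 / α) - 1|
        ≤ A ^ (1 / α) * (C * (t * (b + |α| * |c| + 1))) := by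
          gcongr; exact this.trans (by gcongr)
      _ = _ := by ring

lemma base_Psi (hα0 : α < 0) {φ : Eucl n → EReal} (h : ∀ x, ((1 / α : ℝ) : EReal) < φ x) :
    base α (fun x => Psi α (φ x)) = φ := by
  funext x
  simp only [base]
  obtain hx | ⟨r, hx, hr⟩ := eq_top_or_coe_of_lt (h x)
  · simp [hx]
  · rw [hx, if_neg (Psi_pos hα0 hr).ne', Psi_coe, ← Real.rpow_mul (one_sub_mul_pos hα0 hr).le,
      one_div_mul_cancel hα0.ne, Real.rpow_one]
    congr 1
    rw [sub_sub_cancel, mul_div_cancel_left₀ _ hα0.ne]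

lemma support_Psi (hα0 : α < 0) {φ : Eucl n → EReal} (h : ∀ x, ((1 / α : ℝ) : EReal) < φ x) :
    Function.support (fun x => Psi α (φ x)) = dom φ := by
  ext x
  simp [dom, Psi_eq_zero_iff hα0 (h x), lt_top_iff_ne_top]

lemma tsupport_Psi (hα0 : α < 0) {φ : Eucl n → EReal} (h : ∀ x, ((1 / α : ℝ) : EReal) < φ x) :
    tsupport (fun x => Psi α (φ x)) = closure (dom φ) := by
  rw [tsupport, support_Psi hα0 h]

lemma exists_affine_le_of_coercive {φ : Eucl n → EReal} (h0 : ∀ x, 0 ≤ φ x) (h : Coercive φ) :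
    ∃ c > 0, ∃ d ≥ 0, ∀ x, ((c * ‖x‖ - d : ℝ) : EReal) ≤ φ x := by
  obtain ⟨c, hc0, hc⟩ := EReal.lt_iff_exists_real_btwn.1 h
  have hc0' : 0 < c := by exact_mod_cast hc0
  have h1 := eventually_lt_of_lt_liminf hc
  rw [← comap_norm_atTop, eventually_comap, eventually_atTop] at h1
  obtain ⟨R, hR⟩ := h1
  refine ⟨c, hc0', c * max R 1, by positivity, fun x => ?_⟩
  by_cases hx : max R 1 ≤ ‖x‖
  · have h2 := hR ‖x‖ ((le_max_left _ _).trans hx) x rfl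
    have hpos : (0 : EReal) < ((‖x‖ : ℝ) : EReal) := by
      exact_mod_cast lt_of_lt_of_le (by positivity) hx
    have h3 := (EReal.le_div_iff_mul_le hpos (EReal.coe_ne_top _)).1 h2.le
    refine le_trans ?_ h3
    rw [← EReal.coe_mul]
    exact_mod_cast by nlinarith [le_max_right R 1]
  · refine le_trans ?_ (h0 x)
    have : c * ‖x‖ - c * max R 1 ≤ 0 := by nlinarith
    exact_mod_cast this

/-- Coercivity gives f at most a multiple of (1 + ‖x‖)^{1/α}, and -1/n < α < 0 says exactly that the
decay exponent -1/α exceeds n. -/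
lemma integrable_Psi (hn : 1 ≤ n) (hα : -(1 / (n : ℝ)) < α) (hα0 : α < 0)
    {φ : Eucl n → EReal} (hm : Measurable φ) (h0 : ∀ x, 0 ≤ φ x) (h : Coercive φ) :
    Integrable (fun x => Psi α (φ x)) := by
  obtain ⟨c, hc, d, hd, H⟩ := exists_affine_le_of_coercive h0 h
  have hn0 : (0 : ℝ) < n := by exact_mod_cast hn
  have hr : ((Module.finrank ℝ (Eucl n) : ℕ) : ℝ) < -(1 / α) := by
    rw [finrank_euclideanSpace_fin, lt_neg, div_lt_iff_of_neg hα0]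
    have : -(1 / (n : ℝ)) * n = -1 := by field_simp
    nlinarith
  set a := -α * c
  set e := -α * d
  have ha : 0 < a := mul_pos (by linarith) hc
  have he : 0 ≤ e := mul_nonneg (by linarith) hd
  have hint := ((integrable_one_add_norm (μ := (volume : Measure (Eucl n))) hr).const_mul
    ((a / (1 + e + a)) ^ (1 / α)))
  refine hint.mono' (measurable_Psi.comp hm).aestronglyMeasurable (Eventually.of_forall fun x => ?_)
  have hx := one_div_lt_of_nonneg hα0 (h0 x)
  rw [Real.norm_of_nonneg (Psi_nonneg hα0 hx), neg_neg]
  obtain hx | ⟨r, hx, hr⟩ := eq_top_or_coe_of_lt hx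
  · rw [hx, Psi_top]; positivity
  rw [hx, Psi_coe, ← Real.mul_rpow (by positivity) (by positivity)]
  refine Real.rpow_le_rpow_of_nonpos (by positivity) ?_ (one_div_neg.2 hα0).le
  have hr0 : 0 ≤ r := by have := h0 x; rw [hx] at this; exact_mod_cast this
  have hr1 : c * ‖x‖ - d ≤ r := by have := H x; rw [hx] at this; exact_mod_cast this
  -- With X = 1 - αr, the bounds X ≥ 1 and X ≥ a‖x‖ - e give a(1 + ‖x‖) ≤ a + e + X ≤ (1 + e + a)X.
  rw [div_mul_eq_mul_div, div_le_iff₀ (by positivity)]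
  have h1 : 1 ≤ 1 - α * r := by nlinarith
  have h2 : a * ‖x‖ - e ≤ 1 - α * r := by simp only [a, e]; nlinarith
  nlinarith

end Generator


/-! ### Conjugates, affine minorants and bounds for (φ* + tψ*)* -/

section Conjugate

variable {φ ψ : Eucl n → EReal}

lemma le_legendre (φ : Eucl n → EReal) (x y : Eucl n) :
    ((inner ℝ x y : ℝ) : EReal) - φ x ≤ legendre φ y :=
  le_iSup (fun x : Eucl n => ((inner ℝ x y : ℝ) : EReal) - φ x) x

lemma legendre_le_coe_iff {q : Eucl n} {a : ℝ} (hb : ∀ x, φ x ≠ ⊥) :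
    legendre φ q ≤ (a : EReal) ↔ ∀ (x : Eucl n) (r : ℝ), φ x = r → inner ℝ x q - r ≤ a := by
  refine ⟨fun h x r hr => ?_, fun h => iSup_le fun x => ?_⟩
  · have := (le_legendre φ x q).trans h
    rw [hr] at this
    exact_mod_cast this
  · have hx := hb x
    generalize hs : φ x = s at hx
    induction s with
    | bot => exact absurd rfl hx
    | top => simp
    | coe r => exact_mod_cast h x r hs

lemma exists_coe_of_mem_dom (hb : ∀ x, φ x ≠ ⊥) {x : Eucl n} (hx : x ∈ dom φ) :
    ∃ r : ℝ, φ x = r :=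
  ⟨(φ x).toReal, (EReal.coe_toReal (ne_of_lt hx) (hb x)).symm⟩

lemma IsConv.exists_coe (hφ : IsConv φ) {x : Eucl n} (hx : x ∈ dom φ) :
    ∃ r : ℝ, φ x = r :=
  exists_coe_of_mem_dom hφ.ne_bot hx

lemma mem_dom_of_eq {x : Eucl n} {r : ℝ} (h : φ x = r) : x ∈ dom φ := by
  simp [dom, h]

lemma mem_dom_of_le {x : Eucl n} {r : ℝ} (h : φ x ≤ (r : EReal)) : x ∈ dom φ :=
  lt_of_le_of_lt h (EReal.coe_lt_top r)

lemma legendre_ne_bot (hb : ∀ x, φ x ≠ ⊥) (hd : (dom φ).Nonempty) (q : Eucl n) :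
    legendre φ q ≠ ⊥ := by
  obtain ⟨x, hx⟩ := hd
  obtain ⟨r, hr⟩ := exists_coe_of_mem_dom hb hx
  have := le_legendre φ x q
  rw [hr] at this
  intro h
  rw [h, le_bot_iff] at this
  exact EReal.coe_ne_bot _ this

lemma IsConv.convex_le (hφ : IsConv φ) {x y : Eucl n} {r s a b : ℝ} (ha : 0 ≤ a) (hb : 0 ≤ b)
    (hab : a + b = 1) (hx : φ x ≤ (r : EReal)) (hy : φ y ≤ (s : EReal)) :
    φ (a • x + b • y) ≤ ((a * r + b * s : ℝ) : EReal) := by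
  refine (hφ.convex x y a b ha hb hab).trans ?_
  push_cast
  refine add_le_add (mul_le_mul_of_nonneg_left hx ?_) (mul_le_mul_of_nonneg_left hy ?_)
  · exact_mod_cast ha
  · exact_mod_cast hb

lemma IsConv.convex_dom (hφ : IsConv φ) : Convex ℝ (dom φ) := by
  intro x hx y hy a b ha hb hab
  obtain ⟨r, hr⟩ := hφ.exists_coe hx
  obtain ⟨s, hs⟩ := hφ.exists_coe hy
  exact mem_dom_of_le (hφ.convex_le ha hb hab hr.le hs.le)

lemma IsConv.segment_le (hφ : IsConv φ) {z v : Eucl n} {a r δ t : ℝ} (hδ : 0 < δ) (ht : 0 ≤ t)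
    (htδ : t ≤ δ) (hz : φ z ≤ (a : EReal)) (hw : φ (z + δ • v) ≤ (r : EReal)) :
    φ (z + t • v) ≤ (((1 - t / δ) * a + t / δ * r : ℝ) : EReal) := by
  have h1 : t / δ ≤ 1 := by rw [div_le_one hδ]; exact htδ
  have := hφ.convex_le (a := 1 - t / δ) (b := t / δ) (by linarith) (by positivity) (by ring) hz hw
  convert this using 2
  rw [smul_add, smul_smul, div_mul_cancel₀ _ hδ.ne', ← add_assoc, ← add_smul]
  simp

lemma isClosed_epigraph_real (hφ : LowerSemicontinuous φ) :
    IsClosed {p : Eucl n × ℝ | φ p.1 ≤ (p.2 : EReal)} := by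
  have h := hφ.isClosed_epigraph
  exact h.preimage (f := fun p : Eucl n × ℝ => (p.1, (p.2 : EReal)))
    (continuous_fst.prodMk (continuous_coe_real_ereal.comp continuous_snd))

/-- Fenchel–Moreau: every number below `φ x` is exceeded by an affine minorant of `φ` at `x`. -/
lemma exists_affine_minorant (hφ : IsConv φ) (h0 : ∀ x, 0 ≤ φ x) {x : Eucl n} {M : ℝ}
    (hM : (M : EReal) < φ x) :
    ∃ (q : Eucl n) (a : ℝ), legendre φ q ≤ (a : EReal) ∧ M < inner ℝ x q - a := by
  set S : Set (Eucl n × ℝ) := {p | φ p.1 ≤ (p.2 : EReal)} with hS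
  have hconv : Convex ℝ S := by
    rintro ⟨x, r⟩ hx ⟨y, s⟩ hy a b ha hb hab
    exact hφ.convex_le ha hb hab hx hy
  have hnot : (x, M) ∉ S := by simpa [hS] using hM
  obtain ⟨g, u, hgu, hg⟩ :=
    geometric_hahn_banach_point_closed hconv (isClosed_epigraph_real hφ.lsc) hnot
  set v : Eucl n := (InnerProductSpace.toDual ℝ (Eucl n)).symm
    (g.comp (ContinuousLinearMap.inl ℝ (Eucl n) ℝ)) with hv
  set c : ℝ := g (0, 1) with hc
  have hgv : ∀ (y : Eucl n) (s : ℝ), g (y, s) = inner ℝ y v + s * c := by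
    intro y s
    have h1 : g (y, s) = g (y, 0) + s • g (0, 1) := by
      rw [← map_smul, ← map_add]; simp
    have h2 : inner ℝ y v = g (y, 0) := by
      rw [real_inner_comm, hv, InnerProductSpace.toDual_symm_apply]; simp
    rw [h1, h2, smul_eq_mul]
  rw [hgv] at hgu
  have hg' : ∀ (y : Eucl n) (s : ℝ), φ y ≤ (s : EReal) → u < inner ℝ y v + s * c := by
    intro y s hys
    rw [← hgv]; exact hg (y, s) hys
  have hc0 : 0 ≤ c := by
    by_contra! hneg
    obtain ⟨y, hy⟩ := hφ.dom_nonempty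
    obtain ⟨r, hr⟩ := hφ.exists_coe hy
    set s := max r ((u - inner ℝ y v) / c)
    have h1 := hg' y s (by rw [hr]; exact_mod_cast le_max_left _ _)
    have h2 : s * c ≤ u - inner ℝ y v := by
      have : (u - inner ℝ y v) / c ≤ s := le_max_right _ _
      rwa [div_le_iff_of_neg hneg] at this
    linarith
  -- If c = 0 the separating hyperplane is vertical and x is cut off from dom φ. Since φ ≥ 0, every
  -- multiple k(u - ⟨·, v⟩) with k ≥ 0 is an affine minorant, being negative on dom φ, and k is
  -- chosen large enough to exceed M at x. If c > 0, dividing by c turns the hyperplane into the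
  -- graph of a minorant.
  rcases hc0.eq_or_lt with hc0 | hc0
  · rw [← hc0] at hgu hg'
    simp only [mul_zero, add_zero] at hgu hg'
    set k : ℝ := (|M| + 1) / (u - inner ℝ x v) with hk
    have hpos : 0 < u - inner ℝ x v := by linarith
    have hk0 : 0 ≤ k := by positivity
    refine ⟨-(k • v), -(k * u), (legendre_le_coe_iff hφ.ne_bot).2 fun y r hr => ?_, ?_⟩
    · have h1 := hg' y r hr.le
      have h2 : 0 ≤ r := by have := h0 y; rw [hr] at this; exact_mod_cast this
      rw [inner_neg_right, real_inner_smul_right]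
      nlinarith
    · rw [inner_neg_right, real_inner_smul_right]
      have : k * (u - inner ℝ x v) = |M| + 1 := by rw [hk]; field_simp
      have := le_abs_self M
      nlinarith
  · refine ⟨-(c⁻¹ • v), -(u / c), (legendre_le_coe_iff hφ.ne_bot).2 fun y r hr => ?_, ?_⟩
    · have h1 := hg' y r hr.le
      rw [inner_neg_right, real_inner_smul_right, le_neg, neg_sub, sub_neg_eq_add, div_le_iff₀ hc0]
      have : (r + c⁻¹ * inner ℝ y v) * c = inner ℝ y v + r * c := by field_simp; ring
      rw [this]; exact h1.le
    · rw [inner_neg_right, real_inner_smul_right]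
      have : (-(c⁻¹ * inner ℝ x v) - -(u / c)) = (u - inner ℝ x v) / c := by field_simp; ring
      rw [this, lt_div_iff₀ hc0]
      linarith

/-- The outer supremum is tested at a single slope q. All lower bounds for (φ* + tψ*)* are obtained
this way. -/
lemma le_combBase {t : ℝ} (ht : 0 ≤ t) {q x : Eucl n} {a b : ℝ}
    (ha : legendre φ q ≤ (a : EReal)) (hb : legendre ψ q ≤ (b : EReal)) :
    ((inner ℝ x q - a - t * b : ℝ) : EReal) ≤ combBase φ ψ t x := by
  refine le_trans ?_ (le_legendre _ q x)
  have h1 : legendre φ q + (t : EReal) * legendre ψ q ≤ ((a + t * b : ℝ) : EReal) := by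
    push_cast
    exact add_le_add ha (mul_le_mul_of_nonneg_left hb (by exact_mod_cast ht))
  refine le_trans ?_ (EReal.sub_le_sub le_rfl h1)
  rw [real_inner_comm, ← EReal.coe_sub]
  exact_mod_cast (by linarith : inner ℝ q x - a - t * b ≤ inner ℝ q x - (a + t * b))

/-- The Fenchel–Young inequalities of φ at x - ty and of ψ at y, added with weights 1 and t, bound
every term of the supremum. So (φ* + tψ*)* is at most the infimal convolution; equality with it is
never needed. -/
lemma combBase_le_coe {t : ℝ} (ht : 0 ≤ t) {x y : Eucl n} {a b : ℝ}
    (ha : φ (x - t • y) = (a : EReal)) (hb : ψ y = (b : EReal)) :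
    combBase φ ψ t x ≤ ((a + t * b : ℝ) : EReal) := by
  refine iSup_le fun z => ?_
  have h1 : ((inner ℝ (x - t • y) z - a : ℝ) : EReal) ≤ legendre φ z := by
    have := le_legendre φ (x - t • y) z
    rwa [ha, ← EReal.coe_sub] at this
  have h2 : ((inner ℝ y z - b : ℝ) : EReal) ≤ legendre ψ z := by
    have := le_legendre ψ y z
    rwa [hb, ← EReal.coe_sub] at this
  have h3 : ((inner ℝ (x - t • y) z - a + t * (inner ℝ y z - b) : ℝ) : EReal) ≤
      legendre φ z + (t : EReal) * legendre ψ z := by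
    push_cast
    exact add_le_add h1 (mul_le_mul_of_nonneg_left h2 (by exact_mod_cast ht))
  refine (EReal.sub_le_sub le_rfl h3).trans ?_
  rw [← EReal.coe_sub, inner_sub_left, real_inner_smul_left, real_inner_comm z x]
  exact_mod_cast (by linarith)

lemma combBase_le {t : ℝ} (ht : 0 ≤ t) {x y : Eucl n} {b : ℝ} (hφb : φ (x - t • y) ≠ ⊥)
    (hb : ψ y = (b : EReal)) :
    combBase φ ψ t x ≤ φ (x - t • y) + ((t * b : ℝ) : EReal) := by
  generalize hs : φ (x - t • y) = s at hφb ⊢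
  induction s with
  | bot => exact absurd rfl hφb
  | top => rw [EReal.top_add_coe]; exact le_top
  | coe a => rw [← EReal.coe_add]; exact combBase_le_coe ht hs hb

lemma lowerSemicontinuous_legendre (φ : Eucl n → EReal) :
    LowerSemicontinuous (legendre φ) := by
  refine lowerSemicontinuous_iSup fun x => Continuous.lowerSemicontinuous ?_
  have hc : Continuous fun y : Eucl n => ((inner ℝ x y : ℝ) : EReal) :=
    continuous_coe_real_ereal.comp (by fun_prop)
  generalize φ x = s
  induction s with
  | bot => simpa using continuous_const
  | top => simpa using continuous_const
  | coe a =>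
    simp_rw [← EReal.coe_sub]
    exact continuous_coe_real_ereal.comp (by fun_prop)

lemma measurable_legendre (φ : Eucl n → EReal) : Measurable (legendre φ) :=
  (lowerSemicontinuous_legendre φ).measurable

lemma measurable_combBase (φ ψ : Eucl n → EReal) (t : ℝ) : Measurable (combBase φ ψ t) :=
  measurable_legendre _

end Conjugate

/-! ### The domination hypothesis ψ* ≤ β₁φ* + β₂ -/

section Domination

variable {φ ψ : Eucl n → EReal} {β₁ β₂ : ℝ}

/-- `φ` and `ψ` with `φ ≥ 0` and `ψ* ≤ β₁ φ* + β₂`. -/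
structure Dominated (φ ψ : Eucl n → EReal) (β₁ β₂ : ℝ) : Prop where
  conv : IsConv φ
  nonneg : ∀ x, 0 ≤ φ x
  ne_bot' : ∀ y, ψ y ≠ ⊥
  dom_nonempty' : (dom ψ).Nonempty
  pos : 0 < β₁
  le : ∀ q, legendre ψ q ≤ (β₁ : EReal) * legendre φ q + (β₂ : EReal)

namespace Dominated

lemma le_coe (h : Dominated φ ψ β₁ β₂) {q : Eucl n} {a : ℝ} (ha : legendre φ q ≤ (a : EReal)) :
    legendre ψ q ≤ ((β₁ * a + β₂ : ℝ) : EReal) := by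
  refine (h.le q).trans ?_
  push_cast
  exact add_le_add (mul_le_mul_of_nonneg_left ha (by exact_mod_cast h.pos.le)) le_rfl

lemma legendre_zero_le (h : Dominated φ ψ β₁ β₂) : legendre φ 0 ≤ ((0 : ℝ) : EReal) := by
  refine (legendre_le_coe_iff h.conv.ne_bot).2 fun x r hr => ?_
  have := h.nonneg x
  rw [hr] at this
  have h2 : 0 ≤ r := by exact_mod_cast this
  simpa using h2

/-- `ψ` is bounded below. -/
lemma neg_le (h : Dominated φ ψ β₁ β₂) {y : Eucl n} {r : ℝ} (hr : ψ y = r) : -β₂ ≤ r := by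
  have := (legendre_le_coe_iff h.ne_bot').1 (h.le_coe h.legendre_zero_le) y r hr
  simp at this
  linarith

/-- An affine minorant of φ with slope q and φ*(q) ≤ a has ψ*(q) ≤ β₁a + β₂. Testing q at x = (1 +
tβ₁)w gives (1 + tβ₁)(⟨w, q⟩ - a) - tβ₂, and the supremum over minorants recovers φ(w). -/
lemma dilation_le_combBase (h : Dominated φ ψ β₁ β₂) {t : ℝ} (ht : 0 ≤ t) (x : Eucl n) :
    ((1 + t * β₁ : ℝ) : EReal) * φ ((1 + t * β₁)⁻¹ • x) - ((t * β₂ : ℝ) : EReal) ≤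
      combBase φ ψ t x := by
  have hl : 0 < 1 + t * β₁ := by have := h.pos; positivity
  set w := (1 + t * β₁)⁻¹ • x with hw
  have hxw : x = (1 + t * β₁) • w := by rw [hw, smul_inv_smul₀ hl.ne']
  have key : ∀ M : ℝ, (M : EReal) < φ w →
      (((1 + t * β₁) * M - t * β₂ : ℝ) : EReal) ≤ combBase φ ψ t x := by
    intro M hM
    obtain ⟨q, a, ha, hMa⟩ := exists_affine_minorant h.conv h.nonneg hM
    refine le_trans ?_ (le_combBase ht ha (h.le_coe ha))
    rw [EReal.coe_le_coe_iff, hxw, real_inner_smul_left]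
    nlinarith
  have hb := h.conv.ne_bot w
  generalize hs : φ w = s at hb key ⊢
  induction s with
  | bot => exact absurd rfl hb
  | top =>
    rw [EReal.coe_mul_top_of_pos hl, EReal.top_sub_coe, top_le_iff]
    refine EReal.eq_top_iff_forall_lt _ |>.2 fun y => ?_
    refine lt_of_lt_of_le ?_ (key ((y + t * β₂ + 1) / (1 + t * β₁)) (EReal.coe_lt_top _))
    rw [mul_div_cancel₀ _ hl.ne']
    exact_mod_cast (by linarith)
  | coe r =>
    rw [← EReal.coe_mul, ← EReal.coe_sub]
    refine EReal.ge_of_forall_gt_iff_ge.1 fun z hz => ?_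
    have hz' : z < (1 + t * β₁) * r - t * β₂ := by exact_mod_cast hz
    have := key ((z + t * β₂) / (1 + t * β₁)) (by
      rw [EReal.coe_lt_coe_iff, div_lt_iff₀ hl]; linarith)
    rwa [mul_div_cancel₀ _ hl.ne', add_sub_cancel_right] at this

end Dominated

end Domination


/-! ### The extremal comparison function, a dilation of φ -/

section Dilation

variable {φ : Eucl n → EReal} {β₁ β₂ : ℝ}

/-- The function `β₁ φ(· / β₁) - β₂`, whose conjugate is `β₁ φ* + β₂`. -/
def dilation (β₁ β₂ : ℝ) (φ : Eucl n → EReal) (y : Eucl n) : EReal :=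
  (β₁ : EReal) * φ (β₁⁻¹ • y) - (β₂ : EReal)

lemma dilation_of_eq {y : Eucl n} {r : ℝ} (h : φ (β₁⁻¹ • y) = r) :
    dilation β₁ β₂ φ y = ((β₁ * r - β₂ : ℝ) : EReal) := by
  rw [dilation, h]; push_cast; rfl

lemma dilation_smul_of_eq (hβ : 0 < β₁) {y : Eucl n} {r : ℝ} (h : φ y = r) :
    dilation β₁ β₂ φ (β₁ • y) = ((β₁ * r - β₂ : ℝ) : EReal) :=
  dilation_of_eq (by rwa [inv_smul_smul₀ hβ.ne'])

lemma dilation_cases (hβ : 0 < β₁) (hb : ∀ x, φ x ≠ ⊥) (y : Eucl n) :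
    dilation β₁ β₂ φ y = ⊤ ∨
      ∃ r : ℝ, φ (β₁⁻¹ • y) = r ∧ dilation β₁ β₂ φ y = ((β₁ * r - β₂ : ℝ) : EReal) := by
  have h := hb (β₁⁻¹ • y)
  rcases eq_or_ne (φ (β₁⁻¹ • y)) ⊤ with h' | h'
  · left
    rw [dilation, h', EReal.coe_mul_top_of_pos hβ, EReal.top_sub_coe]
  · right
    refine ⟨_, (EReal.coe_toReal h' h).symm, dilation_of_eq (EReal.coe_toReal h' h).symm⟩

lemma mem_dom_dilation (hβ : 0 < β₁) (hb : ∀ x, φ x ≠ ⊥) {y : Eucl n} :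
    y ∈ dom (dilation β₁ β₂ φ) ↔ β₁⁻¹ • y ∈ dom φ := by
  constructor
  · intro h
    obtain h' | ⟨r, hr, -⟩ := dilation_cases (β₂ := β₂) hβ hb y
    · exact absurd h' (ne_of_lt h)
    · exact mem_dom_of_eq hr
  · intro h
    obtain ⟨r, hr⟩ := exists_coe_of_mem_dom hb h
    exact mem_dom_of_eq (dilation_of_eq hr)

lemma dominated_dilation (hφ : IsConv φ) (h0 : ∀ x, 0 ≤ φ x) (hβ : 0 < β₁) (β₂ : ℝ) :
    Dominated φ (dilation β₁ β₂ φ) β₁ β₂ := by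
  have hnb : ∀ y, dilation β₁ β₂ φ y ≠ ⊥ := fun y => by
    obtain h | ⟨r, -, h⟩ := dilation_cases (β₂ := β₂) hβ hφ.ne_bot y <;> simp [h]
    exact EReal.coe_ne_bot (β₁ * r - β₂)
  refine ⟨hφ, h0, hnb, ?_, hβ, fun q => ?_⟩
  · obtain ⟨x, hx⟩ := hφ.dom_nonempty
    exact ⟨β₁ • x, (mem_dom_dilation hβ hφ.ne_bot).2 (by rwa [inv_smul_smul₀ hβ.ne'])⟩
  · have hb := legendre_ne_bot hφ.ne_bot hφ.dom_nonempty q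
    generalize hs : legendre φ q = s at hb
    induction s with
    | bot => exact absurd rfl hb
    | top => rw [EReal.coe_mul_top_of_pos hβ, EReal.top_add_coe]; exact le_top
    | coe a =>
      rw [← EReal.coe_mul, ← EReal.coe_add]
      refine (legendre_le_coe_iff hnb).2 fun y s hs' => ?_
      obtain h | ⟨r, hr, h⟩ := dilation_cases (β₂ := β₂) hβ hφ.ne_bot y
      · rw [h] at hs'; simp at hs'
      · rw [h] at hs'
        have h1 : β₁ * r - β₂ = s := by exact_mod_cast hs'
        have h2 := (legendre_le_coe_iff hφ.ne_bot).1 hs.le _ r hr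
        rw [real_inner_smul_left] at h2
        have h3 : inner ℝ y q = β₁ * (β₁⁻¹ * inner ℝ y q) := by field_simp
        rw [← h1, h3]
        nlinarith

lemma legendre_dilation_of_eq (hφ : IsConv φ) (h0 : ∀ x, 0 ≤ φ x) (hβ : 0 < β₁)
    {x q : Eucl n} {r : ℝ} (hr : φ x = r) (hq : legendre φ q ≤ ((inner ℝ x q - r : ℝ) : EReal)) :
    legendre (dilation β₁ β₂ φ) q = ((β₁ * (inner ℝ x q - r) + β₂ : ℝ) : EReal) := by
  refine le_antisymm ((dominated_dilation hφ h0 hβ β₂).le_coe hq) ?_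
  have := le_legendre (dilation β₁ β₂ φ) (β₁ • x) q
  rw [dilation_smul_of_eq hβ hr, ← EReal.coe_sub, real_inner_smul_left] at this
  convert this using 2
  ring

/-- The lower bound is the general one for dominated pairs. The upper bound comes from the splitting
x = w + t(β₁w) with w = x/(1 + tβ₁). -/
lemma combBase_dilation (hφ : IsConv φ) (h0 : ∀ x, 0 ≤ φ x) (hβ : 0 < β₁) {t : ℝ} (ht : 0 ≤ t)
    (x : Eucl n) :
    combBase φ (dilation β₁ β₂ φ) t x =
      ((1 + t * β₁ : ℝ) : EReal) * φ ((1 + t * β₁)⁻¹ • x) - ((t * β₂ : ℝ) : EReal) := by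
  have hl : 0 < 1 + t * β₁ := by positivity
  refine le_antisymm ?_ ((dominated_dilation hφ h0 hβ β₂).dilation_le_combBase ht x)
  have hx : x - t • (β₁ • ((1 + t * β₁)⁻¹ • x)) = (1 + t * β₁)⁻¹ • x := by
    have h1 : x = (1 + t * β₁) • (1 + t * β₁)⁻¹ • x := (smul_inv_smul₀ hl.ne' x).symm
    calc _ = (1 + t * β₁) • (1 + t * β₁)⁻¹ • x - t • (β₁ • ((1 + t * β₁)⁻¹ • x)) := by rw [← h1]
      _ = _ := by rw [smul_smul t, ← sub_smul]; simp
  set w := (1 + t * β₁)⁻¹ • x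
  have hb := hφ.ne_bot w
  generalize hs : φ w = s at hb ⊢
  induction s with
  | bot => exact absurd rfl hb
  | top => rw [EReal.coe_mul_top_of_pos hl, EReal.top_sub_coe]; exact le_top
  | coe r =>
    refine (combBase_le_coe ht (by rw [hx]; exact hs) (dilation_smul_of_eq hβ hs)).trans ?_
    rw [← EReal.coe_mul, ← EReal.coe_sub]
    exact_mod_cast (by linarith)

end Dilation

/-! ### Behaviour of φ_t near and beyond the boundary of dom φ -/

section BoundaryLimit

variable {φ ψ : Eucl n → EReal} {β₁ β₂ : ℝ}

namespace Dominated

/-- `φ_t → φ(z)` along curves `x_t → z` that come from the interior of the perturbed domain. -/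
lemma tendsto_combBase (h : Dominated φ ψ β₁ β₂) {z u y : Eucl n} {δ : ℝ} (hδ : 0 < δ)
    (hy : y ∈ dom ψ) (hw : z + δ • (u - y) ∈ dom φ) :
    Tendsto (fun t : ℝ => combBase φ ψ t (z + t • u)) (𝓝[>] 0) (𝓝 (φ z)) := by
  obtain ⟨b, hb⟩ := exists_coe_of_mem_dom h.ne_bot' hy
  obtain ⟨r, hr⟩ := h.conv.exists_coe hw
  rw [tendsto_order]
  constructor
  -- Affine minorants of φ at z are continuous along the curve. This half also covers φ(z) = ⊤.
  · intro c hc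
    obtain ⟨M, hcM, hM⟩ := EReal.lt_iff_exists_real_btwn.1 hc
    obtain ⟨q, a, ha, hMa⟩ := exists_affine_minorant h.conv h.nonneg hM
    have hlim : Tendsto (fun t : ℝ => inner ℝ (z + t • u) q - a - t * (β₁ * a + β₂)) (𝓝[>] 0)
        (𝓝 (inner ℝ (z + (0 : ℝ) • u) q - a - 0 * (β₁ * a + β₂))) := by
      refine tendsto_nhdsWithin_of_tendsto_nhds (Continuous.tendsto ?_ 0)
      fun_prop
    filter_upwards [hlim.eventually_const_lt (u := M) (by simpa using hMa),
      self_mem_nhdsWithin] with t ht ht0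
    refine hcM.trans (lt_of_lt_of_le ?_ (le_combBase (le_of_lt ht0) ha (h.le_coe ha)))
    exact_mod_cast ht
  -- Here φ(z) is finite. Splitting z + tu = (z + t(u - y)) + ty leaves φ on the segment from z to z
  -- + δ(u - y), where convexity bounds it by linear interpolation.
  · intro c hc
    obtain ⟨a, ha⟩ := h.conv.exists_coe (show z ∈ dom φ from hc.trans_le le_top)
    obtain ⟨M, haM, hM⟩ := EReal.lt_iff_exists_real_btwn.1 hc
    have haM' : a < M := by rw [ha] at haM; exact_mod_cast haM
    have hlim : Tendsto (fun t : ℝ => (1 - t / δ) * a + t / δ * r + t * b) (𝓝[>] 0)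
        (𝓝 ((1 - 0 / δ) * a + 0 / δ * r + 0 * b)) := by
      refine tendsto_nhdsWithin_of_tendsto_nhds (Continuous.tendsto ?_ 0)
      fun_prop
    filter_upwards [hlim.eventually_lt_const (u := M) (by simpa using haM'),
      self_mem_nhdsWithin, Ioo_mem_nhdsGT hδ] with t ht ht0 htδ
    have ht0 : 0 < t := ht0
    refine lt_of_le_of_lt ?_ hM
    have hz : z + t • u - t • y = z + t • (u - y) := by rw [smul_sub]; abel
    refine (combBase_le ht0.le (h.conv.ne_bot _) hb).trans ?_
    rw [hz]
    have h1 := h.conv.segment_le hδ ht0.le htδ.2.le ha.le hr.le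
    refine (add_le_add_left h1 _).trans ?_
    rw [← EReal.coe_add]
    exact_mod_cast ht.le

/-- Test the slopes su with s → ∞. Since φ ≥ 0 and ψ ≥ -β₂, φ*(su) ≤ sA and ψ*(su) ≤ sB + β₂, so the
resulting lower bounds grow linearly in s. -/
lemma combBase_eq_top (h : Dominated φ ψ β₁ β₂) {t : ℝ} (ht : 0 ≤ t) {x u : Eucl n} {A B : ℝ}
    (hA : ∀ y ∈ dom φ, inner ℝ y u ≤ A) (hB : ∀ y ∈ dom ψ, inner ℝ y u ≤ B)
    (hx : A + t * B < inner ℝ x u) : combBase φ ψ t x = ⊤ := by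
  have key : ∀ s : ℝ, 0 ≤ s →
      ((s * (inner ℝ x u - A - t * B) - t * β₂ : ℝ) : EReal) ≤ combBase φ ψ t x := by
    intro s hs
    have h1 : legendre φ (s • u) ≤ ((s * A : ℝ) : EReal) := by
      refine (legendre_le_coe_iff h.conv.ne_bot).2 fun y r hr => ?_
      have h2 : 0 ≤ r := by have := h.nonneg y; rw [hr] at this; exact_mod_cast this
      have h3 := hA y (mem_dom_of_eq hr)
      rw [real_inner_smul_right]
      nlinarith
    have h2 : legendre ψ (s • u) ≤ ((s * B + β₂ : ℝ) : EReal) := by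
      refine (legendre_le_coe_iff h.ne_bot').2 fun y r hr => ?_
      have h2 := h.neg_le hr
      have h3 := hB y (mem_dom_of_eq hr)
      rw [real_inner_smul_right]
      nlinarith
    refine le_trans ?_ (le_combBase ht h1 h2)
    rw [real_inner_smul_right]
    exact_mod_cast (by linarith)
  refine (EReal.eq_top_iff_forall_lt _).2 fun M => ?_
  have hpos : 0 < inner ℝ x u - A - t * B := by linarith
  refine lt_of_lt_of_le ?_ (key ((|M| + |t * β₂| + 1) / (inner ℝ x u - A - t * B))
    (by positivity))
  rw [div_mul_cancel₀ _ hpos.ne']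
  exact_mod_cast (by linarith [le_abs_self M, le_abs_self (t * β₂)])

end Dominated

end BoundaryLimit

/-! ### Differentiating φ_t and f_t in t at interior points -/

section InteriorLimit

variable {φ ψ : Eucl n → EReal} {β₁ β₂ : ℝ}

/-- The gradient of a convex function is a subgradient: the difference quotients of φ from x towards
y are at most φ(y) - φ(x), and so is their limit. -/
lemma IsConv.legendre_grad_le (hφ : IsConv φ) {x p : Eucl n} {a : ℝ} (ha : φ x = a)
    (hp : HasGradientAt (fun z => (φ z).toReal) p x) :
    legendre φ p ≤ ((inner ℝ x p - a : ℝ) : EReal) := by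
  refine (legendre_le_coe_iff hφ.ne_bot).2 fun y r hr => ?_
  have h1 : HasDerivWithinAt (fun s : ℝ => (φ (x + s • (y - x))).toReal) (inner ℝ p (y - x))
      (Ioi 0) 0 := by
    have h2 : HasDerivAt (fun s : ℝ => x + s • (y - x)) (y - x) 0 := by
      simpa using ((hasDerivAt_id (0 : ℝ)).smul_const (y - x)).const_add x
    have h3 := hp.hasFDerivAt
    rw [show x = x + (0 : ℝ) • (y - x) by simp] at h3
    have := h3.comp_hasDerivAt (0 : ℝ) h2
    simpa [Function.comp_def] using this.hasDerivWithinAt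
  rw [hasDerivWithinAt_iff_tendsto_slope' (by simp)] at h1
  have h2 : inner ℝ p (y - x) ≤ r - a := by
    refine le_of_tendsto h1 ?_
    filter_upwards [Ioo_mem_nhdsGT one_pos] with s hs
    rw [slope_def_field]
    simp only [zero_smul, add_zero, sub_zero, ha, EReal.toReal_coe]
    rw [div_le_iff₀ hs.1]
    have h3 := hφ.segment_le one_pos hs.1.le hs.2.le ha.le
      (show φ (x + (1 : ℝ) • (y - x)) ≤ (r : EReal) by simp [hr])
    have h4 := EReal.toReal_le_toReal h3 (hφ.ne_bot _) (EReal.coe_ne_top _)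
    rw [EReal.toReal_coe] at h4
    simp only [div_one] at h4
    linarith
  rw [inner_sub_right, real_inner_comm, real_inner_comm x p] at h2
  linarith

namespace Dominated

lemma exists_legendre_grad_eq (h : Dominated φ ψ β₁ β₂) {x p : Eucl n} {a : ℝ} (ha : φ x = a)
    (hp : HasGradientAt (fun z => (φ z).toReal) p x) : ∃ b : ℝ, legendre ψ p = b := by
  have h1 := h.le_coe (h.conv.legendre_grad_le ha hp)
  have h2 := legendre_ne_bot h.ne_bot' h.dom_nonempty' p
  exact ⟨_, (EReal.coe_toReal (ne_of_lt (h1.trans_lt (EReal.coe_lt_top _))) h2).symm⟩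

/-- From below the slope p gives a - tb for every t ≥ 0. From above φ(x - ty) + tψ(y) has right
derivative -(⟨y, p⟩ - ψ(y)), and y may be chosen with ⟨y, p⟩ - ψ(y) as close to b as desired. -/
lemma tendsto_combBase_slope (h : Dominated φ ψ β₁ β₂) {x p : Eucl n} {a b : ℝ} (ha : φ x = a)
    (hint : x ∈ interior (dom φ))
    (hp : HasGradientAt (fun z => (φ z).toReal) p x) (hb : legendre ψ p = b) :
    (∀ᶠ t : ℝ in 𝓝[>] 0, ∃ r : ℝ, combBase φ ψ t x = r) ∧
    Tendsto (fun t : ℝ => ((combBase φ ψ t x).toReal - a) / t) (𝓝[>] 0) (𝓝 (-b)) := by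
  have hlow : ∀ t : ℝ, 0 ≤ t → ((a - t * b : ℝ) : EReal) ≤ combBase φ ψ t x := by
    intro t ht
    have := le_combBase ht (x := x) (h.conv.legendre_grad_le ha hp) hb.le
    simpa using this
  have hup : ∀ (y : Eucl n) (c : ℝ), ψ y = c → ∀ᶠ t : ℝ in 𝓝[>] 0,
      combBase φ ψ t x ≤ (((φ (x - t • y)).toReal + t * c : ℝ) : EReal) := by
    intro y c hc
    have hcont : Tendsto (fun t : ℝ => x - t • y) (𝓝[>] 0) (𝓝 x) := by
      refine tendsto_nhdsWithin_of_tendsto_nhds ?_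
      have : Continuous fun t : ℝ => x - t • y := by fun_prop
      simpa using this.tendsto 0
    filter_upwards [hcont (mem_interior_iff_mem_nhds.1 hint), self_mem_nhdsWithin] with t ht ht0
    obtain ⟨r, hr⟩ := h.conv.exists_coe ht
    rw [hr, EReal.toReal_coe]
    exact combBase_le_coe (le_of_lt ht0) hr hc
  have hreal : ∀ᶠ t : ℝ in 𝓝[>] 0, ∃ r : ℝ, combBase φ ψ t x = r := by
    obtain ⟨y, hy⟩ := h.dom_nonempty'
    obtain ⟨c, hc⟩ := exists_coe_of_mem_dom h.ne_bot' hy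
    filter_upwards [hup y c hc, self_mem_nhdsWithin] with t ht ht0
    have h1 : combBase φ ψ t x ≠ ⊤ := ne_of_lt (ht.trans_lt (EReal.coe_lt_top _))
    have h2 : combBase φ ψ t x ≠ ⊥ := ne_of_gt ((EReal.bot_lt_coe _).trans_le
      (hlow t (le_of_lt ht0)))
    exact ⟨_, (EReal.coe_toReal h1 h2).symm⟩
  refine ⟨hreal, tendsto_order.2 ⟨fun m hm => ?_, fun m hm => ?_⟩⟩
  · filter_upwards [hreal, self_mem_nhdsWithin] with t ⟨r, hr⟩ ht0
    have ht0 : 0 < t := ht0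
    have h1 := hlow t ht0.le
    rw [hr] at h1 ⊢
    have h2 : a - t * b ≤ r := by exact_mod_cast h1
    rw [EReal.toReal_coe, lt_div_iff₀ ht0]
    nlinarith
  · have h1 : ((-m : ℝ) : EReal) < legendre ψ p := by
      rw [hb]; exact_mod_cast (by linarith)
    obtain ⟨y, hy⟩ := lt_iSup_iff.1 h1
    have hy' : y ∈ dom ψ := by
      by_contra hcon
      have : ψ y = ⊤ := by simpa [dom] using hcon
      rw [this] at hy
      simp at hy
    obtain ⟨c, hc⟩ := exists_coe_of_mem_dom h.ne_bot' hy'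
    rw [hc, ← EReal.coe_sub] at hy
    have hy2 : -m < inner ℝ y p - c := by exact_mod_cast hy
    have hd : HasDerivWithinAt (fun t : ℝ => (φ (x - t • y)).toReal) (-inner ℝ y p)
        (Ioi 0) 0 := by
      have h2 : HasDerivAt (fun s : ℝ => x - s • y) (-y) 0 := by
        simpa using ((hasDerivAt_id (0 : ℝ)).smul_const y).const_sub x
      have h3 := hp.hasFDerivAt
      rw [show x = x - (0 : ℝ) • y by simp] at h3
      have := h3.comp_hasDerivAt (0 : ℝ) h2
      simpa [Function.comp_def, real_inner_comm] using this.hasDerivWithinAt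
    rw [hasDerivWithinAt_iff_tendsto_slope' (by simp)] at hd
    filter_upwards [hreal, self_mem_nhdsWithin, hup y c hc,
      hd.eventually_lt_const (u := m - c) (by linarith)] with t ⟨r, hr⟩ ht0 h4 h5
    have ht0 : 0 < t := ht0
    rw [slope_def_field] at h5
    simp only [zero_smul, sub_zero, ha, EReal.toReal_coe] at h5
    rw [hr] at h4 ⊢
    have h6 : r ≤ (φ (x - t • y)).toReal + t * c := by exact_mod_cast h4
    rw [EReal.toReal_coe, div_lt_iff₀ ht0]
    rw [div_lt_iff₀ ht0] at h5
    linarith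

end Dominated

lemma tendsto_comp_slope {g h : ℝ → ℝ} {a m h' : ℝ}
    (hg : Tendsto (fun t => (g t - a) / t) (𝓝[>] 0) (𝓝 m)) (hh : HasDerivAt h h' a) :
    Tendsto (fun t => (h (g t) - h a) / t) (𝓝[>] 0) (𝓝 (h' * m)) := by
  -- The hypothesis says nothing about `g 0`, so this value is reset to `a` before the chain rule is
  -- used.
  have h1 : HasDerivWithinAt (Function.update g 0 a) m (Ioi 0) 0 := by
    rw [hasDerivWithinAt_iff_tendsto_slope' (by simp)]
    refine hg.congr' ?_
    filter_upwards [self_mem_nhdsWithin] with t ht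
    rw [slope_def_field, Function.update_self, Function.update_of_ne (ne_of_gt ht), sub_zero]
  have h2 : HasDerivAt h h' (Function.update g 0 a 0) := by simpa using hh
  have h3 := h2.comp_hasDerivWithinAt 0 h1
  rw [hasDerivWithinAt_iff_tendsto_slope' (by simp)] at h3
  refine h3.congr' ?_
  filter_upwards [self_mem_nhdsWithin] with t ht
  rw [slope_def_field, Function.comp, Function.comp, Function.update_self,
    Function.update_of_ne (ne_of_gt ht), sub_zero]

lemma Dominated.tendsto_Psi_slope {α : ℝ} (hα0 : α < 0) (h : Dominated φ ψ β₁ β₂) {x p : Eucl n}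
    {a b : ℝ} (ha : φ x = a) (hint : x ∈ interior (dom φ))
    (hp : HasGradientAt (fun z => (φ z).toReal) p x) (hb : legendre ψ p = b) :
    Tendsto (fun t : ℝ => (Psi α (combBase φ ψ t x) - Psi α (φ x)) / t) (𝓝[>] 0)
      (𝓝 (b * Psi α (φ x) ^ (1 - α))) := by
  obtain ⟨h1, h2⟩ := h.tendsto_combBase_slope ha hint hp hb
  have ha0 : 1 / α < a := by
    have := one_div_lt_of_nonneg hα0 (h.nonneg x)
    rw [ha] at this; exact_mod_cast this
  have h3 := tendsto_comp_slope h2 (hasDerivAt_Psi hα0 ha0)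
  rw [neg_mul_neg, mul_comm] at h3
  rw [ha]
  refine h3.congr' ?_
  filter_upwards [h1] with t ⟨r, hr⟩
  rw [hr, EReal.toReal_coe]

end InteriorLimit


/-! ### Unit normals of a convex set and the Gauss map -/

section Normals

variable {K : Set (Eucl n)}

lemma isUnitNormal_gaussMap {x : Eucl n} (h : ∃! u, IsUnitNormal K x u) :
    IsUnitNormal K x (gaussMap K x) := by
  rw [gaussMap, dif_pos h]; exact h.choose_spec.1

lemma gaussMap_eq {x u : Eucl n} (h : ∃! u, IsUnitNormal K x u) (hu : IsUnitNormal K x u) :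
    gaussMap K x = u :=
  h.unique (isUnitNormal_gaussMap h) hu

lemma gaussMap_eq_zero {x : Eucl n} (h : ¬ ∃! u, IsUnitNormal K x u) : gaussMap K x = 0 := by
  rw [gaussMap, dif_neg h]

/-- The normal is the normalised Riesz vector of g. The last clause retains the sign of g, for use
when the normal is unique. -/
lemma isUnitNormal_of_clm {x : Eucl n} {g : Eucl n →L[ℝ] ℝ} (hg : g ≠ 0)
    (h : ∀ y ∈ K, g y ≤ g x) :
    ∃ u, IsUnitNormal K x u ∧ ∀ v, 0 ≤ g v → 0 ≤ (inner ℝ v u : ℝ) := by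
  set w := (InnerProductSpace.toDual ℝ (Eucl n)).symm g with hw
  have hin : ∀ y, inner ℝ y w = g y := fun y => by
    rw [real_inner_comm, hw, InnerProductSpace.toDual_symm_apply]
  have hw0 : w ≠ 0 := by simpa [hw] using hg
  have hpos : 0 < ‖w‖⁻¹ := by positivity
  refine ⟨‖w‖⁻¹ • w, ⟨?_, fun y hy => ?_⟩, fun v hv => ?_⟩
  · rw [norm_smul, norm_inv, norm_norm, inv_mul_cancel₀ (norm_ne_zero_iff.2 hw0)]
  · rw [real_inner_smul_right, real_inner_smul_right, hin, hin]
    exact mul_le_mul_of_nonneg_left (h y hy) hpos.le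
  · rw [real_inner_smul_right, hin]
    positivity

/-- The points with a unit normal in a given closed set form a closed set. -/
lemma isClosed_setOf_exists_normal (K : Set (Eucl n)) {D : Set (Eucl n)} (hD : IsClosed D) :
    IsClosed {x | ∃ u ∈ D, IsUnitNormal K x u} := by
  refine IsSeqClosed.isClosed fun x z hx hxz => ?_
  choose u huD hu using hx
  obtain ⟨v, -, k, hk, hv⟩ := (isCompact_sphere (0 : Eucl n) 1).tendsto_subseq
    (fun i => by simpa using (hu i).1 : ∀ i, u i ∈ Metric.sphere (0 : Eucl n) 1)
  refine ⟨v, hD.mem_of_tendsto hv (Eventually.of_forall fun i => huD _), ?_, fun y hy => ?_⟩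
  · refine tendsto_nhds_unique hv.norm ?_
    simp [(hu _).1]
  · exact le_of_tendsto_of_tendsto' (tendsto_const_nhds.inner hv)
      ((hxz.comp hk.tendsto_atTop).inner hv) fun i => (hu (k i)).2 y hy

/-- Uniqueness fails exactly when two normals have some coordinate separated by rationals q < q'. By
compactness of the sphere each of these countably many conditions describes an intersection of
closed sets. -/
lemma measurableSet_setOf_existsUnique_normal (K : Set (Eucl n)) :
    MeasurableSet {x | ∃! u, IsUnitNormal K x u} := by
  have heq : {x | ∃! u, IsUnitNormal K x u} = {x | ∃ u ∈ univ, IsUnitNormal K x u} \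
      ⋃ (i : Fin n) (q : ℚ) (q' : ℚ) (_ : q < q'),
        ({x | ∃ u ∈ {u : Eucl n | u i ≤ q}, IsUnitNormal K x u} ∩
          {x | ∃ u ∈ {u : Eucl n | (q' : ℝ) ≤ u i}, IsUnitNormal K x u}) := by
    ext x
    simp only [Set.mem_sdiff, mem_iUnion, not_exists]
    constructor
    · rintro ⟨u, hu, huu⟩
      refine ⟨⟨u, mem_univ _, hu⟩, ?_⟩
      rintro i q q' hq ⟨⟨v, hv, hv'⟩, ⟨w, hw, hw'⟩⟩
      have h1 : v i ≤ q := hv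
      have h2 : (q' : ℝ) ≤ w i := hw
      rw [huu v hv'] at h1
      rw [huu w hw'] at h2
      have : (q : ℝ) < q' := by exact_mod_cast hq
      linarith
    · rintro ⟨⟨u, -, hu⟩, h⟩
      refine ⟨u, hu, fun v hv => ?_⟩
      have aux : ∀ u v : Eucl n, IsUnitNormal K x u → IsUnitNormal K x v → ∀ i, v i ≤ u i := by
        intro u v hu hv i
        by_contra! hlt
        obtain ⟨q, hq1, hq2⟩ := exists_rat_btwn hlt
        obtain ⟨q', hq3, hq4⟩ := exists_rat_btwn hq2
        exact h i q q' (by exact_mod_cast hq3) ⟨⟨u, hq1.le, hu⟩, ⟨v, hq4.le, hv⟩⟩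
      ext i
      exact le_antisymm (aux u v hu hv i) (aux v u hv hu i)
  rw [heq]
  refine (isClosed_setOf_exists_normal K isClosed_univ).measurableSet.diff ?_
  refine MeasurableSet.iUnion fun i => MeasurableSet.iUnion fun q => MeasurableSet.iUnion fun q' =>
    MeasurableSet.iUnion fun _ => MeasurableSet.inter ?_ ?_
  · exact (isClosed_setOf_exists_normal K
      (isClosed_le (by fun_prop) continuous_const)).measurableSet
  · exact (isClosed_setOf_exists_normal K
      (isClosed_le continuous_const (by fun_prop))).measurableSet

lemma measurable_gaussMap (K : Set (Eucl n)) : Measurable (gaussMap K) := by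
  refine measurable_of_isClosed fun D hD => ?_
  have hU := measurableSet_setOf_existsUnique_normal K
  have heq : gaussMap K ⁻¹' D =
      ({x | ∃! u, IsUnitNormal K x u} ∩ {x | ∃ u ∈ D, IsUnitNormal K x u}) ∪
      ({x | ∃! u, IsUnitNormal K x u}ᶜ ∩ {_x | (0 : Eucl n) ∈ D}) := by
    ext x
    by_cases hx : ∃! u, IsUnitNormal K x u
    · have h1 : gaussMap K x ∈ D ↔ ∃ u ∈ D, IsUnitNormal K x u :=
        ⟨fun h => ⟨_, h, isUnitNormal_gaussMap hx⟩, fun ⟨u, hu, hu'⟩ => by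
          rwa [gaussMap_eq hx hu']⟩
      simp [hx, h1]
    · simp [hx, gaussMap_eq_zero hx]
  rw [heq]
  exact (hU.inter (isClosed_setOf_exists_normal K hD).measurableSet).union
    (hU.compl.inter (MeasurableSet.const _))

/-- Near a smooth boundary point, all unit normals are close to the one at that point. -/
lemma eventually_normal_near {z : Eucl n} (h : ∃! u, IsUnitNormal K z u) {ε : ℝ} (hε : 0 < ε) :
    ∀ᶠ x in 𝓝 z, ∀ u, IsUnitNormal K x u → ‖u - gaussMap K z‖ < ε := by
  have hcl := isClosed_setOf_exists_normal K
    (D := {u | ε ≤ ‖u - gaussMap K z‖}) (isClosed_le continuous_const (by fun_prop))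
  have hz : z ∈ {x | ∃ u ∈ {u | ε ≤ ‖u - gaussMap K z‖}, IsUnitNormal K x u}ᶜ := by
    rintro ⟨u, hu, hu'⟩
    have : ε ≤ ‖u - gaussMap K z‖ := hu
    rw [gaussMap_eq h hu'] at this
    simp at this
    linarith
  filter_upwards [hcl.isOpen_compl.mem_nhds hz] with x hx u hu
  by_contra! hcon
  exact hx ⟨u, hcon, hu⟩

/-- The data of a closed convex set that contains the origin in its interior. -/
structure ConvexNhd (K : Set (Eucl n)) : Prop where
  convex : Convex ℝ K
  closed : IsClosed K
  zero_mem : (0 : Eucl n) ∈ interior K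

namespace ConvexNhd

lemma nhds (h : ConvexNhd K) : K ∈ 𝓝 (0 : Eucl n) := mem_interior_iff_mem_nhds.1 h.zero_mem

lemma closure_interior (h : ConvexNhd K) : closure (interior K) = K := by
  rw [h.convex.closure_interior_eq_closure_of_nonempty_interior ⟨0, h.zero_mem⟩,
    h.closed.closure_eq]

lemma le_of_interior (h : ConvexNhd K) {g : Eucl n →L[ℝ] ℝ} {c : ℝ}
    (hg : ∀ y ∈ interior K, g y ≤ c) : ∀ y ∈ K, g y ≤ c := by
  intro y hy
  rw [← h.closure_interior] at hy
  exact closure_minimal (s := interior K) (t := {y | g y ≤ c}) hg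
    (isClosed_le g.continuous continuous_const) hy

lemma exists_normal (h : ConvexNhd K) {x : Eucl n} (hx : x ∈ frontier K) :
    ∃ u, IsUnitNormal K x u := by
  obtain ⟨g, hg⟩ := geometric_hahn_banach_open_point h.convex.interior isOpen_interior hx.2
  have h0 : g ≠ 0 := by
    rintro rfl
    simpa using hg 0 h.zero_mem
  obtain ⟨u, hu, -⟩ := isUnitNormal_of_clm h0 (h.le_of_interior fun y hy => (hg y hy).le)
  exact ⟨u, hu⟩

/-- A small positive multiple of u lies in K, because 0 is interior. -/
lemma inner_normal_pos (h : ConvexNhd K) {x u : Eucl n} (hu : IsUnitNormal K x u) :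
    0 < (inner ℝ x u : ℝ) := by
  obtain ⟨r, hr, hball⟩ := Metric.mem_nhds_iff.1 h.nhds
  have h1 : (r / 2) • u ∈ K := hball (by
    rw [mem_ball_zero_iff, norm_smul, hu.1, mul_one, Real.norm_of_nonneg (by linarith)]
    linarith)
  have h2 := hu.2 _ h1
  rw [real_inner_smul_left, real_inner_self_eq_norm_sq, hu.1] at h2
  linarith

/-- If the open ray from z along v missed the interior, a hyperplane would separate the two. It
supports K at z, so its normal is the unique one, yet it has nonnegative inner product with v. -/
lemma exists_add_smul_mem_interior (h : ConvexNhd K) {z v : Eucl n} (hz : z ∈ frontier K)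
    (hu : ∃! u, IsUnitNormal K z u) (hv : (inner ℝ v (gaussMap K z) : ℝ) < 0) :
    ∃ δ : ℝ, 0 < δ ∧ z + δ • v ∈ interior K := by
  by_contra! hcon
  have hconv : Convex ℝ ((fun s : ℝ => z + s • v) '' Ioi 0) := by
    have := ((convex_Ioi (0 : ℝ)).linear_image
      (LinearMap.toSpanSingleton ℝ (Eucl n) v)).translate z
    rw [image_image] at this
    exact this
  obtain ⟨g, c, hg1, hg2⟩ := geometric_hahn_banach_open h.convex.interior isOpen_interior hconv
    (by
      rw [Set.disjoint_left]
      rintro _ ha ⟨s, hs, rfl⟩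
      exact hcon s hs ha)
  have hline : ∀ s : ℝ, 0 < s → c ≤ g z + s * g v := by
    intro s hs
    have := hg2 _ ⟨s, hs, rfl⟩
    simpa using this
  have hzc : c ≤ g z := by
    have hlim : Tendsto (fun s : ℝ => g z + s * g v) (𝓝[>] 0) (𝓝 (g z + 0 * g v)) :=
      tendsto_nhdsWithin_of_tendsto_nhds (Continuous.tendsto (by fun_prop) 0)
    rw [zero_mul, add_zero] at hlim
    exact ge_of_tendsto hlim (by filter_upwards [self_mem_nhdsWithin] with s hs using hline s hs)
  have hle := h.le_of_interior (fun y hy => (hg1 y hy).le)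
  have hzK : z ∈ K := h.closed.frontier_subset hz
  have hgz : g z = c := le_antisymm (hle z hzK) hzc
  have h0 : g ≠ 0 := by
    rintro rfl
    have := hg1 0 h.zero_mem
    simp at this hgz
    linarith
  obtain ⟨u, hu1, hu2⟩ := isUnitNormal_of_clm h0 (fun y hy => by rw [hgz]; exact hle y hy)
  have hgv : 0 ≤ g v := by have := hline 1 one_pos; linarith
  have := hu2 v hgv
  rw [← gaussMap_eq hu hu1] at this
  linarith

/-- Near a smooth boundary point, secants of the boundary are almost tangential. -/
lemma eventually_abs_inner_sub_le (h : ConvexNhd K) {z : Eucl n}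
    (hu : ∃! u, IsUnitNormal K z u) {ε : ℝ} (hε : 0 < ε) :
    ∃ U ∈ 𝓝 z, ∀ x ∈ frontier K ∩ U, ∀ y ∈ frontier K ∩ U,
      |(inner ℝ (x - y) (gaussMap K z) : ℝ)| ≤ ε * ‖x - y‖ := by
  refine ⟨_, eventually_normal_near hu hε, ?_⟩
  -- A normal u at x satisfies ⟨y - x, u⟩ ≤ 0, and replacing u by the normal at z costs at most ε‖x
  -- - y‖. Exchanging x and y gives the other sign.
  have aux : ∀ x ∈ frontier K ∩ {x | ∀ u, IsUnitNormal K x u → ‖u - gaussMap K z‖ < ε},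
      ∀ y ∈ K, (inner ℝ (y - x) (gaussMap K z) : ℝ) ≤ ε * ‖x - y‖ := by
    rintro x ⟨hx, hxU⟩ y hy
    obtain ⟨u, hu'⟩ := h.exists_normal hx
    have h1 := hu'.2 y hy
    have h2 : (inner ℝ (y - x) (gaussMap K z) : ℝ)
        = inner ℝ (y - x) u - inner ℝ (y - x) (u - gaussMap K z) := by
      rw [← inner_sub_right]; simp
    have h3 := neg_le_of_abs_le (abs_real_inner_le_norm (y - x) (u - gaussMap K z))
    have h4 : ‖y - x‖ * ‖u - gaussMap K z‖ ≤ ‖y - x‖ * ε := by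
      gcongr; exact (hxU u hu').le
    have h5 : (inner ℝ (y - x) u : ℝ) ≤ 0 := by rw [inner_sub_left]; linarith
    rw [h2, norm_sub_rev x y]
    linarith
  intro x hx y hy
  rw [abs_le]
  constructor
  · have := aux x hx y (h.closed.frontier_subset hy.1)
    rw [← neg_sub x y, inner_neg_left] at this
    linarith
  · have := aux y hy x (h.closed.frontier_subset hx.1)
    rwa [norm_sub_rev y x] at this

lemma gauge_smul_of_pos (x : Eucl n) {r : ℝ} (hr : 0 ≤ r) : gauge K (r • x) = r * gauge K x := by
  rw [gauge_smul_of_nonneg hr, smul_eq_mul]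

lemma inner_le_mul_gauge (h : ConvexNhd K) {x u : Eucl n} (hu : IsUnitNormal K x u)
    (y : Eucl n) : (inner ℝ y u : ℝ) ≤ inner ℝ x u * gauge K y := by
  have hpos := h.inner_normal_pos hu
  have key : ∀ a, gauge K y < a → (inner ℝ y u : ℝ) ≤ inner ℝ x u * a := by
    intro a ha
    obtain ⟨b, hb0, hba, w, hw, rfl⟩ := exists_lt_of_gauge_lt (absorbent_nhds_zero h.nhds) ha
    simp only [real_inner_smul_left]
    have := hu.2 w hw
    nlinarith
  refine le_of_forall_pos_le_add fun ε hε => ?_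
  have := key (gauge K y + ε / inner ℝ x u) (by linarith [div_pos hε hpos])
  rwa [mul_add, mul_div_cancel₀ _ hpos.ne'] at this

/-- For a normal u at z, the function ⟨z, u⟩ gauge - ⟨·, u⟩ is nonnegative and vanishes at x, so its
derivative there is zero. All normals are therefore positive multiples of the gradient of the gauge,
and unit length leaves only one. -/
lemma existsUnique_normal_of_differentiableAt (h : ConvexNhd K) {x : Eucl n}
    (hx : 0 < gauge K x) (hd : DifferentiableAt ℝ (gauge K) x) :
    ∃! u, IsUnitNormal K ((gauge K x)⁻¹ • x) u := by
  set z := (gauge K x)⁻¹ • x with hz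
  have hfr : z ∈ frontier K := by
    rw [← gauge_eq_one_iff_mem_frontier h.convex h.nhds, hz, gauge_smul_of_pos _ (by positivity),
      inv_mul_cancel₀ hx.ne']
  have key : ∀ u, IsUnitNormal K z u → ∀ y, inner ℝ y u = inner ℝ z u * fderiv ℝ (gauge K) x y := by
    intro u hu y
    have hmin : IsLocalMin (fun y => inner ℝ z u * gauge K y - inner ℝ y u) x := by
      refine Eventually.of_forall fun y => ?_
      have h1 := h.inner_le_mul_gauge hu y
      have h2 : inner ℝ z u * gauge K x = inner ℝ x u := by
        rw [hz, real_inner_smul_left]; field_simp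
      simp only [h2]
      linarith
    have hder : HasFDerivAt (fun y => inner ℝ z u * gauge K y - inner ℝ y u)
        (inner ℝ z u • fderiv ℝ (gauge K) x - innerSL ℝ u) x := by
      refine (hd.hasFDerivAt.const_mul _).sub ?_
      have := (innerSL ℝ u).hasFDerivAt (x := x)
      refine this.congr_of_eventuallyEq (Eventually.of_forall fun y => ?_)
      simp [real_inner_comm]
    have h0 := congrArg (fun L => L y) (hmin.hasFDerivAt_eq_zero hder)
    simp at h0
    rw [real_inner_comm]
    linarith
  obtain ⟨u, hu⟩ := h.exists_normal hfr
  refine ⟨u, hu, fun v hv => ?_⟩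
  have hpu := h.inner_normal_pos hu
  have hpv := h.inner_normal_pos hv
  have hvu : v = (inner ℝ z v / inner ℝ z u) • u := by
    refine ext_inner_left ℝ fun y => ?_
    rw [real_inner_smul_right, key v hv y, key u hu y]
    field_simp
  have hn := congrArg norm hvu
  rw [norm_smul, hu.1, hv.1, mul_one, Real.norm_of_nonneg (by positivity)] at hn
  rw [hvu, ← hn, one_smul]

/-- Rademacher's theorem for the gauge, which is Lipschitz. -/
lemma ae_existsUnique_normal (h : ConvexNhd K) :
    ∀ᵐ x : Eucl n, 0 < gauge K x → ∃! u, IsUnitNormal K ((gauge K x)⁻¹ • x) u := by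
  obtain ⟨C, hC⟩ := h.convex.lipschitz_gauge h.nhds
  filter_upwards [hC.ae_differentiableAt] with x hx hx0
  exact h.existsUnique_normal_of_differentiableAt hx0 hx

end ConvexNhd

end Normals


/-! ### The support function of dom ψ and the limit of f_t at the boundary -/

section Support

variable {φ ψ : Eucl n → EReal} {β₁ β₂ : ℝ}

/-- Evaluating ψ* ≤ β₁φ* + β₂ at su gives s⟨y, u⟩ - ψ(y) ≤ β₁sA + β₂; compare the terms linear in s
as s → ∞. This makes the support function finite at normals of K. -/
lemma Dominated.inner_le (h : Dominated φ ψ β₁ β₂) {u : Eucl n} {A : ℝ}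
    (hA : ∀ x ∈ dom φ, inner ℝ x u ≤ A) : ∀ y ∈ dom ψ, inner ℝ y u ≤ β₁ * A := by
  intro y hy
  obtain ⟨r, hr⟩ := exists_coe_of_mem_dom h.ne_bot' hy
  have key : ∀ s : ℝ, 0 ≤ s → s * inner ℝ y u - r ≤ β₁ * (s * A) + β₂ := by
    intro s hs
    have h1 : legendre φ (s • u) ≤ ((s * A : ℝ) : EReal) := by
      refine (legendre_le_coe_iff h.conv.ne_bot).2 fun x a ha => ?_
      have h2 : 0 ≤ a := by have := h.nonneg x; rw [ha] at this; exact_mod_cast this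
      have h3 := hA x (mem_dom_of_eq ha)
      rw [real_inner_smul_right]
      nlinarith
    have h2 := (legendre_le_coe_iff h.ne_bot').1 (h.le_coe h1) y r hr
    rwa [real_inner_smul_right] at h2
  by_contra! hlt
  have hpos : 0 < inner ℝ y u - β₁ * A := by linarith
  have h1 := key ((|β₂| + |r| + 1) / (inner ℝ y u - β₁ * A)) (by positivity)
  have h2 : (|β₂| + |r| + 1) / (inner ℝ y u - β₁ * A) * (inner ℝ y u - β₁ * A)
      = |β₂| + |r| + 1 := div_mul_cancel₀ _ hpos.ne'
  have h3 := le_abs_self β₂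
  have h4 := le_abs_self r
  nlinarith

lemma exists_supportFun_closure_eq {D : Set (Eucl n)} (hD : D.Nonempty) {u : Eucl n} {A : ℝ}
    (hA : ∀ y ∈ D, inner ℝ y u ≤ A) :
    ∃ b : ℝ, supportFun (closure D) u = b ∧ (∀ y ∈ D, inner ℝ y u ≤ b) ∧ b ≤ A ∧
      ∀ c < b, ∃ y ∈ D, c < inner ℝ y u := by
  have hle : ∀ c : ℝ, (∀ y ∈ D, inner ℝ y u ≤ c) → supportFun (closure D) u ≤ c := by
    intro c hc
    refine iSup₂_le fun y hy => ?_
    have : y ∈ {y : Eucl n | inner ℝ u y ≤ c} :=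
      closure_minimal (fun y hy => by
        have := hc y hy
        rwa [real_inner_comm] at this)
        (isClosed_le (by fun_prop) continuous_const) hy
    exact_mod_cast this
  have hge : ∀ y ∈ D, ((inner ℝ y u : ℝ) : EReal) ≤ supportFun (closure D) u := by
    intro y hy
    rw [real_inner_comm]
    exact le_iSup₂ (f := fun y (_ : y ∈ closure D) => ((inner ℝ u y : ℝ) : EReal)) y
      (subset_closure hy)
  obtain ⟨y, hy⟩ := hD
  have hb : supportFun (closure D) u ≠ ⊥ :=
    ne_of_gt ((EReal.bot_lt_coe _).trans_le (hge y hy))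
  have ht : supportFun (closure D) u ≠ ⊤ := ne_of_lt ((hle A hA).trans_lt (EReal.coe_lt_top _))
  have heq := EReal.coe_toReal ht hb
  refine ⟨_, heq.symm, fun y hy => ?_, ?_, fun c hc => ?_⟩
  · have := hge y hy
    rw [← heq] at this
    exact_mod_cast this
  · have := hle A hA
    rw [← heq] at this
    exact_mod_cast this
  · by_contra! hcon
    have := hle c hcon
    rw [← heq] at this
    have h2 : (supportFun (closure D) u).toReal ≤ c := by exact_mod_cast this
    linarith

lemma supportFun_zero {D : Set (Eucl n)} (hD : D.Nonempty) : supportFun D 0 = 0 := by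
  simp [supportFun, biSup_const hD]

lemma Dominated.exists_supportFun_gaussMap (h : Dominated φ ψ β₁ β₂) {x : Eucl n}
    (hx : ∃! u, IsUnitNormal (closure (dom φ)) x u) :
    ∃ b : ℝ, supportFun (closure (dom ψ)) (gaussMap (closure (dom φ)) x) = b ∧
      (∀ y ∈ dom ψ, inner ℝ y (gaussMap (closure (dom φ)) x) ≤ b) ∧
      b ≤ β₁ * inner ℝ x (gaussMap (closure (dom φ)) x) ∧
      ∀ c < b, ∃ y ∈ dom ψ, c < inner ℝ y (gaussMap (closure (dom φ)) x) :=
  exists_supportFun_closure_eq h.dom_nonempty' (h.inner_le fun y hy =>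
    (isUnitNormal_gaussMap hx).2 y (subset_closure hy))

lemma Dominated.supportFun_gaussMap_ne_top (h : Dominated φ ψ β₁ β₂) (x : Eucl n) :
    supportFun (closure (dom ψ)) (gaussMap (closure (dom φ)) x) ≠ ⊤ := by
  by_cases hx : ∃! u, IsUnitNormal (closure (dom φ)) x u
  · obtain ⟨b, hb, -⟩ := h.exists_supportFun_gaussMap hx
    rw [hb]
    exact EReal.coe_ne_top b
  · rw [gaussMap_eq_zero hx, supportFun_zero h.dom_nonempty'.closure]
    exact EReal.zero_ne_top

lemma lowerSemicontinuous_supportFun (D : Set (Eucl n)) : LowerSemicontinuous (supportFun D) :=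
  lowerSemicontinuous_iSup fun _ => lowerSemicontinuous_iSup fun _ =>
    (continuous_coe_real_ereal.comp (by fun_prop)).lowerSemicontinuous

lemma Dominated.tendsto_Psi_boundary {α : ℝ} (hα0 : α < 0) (h : Dominated φ ψ β₁ β₂)
    (hK : ConvexNhd (closure (dom φ))) (hint : interior (closure (dom φ)) ⊆ dom φ)
    {z : Eucl n} (hz : z ∈ frontier (closure (dom φ)))
    (hu : ∃! u, IsUnitNormal (closure (dom φ)) z u) {b : ℝ}
    (hb : supportFun (closure (dom ψ)) (gaussMap (closure (dom φ)) z) = b) {τ : ℝ}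
    (hτ : τ ≠ b / inner ℝ z (gaussMap (closure (dom φ)) z)) :
    Tendsto (fun t : ℝ => Psi α (combBase φ ψ t ((1 + t * τ) • z))) (𝓝[>] 0)
      (𝓝 (if τ < b / inner ℝ z (gaussMap (closure (dom φ)) z) then Psi α (φ z) else 0)) := by
  set ν := gaussMap (closure (dom φ)) z with hν
  have hνn := isUnitNormal_gaussMap hu
  have hd := hK.inner_normal_pos hνn
  rw [← hν] at hd hνn
  obtain ⟨b', hb', h1, -, h2⟩ := h.exists_supportFun_gaussMap hu
  rw [← hν] at hb' h1 h2
  obtain rfl : b' = b := by rw [hb] at hb'; exact_mod_cast hb'.symm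
  -- Below the threshold some y ∈ dom ψ has ⟨y, ν⟩ > τ⟨z, ν⟩, so τz - y points strictly into K at z
  -- and φ_t converges along the curve. Above it the half-spaces containing dom φ and dom ψ force
  -- φ_t = ⊤.
  split_ifs with hlt
  · rw [lt_div_iff₀ hd] at hlt
    obtain ⟨y, hy, hyν⟩ := h2 _ hlt
    obtain ⟨δ, hδ, hmem⟩ := hK.exists_add_smul_mem_interior hz hu (v := τ • z - y) (by
      rw [inner_sub_left, real_inner_smul_left, ← hν]; linarith)
    have h3 := h.tendsto_combBase hδ hy (hint hmem)
    have h4 := (continuousAt_Psi hα0 (one_div_lt_of_nonneg hα0 (h.nonneg z))).tendsto.comp h3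
    refine h4.congr fun t => ?_
    simp only [Function.comp, add_smul, one_smul, mul_smul]
  · have hgt : b' < τ * inner ℝ z ν := by
      rw [← div_lt_iff₀ hd]
      exact lt_of_le_of_ne (not_lt.1 hlt) (Ne.symm hτ)
    refine tendsto_const_nhds.congr' ?_
    filter_upwards [self_mem_nhdsWithin] with t ht
    have ht : 0 < t := ht
    rw [h.combBase_eq_top ht.le (fun y hy => hνn.2 y (subset_closure hy)) h1, Psi_top]
    rw [real_inner_smul_left]
    nlinarith

end Support

/-! ### Varying majorants, and the mass of dilations -/

section Convergence

/-- A dominated convergence theorem with varying dominating functions (Pratt). -/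
lemma tendsto_lintegral_of_le_of_tendsto {X ι : Type*} [MeasurableSpace X] {μ : Measure X}
    {l : Filter ι} [l.IsCountablyGenerated] {F G : ι → X → ENNReal} {F₀ G₀ : X → ENNReal}
    (hF : ∀ i, Measurable (F i)) (hG : ∀ i, Measurable (G i)) (hG₀ : Measurable G₀)
    (hle : ∀ᶠ i in l, ∀ᵐ x ∂μ, F i x ≤ G i x) (hle₀ : ∀ᵐ x ∂μ, F₀ x ≤ G₀ x)
    (hlF : ∀ᵐ x ∂μ, Tendsto (fun i => F i x) l (𝓝 (F₀ x)))
    (hlG : ∀ᵐ x ∂μ, Tendsto (fun i => G i x) l (𝓝 (G₀ x)))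
    (hint : Tendsto (fun i => ∫⁻ x, G i x ∂μ) l (𝓝 (∫⁻ x, G₀ x ∂μ)))
    (hfin : ∫⁻ x, G₀ x ∂μ ≠ ⊤) :
    Tendsto (fun i => ∫⁻ x, F i x ∂μ) l (𝓝 (∫⁻ x, F₀ x ∂μ)) := by
  have hminF : Tendsto (fun i => ∫⁻ x, min (F i x) (G₀ x) ∂μ) l (𝓝 (∫⁻ x, F₀ x ∂μ)) := by
    refine tendsto_lintegral_filter_of_dominated_convergence G₀
      (Eventually.of_forall fun i => (hF i).min hG₀)
      (Eventually.of_forall fun i => Eventually.of_forall fun x => min_le_right _ _) hfin ?_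
    filter_upwards [hlF, hle₀] with x hx hx0
    simpa [min_eq_left hx0] using hx.min (tendsto_const_nhds (x := G₀ x))
  have hminG : Tendsto (fun i => ∫⁻ x, min (G i x) (G₀ x) ∂μ) l (𝓝 (∫⁻ x, G₀ x ∂μ)) := by
    refine tendsto_lintegral_filter_of_dominated_convergence G₀
      (Eventually.of_forall fun i => (hG i).min hG₀)
      (Eventually.of_forall fun i => Eventually.of_forall fun x => min_le_right _ _) hfin ?_
    filter_upwards [hlG] with x hx
    simpa using hx.min (tendsto_const_nhds (x := G₀ x))
  -- The excess of G over G₀ is G - min(G, G₀), and both terms have integrals tending to ∫G₀. Then F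
  -- lies between min(F, G₀) and min(F, G₀) plus this excess.
  have hexc : Tendsto (fun i => ∫⁻ x, (G i x - G₀ x) ∂μ) l (𝓝 0) := by
    have h1 := ENNReal.Tendsto.sub hint hminG (Or.inl hfin)
    rw [tsub_self] at h1
    refine h1.congr fun i => ?_
    rw [← lintegral_sub ((hG i).min hG₀)
      (ne_top_of_le_ne_top hfin (lintegral_mono fun x => min_le_right _ _))
      (Eventually.of_forall fun x => min_le_left _ _)]
    exact lintegral_congr fun x => tsub_min
  have hup := hminF.add hexc
  rw [add_zero] at hup
  refine tendsto_of_tendsto_of_tendsto_of_le_of_le' hminF hup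
    (Eventually.of_forall fun i => lintegral_mono fun x => min_le_left _ _) ?_
  filter_upwards [hle] with i hi
  rw [← lintegral_add_left ((hF i).min hG₀)]
  refine lintegral_mono_ae ?_
  filter_upwards [hi] with x hx
  rcases le_total (F i x) (G₀ x) with h | h
  · simp [h]
  · rw [min_eq_right h]
    calc F i x ≤ G i x := hx
      _ ≤ G₀ x + (G i x - G₀ x) := le_add_tsub

/-- The derivative of the total mass along the dilations `(1 + t β₁) φ(· / (1 + t β₁)) - t β₂`. -/
lemma tendsto_integral_dilation {α : ℝ} (hα0 : α < 0) {φ : Eucl n → EReal}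
    (hm : Measurable φ) (h0 : ∀ x, 0 ≤ φ x) (hint : Integrable fun x => Psi α (φ x))
    {β₁ : ℝ} (hβ : 0 < β₁) (β₂ : ℝ) :
    (∀ᶠ t : ℝ in 𝓝[>] 0, Integrable fun x => Psi α (((1 + t * β₁ : ℝ) : EReal) *
        φ ((1 + t * β₁)⁻¹ • x) - ((t * β₂ : ℝ) : EReal))) ∧
    Integrable (fun x => (β₁ * (φ x).toReal - β₂) * Psi α (φ x) ^ (1 - α)) ∧
    Tendsto (fun t : ℝ => ((∫ x, Psi α (((1 + t * β₁ : ℝ) : EReal) *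
        φ ((1 + t * β₁)⁻¹ • x) - ((t * β₂ : ℝ) : EReal))) - ∫ x, Psi α (φ x)) / t) (𝓝[>] 0)
      (𝓝 (n * β₁ * (∫ x, Psi α (φ x)) -
        ∫ x, (β₁ * (φ x).toReal - β₂) * Psi α (φ x) ^ (1 - α))) := by
  obtain ⟨C, hC, δ, hδ, H⟩ := exists_abs_Psi_sub_le hα0 hβ.le β₂
  -- The spatial dilation is removed: it contributes only the factor (1 + tβ₁)^n, with derivative
  -- nβ₁. What remains is a pointwise perturbation of φ whose quotients are at most C f, so ordinary
  -- dominated convergence applies.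
  set g : ℝ → Eucl n → ℝ := fun t x =>
    Psi α (((1 + t * β₁ : ℝ) : EReal) * φ x - ((t * β₂ : ℝ) : EReal)) with hg
  have hgm : ∀ t, Measurable (g t) := fun t =>
    measurable_Psi.comp ((hm.const_mul _).sub measurable_const)
  have hfm : Measurable fun x => Psi α (φ x) := measurable_Psi.comp hm
  have hsmall : ∀ᶠ t : ℝ in 𝓝[>] 0, 0 < t ∧ t < δ :=
    (Ioo_mem_nhdsGT hδ : Ioo 0 δ ∈ 𝓝[>] (0 : ℝ))
  have hgi : ∀ᶠ t : ℝ in 𝓝[>] 0, Integrable (g t) := by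
    filter_upwards [hsmall] with t ⟨ht0, htδ⟩
    refine (hint.const_mul (1 + C * t)).mono' (hgm t).aestronglyMeasurable
      (Eventually.of_forall fun x => ?_)
    obtain ⟨h1, h2⟩ := H t ht0 htδ (φ x) (h0 x)
    rw [Real.norm_of_nonneg (Psi_nonneg hα0 h1)]
    linarith [(abs_le.1 h2).2]
  have hscale : ∀ t : ℝ, 0 < t → (∫ x, g t ((1 + t * β₁)⁻¹ • x)) = (1 + t * β₁) ^ n * ∫ x, g t x := by
    intro t ht
    rw [Measure.integral_comp_inv_smul, finrank_euclideanSpace_fin, smul_eq_mul,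
      abs_of_nonneg (by positivity)]
  have hpt : ∀ x, Tendsto (fun t : ℝ => (g t x - Psi α (φ x)) / t) (𝓝[>] 0)
      (𝓝 (-((β₁ * (φ x).toReal - β₂) * Psi α (φ x) ^ (1 - α)))) := by
    intro x
    obtain hx | ⟨r, hx, hr⟩ := eq_top_or_coe_of_lt (one_div_lt_of_nonneg hα0 (h0 x))
    · simp only [hg, hx, Psi_top]
      rw [Real.zero_rpow (by linarith), mul_zero, neg_zero]
      refine tendsto_const_nhds.congr' ?_
      filter_upwards [hsmall] with t ⟨ht0, _⟩
      rw [EReal.coe_mul_top_of_pos (by positivity), EReal.top_sub_coe]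
      simp
    · have hs : Tendsto (fun t : ℝ => (((1 + t * β₁) * r - t * β₂) - r) / t) (𝓝[>] 0)
          (𝓝 (β₁ * r - β₂)) := by
        refine tendsto_const_nhds.congr' ?_
        filter_upwards [hsmall] with t ⟨ht0, _⟩
        field_simp
        ring
      have h3 := tendsto_comp_slope hs (hasDerivAt_Psi hα0 hr)
      simp only [hg, hx, EReal.toReal_coe]
      rw [show -((β₁ * r - β₂) * Psi α (r : EReal) ^ (1 - α)) =
        -Psi α (r : EReal) ^ (1 - α) * (β₁ * r - β₂) by ring]
      refine h3.congr fun t => ?_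
      push_cast
      rfl
  have hlimm : Measurable fun x => (β₁ * (φ x).toReal - β₂) * Psi α (φ x) ^ (1 - α) :=
    ((hm.ereal_toReal.const_mul β₁).sub_const β₂).mul (hfm.pow_const _)
  have hbound : ∀ᶠ t : ℝ in 𝓝[>] 0, ∀ x,
      ‖(g t x - Psi α (φ x)) / t‖ ≤ C * Psi α (φ x) := by
    filter_upwards [hsmall] with t ⟨ht0, htδ⟩ x
    obtain ⟨h1, h2⟩ := H t ht0 htδ (φ x) (h0 x)
    rw [Real.norm_eq_abs, abs_div, abs_of_pos ht0, div_le_iff₀ ht0]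
    linarith
  have hdct : Tendsto (fun t : ℝ => ∫ x, (g t x - Psi α (φ x)) / t) (𝓝[>] 0)
      (𝓝 (∫ x, -((β₁ * (φ x).toReal - β₂) * Psi α (φ x) ^ (1 - α)))) := by
    refine tendsto_integral_filter_of_dominated_convergence (fun x => C * Psi α (φ x))
      (Eventually.of_forall fun t => (((hgm t).sub hfm).div_const t).aestronglyMeasurable)
      ?_ (hint.const_mul C) (Eventually.of_forall hpt)
    filter_upwards [hbound] with t ht using Eventually.of_forall ht
  have hlimint : Integrable fun x => (β₁ * (φ x).toReal - β₂) * Psi α (φ x) ^ (1 - α) := by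
    refine (hint.const_mul C).mono' hlimm.aestronglyMeasurable (Eventually.of_forall fun x => ?_)
    have := le_of_tendsto (hpt x).norm (hbound.mono fun t ht => ht x)
    rwa [norm_neg] at this
  refine ⟨?_, hlimint, ?_⟩
  · filter_upwards [hgi, hsmall] with t ht ⟨ht0, _⟩
    exact ht.comp_smul (by positivity : (1 + t * β₁)⁻¹ ≠ 0)
  · have hpow : Tendsto (fun t : ℝ => ((1 + t * β₁) ^ n - 1) / t) (𝓝[>] 0) (𝓝 (n * β₁)) := by
      have h1 : HasDerivAt (fun t : ℝ => (1 + t * β₁) ^ n) (n * β₁) 0 := by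
        have := (((hasDerivAt_id (0 : ℝ)).mul_const β₁).const_add 1).fun_pow n
        simpa using this
      have h2 := h1.hasDerivWithinAt (s := Ioi 0)
      rw [hasDerivWithinAt_iff_tendsto_slope' (by simp)] at h2
      refine h2.congr fun t => ?_
      simp [slope_def_field]
    have hl : Tendsto (fun t : ℝ => (1 + t * β₁) ^ n) (𝓝[>] 0) (𝓝 1) := by
      refine tendsto_nhdsWithin_of_tendsto_nhds ?_
      have : Continuous fun t : ℝ => (1 + t * β₁) ^ n := by fun_prop
      simpa using this.tendsto 0
    have h3 := (hl.mul hdct).add (hpow.mul_const (∫ x, Psi α (φ x)))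
    rw [integral_neg, one_mul, neg_add_eq_sub] at h3
    refine h3.congr' ?_
    filter_upwards [hsmall, hgi] with t ⟨ht0, _⟩ hi
    change _ = ((∫ x, g t ((1 + t * β₁)⁻¹ • x)) - _) / t
    rw [hscale t ht0, integral_div, integral_sub hi hint]
    field_simp
    ring

end Convergence


/-! ### Polar coordinates -/

section Polar

/-- The unit sphere. -/
abbrev USphere (n : ℕ) : Type := Metric.sphere (0 : Eucl n) 1

/-- The surface measure on the unit sphere. -/
abbrev sphereMeasure (n : ℕ) : Measure (USphere n) := (volume : Measure (Eucl n)).toSphere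

/-- The measure `r^{n-1} dr` on `(0, ∞)`. -/
def radialMeasure (n : ℕ) : Measure ℝ :=
  (volume.restrict (Ioi 0)).withDensity fun r => ENNReal.ofReal (r ^ (n - 1))

instance (n : ℕ) : SFinite (radialMeasure n) := by unfold radialMeasure; infer_instance

lemma lintegral_radialMeasure {F : ℝ → ENNReal} (hF : Measurable F) :
    ∫⁻ r, F r ∂radialMeasure n = ∫⁻ r in Ioi (0 : ℝ), ENNReal.ofReal (r ^ (n - 1)) * F r := by
  rw [radialMeasure, lintegral_withDensity_eq_lintegral_mul _ (by fun_prop) hF]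
  rfl

lemma measurable_polar (n : ℕ) :
    Measurable fun p : USphere n × ℝ => p.2 • (p.1 : Eucl n) := by fun_prop

lemma lintegral_polar_prod [NeZero n] {F : Eucl n → ENNReal} (hF : Measurable F) :
    ∫⁻ x, F x = ∫⁻ θ, ∫⁻ r, F (r • (θ : Eucl n)) ∂radialMeasure n ∂sphereMeasure n := by
  have hmp := (volume : Measure (Eucl n)).measurePreserving_homeomorphUnitSphereProd
  have h1 : ∫⁻ x, F x = ∫⁻ x : ({0}ᶜ : Set (Eucl n)), F x ∂(volume.comap Subtype.val) := by
    rw [lintegral_subtype_comap (measurableSet_singleton _).compl F, restrict_compl_singleton]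
  have h2 := hmp.lintegral_comp_emb (Homeomorph.measurableEmbedding _)
    (fun p => F ((p.2 : ℝ) • (p.1 : Eucl n)))
  have h3 : ∀ x : ({0}ᶜ : Set (Eucl n)),
      ((homeomorphUnitSphereProd (Eucl n) x).2 : ℝ) •
        ((homeomorphUnitSphereProd (Eucl n) x).1 : Eucl n) = x := by
    intro x
    have hx : ‖(x : Eucl n)‖ ≠ 0 := norm_ne_zero_iff.2 x.2
    simpa using smul_inv_smul₀ hx (x : Eucl n)
  simp only [h3] at h2
  rw [h1, h2, lintegral_prod _ (by fun_prop)]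
  refine lintegral_congr fun θ => ?_
  rw [lintegral_radialMeasure (F := fun r => F (r • (θ : Eucl n))) (by fun_prop), Measure.volumeIoiPow,
    lintegral_withDensity_eq_lintegral_mul _ (by fun_prop)
      (by fun_prop : Measurable fun r : Ioi (0 : ℝ) => F ((r : ℝ) • (θ : Eucl n)))]
  simp only [Pi.mul_apply, finrank_euclideanSpace_fin]
  exact lintegral_subtype_comap measurableSet_Ioi
    (fun r : ℝ => ENNReal.ofReal (r ^ (n - 1)) * F (r • (θ : Eucl n)))

lemma measurePreserving_polar [NeZero n] :
    MeasurePreserving (fun p : USphere n × ℝ => p.2 • (p.1 : Eucl n))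
      ((sphereMeasure n).prod (radialMeasure n)) volume := by
  refine ⟨measurable_polar n, Measure.ext_of_lintegral _ fun F hF => ?_⟩
  rw [lintegral_map hF (measurable_polar n), lintegral_prod _ (Measurable.aemeasurable (by fun_prop)),
    lintegral_polar_prod hF]

end Polar

/-! ### The cone measure and integration outside K -/

section ConeMeasure

variable {K : Set (Eucl n)}

/-- The cone measure of `K` on its boundary, `A ↦ n |{r z : z ∈ A, 0 < r ≤ 1}|`. -/
def coneMeasure (K : Set (Eucl n)) : Measure (Eucl n) :=
  ((sphereMeasure n).withDensity fun θ =>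
    if 0 < gauge K (θ : Eucl n) then ENNReal.ofReal ((gauge K (θ : Eucl n) ^ n)⁻¹) else 0).map
    fun θ : USphere n => (gauge K (θ : Eucl n))⁻¹ • (θ : Eucl n)

instance (K : Set (Eucl n)) : SFinite (coneMeasure K) := by unfold coneMeasure; infer_instance

lemma ConvexNhd.measurable_gauge (h : ConvexNhd K) : Measurable (gauge K) :=
  (continuous_gauge h.convex h.nhds).measurable

lemma ConvexNhd.measurable_density (h : ConvexNhd K) : Measurable fun θ : USphere n =>
    if 0 < gauge K (θ : Eucl n) then ENNReal.ofReal ((gauge K (θ : Eucl n) ^ n)⁻¹) else 0 := by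
  have h1 : Measurable fun θ : USphere n => gauge K (θ : Eucl n) :=
    h.measurable_gauge.comp measurable_subtype_coe
  exact Measurable.ite (measurableSet_lt measurable_const h1) (by fun_prop) measurable_const

lemma ConvexNhd.measurable_radial (h : ConvexNhd K) : Measurable fun θ : USphere n =>
    (gauge K (θ : Eucl n))⁻¹ • (θ : Eucl n) := by
  have h1 : Measurable fun θ : USphere n => gauge K (θ : Eucl n) :=
    h.measurable_gauge.comp measurable_subtype_coe
  fun_prop

lemma ConvexNhd.lintegral_coneMeasure (h : ConvexNhd K) {F : Eucl n → ENNReal}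
    (hF : Measurable F) :
    ∫⁻ z, F z ∂coneMeasure K = ∫⁻ θ : USphere n, (if 0 < gauge K (θ : Eucl n) then
      ENNReal.ofReal ((gauge K (θ : Eucl n) ^ n)⁻¹) else 0) *
        F ((gauge K (θ : Eucl n))⁻¹ • (θ : Eucl n)) ∂sphereMeasure n := by
  rw [coneMeasure, lintegral_map hF h.measurable_radial,
    lintegral_withDensity_eq_lintegral_mul _ h.measurable_density
      (g := fun θ : USphere n => F ((gauge K (θ : Eucl n))⁻¹ • (θ : Eucl n)))
      (hF.comp h.measurable_radial)]
  rfl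

lemma ConvexNhd.gauge_radial (h : ConvexNhd K) {x : Eucl n} (hx : 0 < gauge K x) :
    (gauge K x)⁻¹ • x ∈ frontier K := by
  rw [← gauge_eq_one_iff_mem_frontier h.convex h.nhds, ConvexNhd.gauge_smul_of_pos _ (by positivity),
    inv_mul_cancel₀ hx.ne']

lemma ConvexNhd.ae_coneMeasure_of (h : ConvexNhd K) {P : Eucl n → Prop}
    (hP : MeasurableSet {z | P z})
    (hae : ∀ᵐ θ : USphere n ∂sphereMeasure n, 0 < gauge K (θ : Eucl n) →
      P ((gauge K (θ : Eucl n))⁻¹ • (θ : Eucl n))) : ∀ᵐ z ∂coneMeasure K, P z := by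
  rw [coneMeasure, ae_map_iff h.measurable_radial.aemeasurable hP,
    ae_withDensity_iff h.measurable_density]
  filter_upwards [hae] with θ hθ hne
  refine hθ ?_
  by_contra hcon
  simp [hcon] at hne

lemma ConvexNhd.ae_mem_frontier (h : ConvexNhd K) : ∀ᵐ z ∂coneMeasure K, z ∈ frontier K :=
  h.ae_coneMeasure_of isClosed_frontier.measurableSet
    (Eventually.of_forall fun _ hθ => h.gauge_radial hθ)

/-- If P fails at θ it fails on the whole open ray through θ, which is not null for the radial
measure. By Fubini this happens for almost no θ. -/
lemma ae_sphere_of_ae_of_homogeneous [NeZero n] {P : Eucl n → Prop} (hP : ∀ᵐ x : Eucl n, P x)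
    (hhom : ∀ x : Eucl n, ∀ r : ℝ, 0 < r → P (r • x) → P x) :
    ∀ᵐ θ : USphere n ∂sphereMeasure n, P (θ : Eucl n) := by
  have h1 := measurePreserving_polar (n := n).quasiMeasurePreserving.ae hP
  have h2 := Measure.ae_ae_of_ae_prod h1
  filter_upwards [h2] with θ hθ
  by_contra hcon
  have h3 : ∀ᵐ r ∂radialMeasure n, r ≤ 0 := by
    filter_upwards [hθ] with r hr
    by_contra! hr0
    exact hcon (hhom _ _ hr0 hr)
  rw [radialMeasure, ae_withDensity_iff (by fun_prop), ae_restrict_iff' measurableSet_Ioi] at h3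
  have h4 : ∀ᵐ r : ℝ, r ∉ Ioi (0 : ℝ) := by
    filter_upwards [h3] with r hr hr0
    have hr0' : 0 < r := hr0
    exact absurd (hr hr0 (by simpa using pow_pos hr0' (n - 1))) (not_le.2 hr0)
  have h5 : volume (Ioi (0 : ℝ)) = 0 := by
    rw [← compl_compl (Ioi (0 : ℝ))]; exact h4
  simp at h5

lemma ConvexNhd.ae_coneMeasure_existsUnique_normal [NeZero n] (h : ConvexNhd K) :
    ∀ᵐ z ∂coneMeasure K, ∃! u, IsUnitNormal K z u := by
  refine h.ae_coneMeasure_of (measurableSet_setOf_existsUnique_normal K) ?_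
  refine ae_sphere_of_ae_of_homogeneous h.ae_existsUnique_normal fun x r hr hx hpos => ?_
  have h1 := hx (by rw [ConvexNhd.gauge_smul_of_pos _ hr.le]; positivity)
  rwa [ConvexNhd.gauge_smul_of_pos _ hr.le, smul_smul, mul_inv, mul_assoc, mul_comm _ r,
    ← mul_assoc, inv_mul_cancel₀ hr.ne', one_mul] at h1

/-- Integration over the exterior of `K` in the coordinates `(1 + t τ) z`, `z ∈ ∂K`, `τ > 0`. -/
lemma ConvexNhd.lintegral_exterior [NeZero n] (h : ConvexNhd K) {F : Eucl n → ENNReal}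
    (hF : Measurable F) (hFK : ∀ x ∈ K, F x = 0) {t : ℝ} (ht : 0 < t) :
    ∫⁻ x, F x = ∫⁻ p, ENNReal.ofReal (t * (1 + t * p.2) ^ (n - 1)) * F ((1 + t * p.2) • p.1)
      ∂((coneMeasure K).prod (volume.restrict (Ioi (0 : ℝ)))) := by
  have hmeas : Measurable fun p : Eucl n × ℝ =>
      ENNReal.ofReal (t * (1 + t * p.2) ^ (n - 1)) * F ((1 + t * p.2) • p.1) :=
    Measurable.mul (by fun_prop) (hF.comp (by fun_prop))
  have hsec : ∀ z : Eucl n, Measurable fun τ : ℝ =>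
      ENNReal.ofReal (t * (1 + t * τ) ^ (n - 1)) * F ((1 + t * τ) • z) :=
    fun z => Measurable.mul (by fun_prop) (hF.comp (by fun_prop))
  rw [lintegral_prod _ hmeas.aemeasurable, lintegral_polar_prod hF,
    h.lintegral_coneMeasure hmeas.lintegral_prod_right']
  refine lintegral_congr fun θ => ?_
  rw [lintegral_radialMeasure (F := fun r => F (r • (θ : Eucl n))) (by fun_prop)]
  set p := gauge K (θ : Eucl n) with hp
  have hzero : ∀ r : ℝ, 0 < r → r * p ≤ 1 → F (r • (θ : Eucl n)) = 0 := by
    intro r hr hrp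
    apply hFK
    rw [← h.closed.closure_eq, ← gauge_le_one_iff_mem_closure h.convex h.nhds,
      ConvexNhd.gauge_smul_of_pos _ hr.le]
    exact hrp
  split_ifs with hp0
  -- The ray leaves K at radius 1/p. Substituting r = (1 + tτ)/p turns r^{n-1} dr into t(1 +
  -- tτ)^{n-1} p^{-n} dτ, and p^{-n} is the density of the cone measure.
  · have himg : (fun τ : ℝ => (1 + t * τ) / p) '' Ioi 0 = Ioi (1 / p) := by
      ext r
      simp only [mem_image, mem_Ioi]
      constructor
      · rintro ⟨τ, hτ, rfl⟩
        gcongr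
        have := mul_pos ht hτ
        linarith
      · intro hr
        rw [div_lt_iff₀ hp0] at hr
        refine ⟨(r * p - 1) / t, by apply div_pos <;> linarith, ?_⟩
        field_simp
        ring
    have h1 : ∫⁻ r in Ioi (0 : ℝ), ENNReal.ofReal (r ^ (n - 1)) * F (r • (θ : Eucl n)) =
        ∫⁻ r in Ioi (1 / p), ENNReal.ofReal (r ^ (n - 1)) * F (r • (θ : Eucl n)) := by
      have hsub : Ioi (1 / p) ⊆ Ioi 0 := Ioi_subset_Ioi (by positivity)
      rw [← lintegral_indicator measurableSet_Ioi, ← lintegral_indicator measurableSet_Ioi]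
      refine lintegral_congr fun r => ?_
      by_cases hr : r ∈ Ioi (1 / p)
      · rw [indicator_of_mem hr, indicator_of_mem (hsub hr)]
      · rw [indicator_of_notMem hr]
        by_cases hr0 : r ∈ Ioi 0
        · rw [indicator_of_mem hr0, hzero r hr0, mul_zero]
          rw [mem_Ioi, not_lt, le_div_iff₀ hp0] at hr
          exact hr
        · rw [indicator_of_notMem hr0]
    have hderiv : ∀ τ ∈ Ioi (0 : ℝ),
        HasDerivWithinAt (fun τ : ℝ => (1 + t * τ) / p) (t / p) (Ioi 0) τ := by
      intro τ _
      have := (((hasDerivAt_id τ).const_mul t).const_add 1).div_const p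
      simpa using this.hasDerivWithinAt
    have hinj : InjOn (fun τ : ℝ => (1 + t * τ) / p) (Ioi 0) := by
      intro a _ b _ hab
      simp only at hab
      field_simp at hab
      exact mul_left_cancel₀ ht.ne' (add_left_cancel hab)
    rw [h1, ← himg, lintegral_image_eq_lintegral_abs_deriv_mul measurableSet_Ioi hderiv hinj,
      ← lintegral_const_mul _ (hsec ((gauge K (θ : Eucl n))⁻¹ • (θ : Eucl n)))]
    refine setLIntegral_congr_fun measurableSet_Ioi fun τ hτ => ?_
    have hτ0 : (0 : ℝ) < τ := hτ
    have hn : n - 1 + 1 = n := Nat.succ_pred_eq_of_ne_zero (NeZero.ne n)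
    rw [← mul_assoc, ← mul_assoc, ← ENNReal.ofReal_mul (by positivity),
      ← ENNReal.ofReal_mul (by positivity), abs_of_pos (by positivity), div_eq_mul_inv (1 + t * τ) p,
      mul_smul]
    congr 2
    rw [mul_pow, inv_pow]
    conv_rhs => rw [← hn, pow_succ, mul_inv]
    simp only [hn]
    ring
  -- When the gauge is zero the entire ray lies in K, where F vanishes.
  · rw [zero_mul]
    have hp1 : p = 0 := le_antisymm (not_lt.1 hp0) (gauge_nonneg _)
    rw [← lintegral_zero (μ := volume.restrict (Ioi (0 : ℝ)))]
    refine setLIntegral_congr_fun measurableSet_Ioi fun r hr => ?_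
    rw [hzero r hr (by rw [hp1]; simp), mul_zero]

/-- The cone measure of a boundary set is `n` times the volume of the cone over it. -/
lemma ConvexNhd.coneMeasure_apply [NeZero n] (h : ConvexNhd K) {A : Set (Eucl n)}
    (hA : MeasurableSet A) :
    coneMeasure K A = n * volume {x | 0 < gauge K x ∧ gauge K x ≤ 1 ∧ (gauge K x)⁻¹ • x ∈ A} := by
  have hgm := h.measurable_gauge
  have hS : MeasurableSet {x | 0 < gauge K x ∧ gauge K x ≤ 1 ∧ (gauge K x)⁻¹ • x ∈ A} := by
    refine (measurableSet_lt measurable_const hgm).inter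
      ((measurableSet_le hgm measurable_const).inter ?_)
    have : Measurable fun x : Eucl n => (gauge K x)⁻¹ • x := by fun_prop
    exact this hA
  have hn0 : (n : ENNReal) ≠ 0 := by simpa using NeZero.ne n
  rw [← lintegral_indicator_one hA, h.lintegral_coneMeasure (measurable_one.indicator hA),
    ← lintegral_indicator_one hS, lintegral_polar_prod (measurable_one.indicator hS),
    ← lintegral_const_mul']
  swap
  · simp
  refine lintegral_congr fun θ => ?_
  rw [lintegral_radialMeasure (F := fun r => indicator _ 1 (r • (θ : Eucl n)))
    ((measurable_one.indicator hS).comp (by fun_prop : Measurable fun r : ℝ => r • (θ : Eucl n)))]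
  set p := gauge K (θ : Eucl n) with hp
  by_cases hp0 : 0 < p
  swap
  · rw [if_neg hp0, zero_mul, eq_comm, mul_eq_zero, or_iff_right hn0]
    rw [← lintegral_zero (μ := volume.restrict (Ioi (0 : ℝ)))]
    refine setLIntegral_congr_fun measurableSet_Ioi fun r hr => ?_
    have hr0 : (0 : ℝ) < r := hr
    have hp1 : p = 0 := le_antisymm (not_lt.1 hp0) (gauge_nonneg _)
    rw [indicator_of_notMem, mul_zero]
    rintro ⟨hc, -⟩
    rw [ConvexNhd.gauge_smul_of_pos _ hr0.le, ← hp, hp1] at hc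
    simp at hc
  rw [if_pos hp0]
  have hmem : ∀ r : ℝ, 0 < r → (r • (θ : Eucl n) ∈
      {x | 0 < gauge K x ∧ gauge K x ≤ 1 ∧ (gauge K x)⁻¹ • x ∈ A} ↔
      r ≤ 1 / p ∧ p⁻¹ • (θ : Eucl n) ∈ A) := by
    intro r hr
    change (0 < gauge K (r • (θ : Eucl n)) ∧ gauge K (r • (θ : Eucl n)) ≤ 1 ∧
      (gauge K (r • (θ : Eucl n)))⁻¹ • r • (θ : Eucl n) ∈ A) ↔ _
    rw [ConvexNhd.gauge_smul_of_pos _ hr.le, ← hp, smul_smul, mul_inv, mul_comm r⁻¹, mul_assoc,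
      inv_mul_cancel₀ hr.ne', mul_one, le_div_iff₀ hp0]
    simp [mul_pos hr hp0]
  have hint : ∫⁻ r in Ioi (0 : ℝ), ENNReal.ofReal (r ^ (n - 1)) *
      ({x | 0 < gauge K x ∧ gauge K x ≤ 1 ∧ (gauge K x)⁻¹ • x ∈ A}.indicator 1
        (r • (θ : Eucl n))) =
      (∫⁻ r in Ioc (0 : ℝ) (1 / p), ENNReal.ofReal (r ^ (n - 1))) *
        A.indicator 1 (p⁻¹ • (θ : Eucl n)) := by
    rw [← lintegral_mul_const _ (by fun_prop), ← lintegral_indicator measurableSet_Ioi,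
      ← lintegral_indicator measurableSet_Ioc]
    refine lintegral_congr fun r => ?_
    by_cases hr : 0 < r
    · rw [indicator_of_mem (show r ∈ Ioi 0 from hr)]
      by_cases hr1 : r ≤ 1 / p
      · rw [indicator_of_mem (show r ∈ Ioc 0 (1 / p) from ⟨hr, hr1⟩)]
        by_cases hA' : p⁻¹ • (θ : Eucl n) ∈ A
        · rw [indicator_of_mem hA', indicator_of_mem ((hmem r hr).2 ⟨hr1, hA'⟩)]; rfl
        · rw [indicator_of_notMem hA', indicator_of_notMem fun hc => hA' ((hmem r hr).1 hc).2]
      · rw [indicator_of_notMem (fun hc => hr1 ((hmem r hr).1 hc).1), mul_zero,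
          indicator_of_notMem fun hc => hr1 hc.2]
    · rw [indicator_of_notMem (show r ∉ Ioi 0 from hr), indicator_of_notMem fun hc => hr hc.1]
  have hpow : ∫⁻ r in Ioc (0 : ℝ) (1 / p), ENNReal.ofReal (r ^ (n - 1)) =
      ENNReal.ofReal ((1 / p) ^ n / n) := by
    have hn : n - 1 + 1 = n := Nat.succ_pred_eq_of_ne_zero (NeZero.ne n)
    rw [← ofReal_integral_eq_lintegral_ofReal, ← intervalIntegral.integral_of_le (by positivity),
      integral_pow, hn, zero_pow (NeZero.ne n), sub_zero]
    · congr 2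
      exact_mod_cast congrArg (Nat.cast (R := ℝ)) hn
    · exact (intervalIntegral.intervalIntegrable_pow _).1
    · filter_upwards [ae_restrict_mem measurableSet_Ioc] with r hr using pow_nonneg hr.1.le _
  rw [hint, hpow, ← mul_assoc]
  congr 1
  rw [← ENNReal.ofReal_natCast, ← ENNReal.ofReal_mul (by positivity),
    mul_div_cancel₀ _ (by simpa using NeZero.ne n), one_div, inv_pow]

end ConeMeasure


/-! ### The cone measure in terms of the surface measure -/

section HausdorffComparison

lemma euclideanHausdorffMeasure_image_le {m : ℕ} {g : Eucl n → Eucl n} {A : Set (Eucl n)}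
    {L : NNReal} (hg : LipschitzOnWith L g A) :
    (Measure.euclideanHausdorffMeasure m : Measure (Eucl n)) (g '' A) ≤
      (L : ENNReal) ^ m * (Measure.euclideanHausdorffMeasure m : Measure (Eucl n)) A := by
  rw [Measure.euclideanHausdorffMeasure_def, Measure.smul_apply, Measure.smul_apply]
  have := hg.hausdorffMeasure_image_le (d := m) (by positivity)
  rw [ENNReal.rpow_natCast] at this
  rw [ENNReal.smul_def, smul_eq_mul, ENNReal.smul_def, smul_eq_mul, mul_left_comm]
  gcongr

/-- The volume of a cone over a flat base. -/
lemma volume_cone_flat [NeZero n] {ν : Eucl n} (hν : ‖ν‖ = 1) {d : ℝ} (hd : 0 < d)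
    {B : Set (Eucl n)} (hB : MeasurableSet B) (hBd : ∀ x ∈ B, (inner ℝ x ν : ℝ) = d) :
    n * volume {x : Eucl n | 0 < (inner ℝ x ν : ℝ) ∧ (inner ℝ x ν : ℝ) ≤ d ∧
        (d / inner ℝ x ν) • x ∈ B} =
      ENNReal.ofReal d * (Measure.euclideanHausdorffMeasure (n - 1) : Measure (Eucl n)) B := by
  set C := {x : Eucl n | 0 < (inner ℝ x ν : ℝ) ∧ (inner ℝ x ν : ℝ) ≤ d ∧
        (d / inner ℝ x ν) • x ∈ B} with hC
  have hin : Measurable fun x : Eucl n => (inner ℝ x ν : ℝ) := by fun_prop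
  have hCm : MeasurableSet C := by
    refine (measurableSet_lt measurable_const hin).inter
      ((measurableSet_le hin measurable_const).inter ?_)
    have : Measurable fun x : Eucl n => (d / inner ℝ x ν) • x :=
      (measurable_const.div hin).smul measurable_id
    exact this hB
  have hν0 : ν ≠ 0 := by rintro rfl; simp at hν
  have hn : n - 1 + 1 = n := Nat.succ_pred_eq_of_ne_zero (NeZero.ne n)
  have hfub := EuclideanGeometry.euclideanHausdorffMeasure_eq_lintegral (0 : Eucl n) hν0 hCm
  rw [InnerProductSpace.euclideanHausdorffMeasure_eq_volume, finrank_euclideanSpace_fin] at hfub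
  have hslice : ∀ s : ℝ, C ∩ (AffineSubspace.mk' (s • ν +ᵥ (0 : Eucl n)) (ℝ ∙ ν)ᗮ : Set (Eucl n)) =
      {x | x ∈ C ∧ (inner ℝ x ν : ℝ) = s} := by
    intro s
    ext x
    simp only [mem_inter_iff, SetLike.mem_coe, AffineSubspace.mem_mk', vsub_eq_sub, vadd_eq_add,
      add_zero, Submodule.mem_orthogonal_singleton_iff_inner_left, inner_sub_left,
      real_inner_smul_left, real_inner_self_eq_norm_sq, hν, mem_ofPred_eq]
    rw [one_pow, mul_one, sub_eq_zero]
  -- The slice of the cone at height s is (s/d)B for 0 < s ≤ d and empty otherwise, so Fubini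
  -- reduces the volume to ∫₀^d (s/d)^{n-1} ds = d/n.
  have hval : ∀ s : ℝ, (Measure.euclideanHausdorffMeasure (n - 1) : Measure (Eucl n))
      (C ∩ (AffineSubspace.mk' (s • ν +ᵥ (0 : Eucl n)) (ℝ ∙ ν)ᗮ : Set (Eucl n))) =
      (Ioc (0 : ℝ) d).indicator (fun s => ENNReal.ofReal ((s / d) ^ (n - 1))) s *
        (Measure.euclideanHausdorffMeasure (n - 1) : Measure (Eucl n)) B := by
    intro s
    rw [hslice]
    by_cases hs : s ∈ Ioc (0 : ℝ) d
    · have hs0 : 0 < s / d := div_pos hs.1 hd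
      have heq : {x | x ∈ C ∧ (inner ℝ x ν : ℝ) = s} = (s / d) • B := by
        ext x
        rw [mem_smul_set_iff_inv_smul_mem₀ hs0.ne', inv_div]
        constructor
        · rintro ⟨⟨h1, h2, h3⟩, h4⟩
          rwa [h4] at h3
        · intro h
          have h4 := hBd _ h
          rw [real_inner_smul_left] at h4
          have h5 : (inner ℝ x ν : ℝ) = s := by
            have := hs.1.ne'
            field_simp at h4
            nlinarith
          refine ⟨⟨?_, ?_, ?_⟩, h5⟩
          · rw [h5]; exact hs.1
          · rw [h5]; exact hs.2
          · rw [h5]; exact h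
      rw [heq, indicator_of_mem hs, Measure.euclideanHausdorffMeasure_smul₀ _ hs0.ne',
        ENNReal.smul_def, smul_eq_mul]
      congr 1
      rw [ENNReal.ofReal_pow hs0.le, ENNReal.coe_pow]
      congr 1
      rw [← enorm_eq_nnnorm, Real.enorm_eq_ofReal hs0.le]
    · have heq : {x | x ∈ C ∧ (inner ℝ x ν : ℝ) = s} = ∅ := by
        ext x
        simp only [mem_empty_iff_false, iff_false]
        rintro ⟨⟨h1, h2, -⟩, h4⟩
        rw [h4] at h1 h2
        exact hs ⟨h1, h2⟩
      rw [heq, indicator_of_notMem hs, measure_empty, zero_mul]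
  have hint : ∫⁻ s : ℝ, (Ioc (0 : ℝ) d).indicator (fun s => ENNReal.ofReal ((s / d) ^ (n - 1))) s =
      ENNReal.ofReal (d / n) := by
    rw [lintegral_indicator measurableSet_Ioc, ← ofReal_integral_eq_lintegral_ofReal,
      ← intervalIntegral.integral_of_le hd.le]
    · simp_rw [div_pow]
      rw [intervalIntegral.integral_div, integral_pow, hn, zero_pow (NeZero.ne n), sub_zero]
      congr 1
      have h1 : ((n - 1 : ℕ) : ℝ) + 1 = n := by exact_mod_cast congrArg (Nat.cast (R := ℝ)) hn
      have h2 : d ^ n = d ^ (n - 1) * d := by conv_lhs => rw [← hn, pow_succ]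
      rw [h1, h2]
      field_simp
    · exact ((intervalIntegral.intervalIntegrable_pow (n - 1)).div_const (d ^ (n - 1))
        |>.1).congr (Eventually.of_forall fun s => by simp [div_pow])
    · filter_upwards [ae_restrict_mem measurableSet_Ioc] with s hs
      have := hs.1
      positivity
  rw [hfub]
  simp_rw [hval]
  rw [lintegral_mul_const _ ((by fun_prop : Measurable fun s : ℝ =>
    ENNReal.ofReal ((s / d) ^ (n - 1))).indicator measurableSet_Ioc), hint, ← ofReal_norm, hν,
    ENNReal.ofReal_one, one_mul, ← mul_assoc]
  congr 1
  rw [← ENNReal.ofReal_natCast, ← ENNReal.ofReal_mul (by positivity)]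
  congr 1
  have : (n : ℝ) ≠ 0 := by simpa using NeZero.ne n
  field_simp

/-- Two measures with local density ratios arbitrarily close to one are comparable. -/
lemma measure_le_of_local {X : Type*} [TopologicalSpace X] [SecondCountableTopology X]
    [MeasurableSpace X] [OpensMeasurableSpace X] {μ ν : Measure X} {S : Set X}
    (h : ∀ c : ℝ, 1 < c → ∀ x ∈ S, ∃ U ∈ 𝓝 x, ∀ A ⊆ S ∩ U, MeasurableSet A →
      μ A ≤ ENNReal.ofReal c * ν A) {A : Set X} (hA : MeasurableSet A) (hAS : A ⊆ S) :
    μ A ≤ ν A := by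
  have key : ∀ c : ℝ, 1 < c → μ A ≤ ENNReal.ofReal c * ν A := by
    intro c hc
    choose! U hU hUA using h c hc
    rcases S.eq_empty_or_nonempty with rfl | hne
    · rw [subset_empty_iff.1 hAS]; simp
    -- Countably many of the neighbourhoods cover S; made disjoint, they let the local inequalities
    -- be summed.
    obtain ⟨t, htS, htc, hcov⟩ := TopologicalSpace.countable_cover_nhdsWithin
      (f := fun x => interior (U x)) (s := S)
      fun x hx => mem_nhdsWithin_of_mem_nhds (interior_mem_nhds.2 (hU x hx))
    have htne : t.Nonempty := by
      obtain ⟨x, hx⟩ := hne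
      obtain ⟨y, hy, -⟩ := mem_iUnion₂.1 (hcov hx)
      exact ⟨y, hy⟩
    obtain ⟨e, rfl⟩ := htc.exists_eq_range htne
    set V : ℕ → Set X := disjointed fun i => interior (U (e i)) with hV
    have hVm : ∀ i, MeasurableSet (V i) :=
      fun i => MeasurableSet.disjointed (fun _ => isOpen_interior.measurableSet) i
    have hAV : A = ⋃ i, A ∩ V i := by
      rw [← inter_iUnion, iUnion_disjointed, eq_comm, inter_eq_left]
      refine hAS.trans (hcov.trans ?_)
      rw [biUnion_range]
    have hdisj : Pairwise (Function.onFun Disjoint fun i => A ∩ V i) := fun i j hij =>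
      (disjoint_disjointed _ hij).mono inter_subset_right inter_subset_right
    have hm : ∀ i, MeasurableSet (A ∩ V i) := fun i => hA.inter (hVm i)
    rw [hAV, measure_iUnion hdisj hm, measure_iUnion hdisj hm, ← ENNReal.tsum_mul_left]
    refine ENNReal.tsum_le_tsum fun i => ?_
    refine hUA (e i) (htS (mem_range_self i)) _ ?_ (hm i)
    exact fun x hx => ⟨hAS hx.1, interior_subset (disjointed_subset _ i hx.2)⟩
  have hlim : Tendsto (fun c : ℝ => ENNReal.ofReal c * ν A) (𝓝[>] 1)
      (𝓝 (ENNReal.ofReal 1 * ν A)) :=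
    ENNReal.Tendsto.mul_const
      (tendsto_nhdsWithin_of_tendsto_nhds (ENNReal.continuous_ofReal.tendsto 1)) (by simp)
  rw [ENNReal.ofReal_one, one_mul] at hlim
  exact ge_of_tendsto hlim (by filter_upwards [self_mem_nhdsWithin] with c hc using key c hc)

variable {K : Set (Eucl n)}

/-- Near a smooth boundary point `z₀`, the central projection of `∂K` to the tangent hyperplane is
bi-Lipschitz with constants close to one. -/
lemma ConvexNhd.exists_centralProjection_biLipschitz (h : ConvexNhd K) {z₀ : Eucl n}
    (hu : ∃! u, IsUnitNormal K z₀ u) {L : ℝ} (hL : 1 < L) :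
    ∃ U ∈ 𝓝 z₀, (∀ x ∈ U, (inner ℝ z₀ (gaussMap K z₀) : ℝ) / L ≤ inner ℝ x (gaussMap K z₀) ∧
        (inner ℝ x (gaussMap K z₀) : ℝ) ≤ L * inner ℝ z₀ (gaussMap K z₀)) ∧
      ∀ x ∈ frontier K ∩ U, ∀ y ∈ frontier K ∩ U,
        ‖((inner ℝ z₀ (gaussMap K z₀) : ℝ) / inner ℝ x (gaussMap K z₀)) • x -
          ((inner ℝ z₀ (gaussMap K z₀) : ℝ) / inner ℝ y (gaussMap K z₀)) • y‖ ≤ L * ‖x - y‖ ∧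
        ‖x - y‖ ≤ L * ‖((inner ℝ z₀ (gaussMap K z₀) : ℝ) / inner ℝ x (gaussMap K z₀)) • x -
          ((inner ℝ z₀ (gaussMap K z₀) : ℝ) / inner ℝ y (gaussMap K z₀)) • y‖ := by
  set ν := gaussMap K z₀ with hν
  set d : ℝ := inner ℝ z₀ ν with hd
  have hd0 : 0 < d := h.inner_normal_pos (isUnitNormal_gaussMap hu)
  -- The projection will differ from the identity by an η-Lipschitz map. This η serves both
  -- directions: 1 + η ≤ L, and 1 - η = 1/L.
  set η : ℝ := 1 - 1 / L with hη
  have hη0 : 0 < η := by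
    have : 1 / L < 1 := by rw [div_lt_one (by linarith)]; exact hL
    linarith
  set M : ℝ := ‖z₀‖ + 1 with hM
  have hM0 : 0 < M := by positivity
  -- With heights above d/2 the factors d/a and d/b differ by at most (4/d)|a - b|, and
  -- (4/d)(ηd/(8M))M = η/2. The other half of η comes from |d/a - 1| < η/2.
  obtain ⟨U₁, hU₁, hsec⟩ := h.eventually_abs_inner_sub_le hu (ε := η * d / (8 * M)) (by positivity)
  have hcont : Continuous fun x : Eucl n => (inner ℝ x ν : ℝ) := by fun_prop
  have hL1 : d / L < d := by rw [div_lt_iff₀ (by linarith)]; nlinarith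
  have hL2 : d < L * d := by nlinarith
  have e1 : ∀ᶠ x in 𝓝 z₀, d / L < (inner ℝ x ν : ℝ) := hcont.continuousAt.eventually_const_lt hL1
  have e2 : ∀ᶠ x in 𝓝 z₀, (inner ℝ x ν : ℝ) < L * d := hcont.continuousAt.eventually_lt_const hL2
  have e3 : ∀ᶠ x in 𝓝 z₀, d / 2 < (inner ℝ x ν : ℝ) :=
    hcont.continuousAt.eventually_const_lt (by linarith)
  have e4 : ∀ᶠ x in 𝓝 z₀, |d / (inner ℝ x ν : ℝ) - 1| < η / 2 := by
    have hc : ContinuousAt (fun x : Eucl n => |d / (inner ℝ x ν : ℝ) - 1|) z₀ := by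
      have : ContinuousAt (fun x : Eucl n => d / (inner ℝ x ν : ℝ)) z₀ :=
        continuousAt_const.div hcont.continuousAt hd0.ne'
      exact (this.sub continuousAt_const).abs
    refine hc.eventually_lt_const ?_
    change |d / d - 1| < η / 2
    rw [div_self hd0.ne']
    simpa using hη0
  have e5 : ∀ᶠ x in 𝓝 z₀, ‖x‖ < M :=
    continuous_norm.continuousAt.eventually_lt_const (by linarith)
  refine ⟨_, inter_mem hU₁ (inter_mem (inter_mem e1 e2) (inter_mem e3 (inter_mem e4 e5))),
    fun x hx => ⟨le_of_lt hx.2.1.1, le_of_lt hx.2.1.2⟩, ?_⟩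
  rintro x ⟨hxK, hxU, ⟨-, -⟩, hx3, hx4, hx5⟩ y ⟨hyK, hyU, ⟨-, -⟩, hy3, hy4, hy5⟩
  have hx3 : d / 2 < (inner ℝ x ν : ℝ) := hx3
  have hx4 : |d / (inner ℝ x ν : ℝ) - 1| < η / 2 := hx4
  have hy3 : d / 2 < (inner ℝ y ν : ℝ) := hy3
  have hy5 : ‖y‖ < M := hy5
  set a : ℝ := inner ℝ x ν with ha
  set b : ℝ := inner ℝ y ν with hb
  have ha0 : 0 < a := by linarith
  have hb0 : 0 < b := by linarith
  have hxy := hsec x ⟨hxK, hxU⟩ y ⟨hyK, hyU⟩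
  rw [inner_sub_left, ← ha, ← hb] at hxy
  have hdiff : ‖((d / a) • x - (d / b) • y) - (x - y)‖ ≤ η * ‖x - y‖ := by
    have heq : ((d / a) • x - (d / b) • y) - (x - y) =
        (d / a - 1) • (x - y) + (d / a - d / b) • y := by module
    have hab : |d / a - d / b| ≤ 4 / d * |a - b| := by
      have h1 : d / a - d / b = d / (a * b) * (b - a) := by field_simp
      rw [h1, abs_mul, abs_of_pos (by positivity), abs_sub_comm b a]
      refine mul_le_mul_of_nonneg_right ?_ (abs_nonneg _)
      rw [div_le_div_iff₀ (by positivity) hd0]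
      nlinarith
    rw [heq]
    refine (norm_add_le _ _).trans ?_
    rw [norm_smul, norm_smul, Real.norm_eq_abs, Real.norm_eq_abs]
    calc |d / a - 1| * ‖x - y‖ + |d / a - d / b| * ‖y‖
        ≤ η / 2 * ‖x - y‖ + (4 / d * (η * d / (8 * M) * ‖x - y‖)) * M := by
          gcongr
          exact hab.trans (by gcongr)
      _ = η * ‖x - y‖ := by field_simp; ring
  have hLinv : L * (1 / L) = 1 := by field_simp
  constructor
  · calc ‖(d / a) • x - (d / b) • y‖
        = ‖((d / a) • x - (d / b) • y) - (x - y) + (x - y)‖ := by rw [sub_add_cancel]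
      _ ≤ η * ‖x - y‖ + ‖x - y‖ := (norm_add_le _ _).trans (by gcongr)
      _ = (1 + η) * ‖x - y‖ := by ring
      _ ≤ L * ‖x - y‖ := by
        gcongr
        have : 0 ≤ (L - 1) ^ 2 / L := by positivity
        have h2 : (L - 1) ^ 2 / L = L - 2 + 1 / L := by field_simp; ring
        linarith
  · have h1 : ‖x - y‖ ≤ ‖(d / a) • x - (d / b) • y‖ + η * ‖x - y‖ := by
      have := norm_sub_le ((d / a) • x - (d / b) • y) (((d / a) • x - (d / b) • y) - (x - y))
      rw [sub_sub_cancel] at this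
      linarith
    have h2 : 1 / L * ‖x - y‖ ≤ ‖(d / a) • x - (d / b) • y‖ := by
      have : (1 : ℝ) / L = 1 - η := by rw [hη]; ring
      rw [this]; linarith
    calc ‖x - y‖ = L * (1 / L * ‖x - y‖) := by rw [← mul_assoc, hLinv, one_mul]
      _ ≤ _ := by gcongr

/-- Near a smooth boundary point the cone measure is comparable to the surface measure. -/
lemma ConvexNhd.exists_coneMeasure_compare [NeZero n] (h : ConvexNhd K) {z₀ : Eucl n}
    (hu : ∃! u, IsUnitNormal K z₀ u) {L : ℝ} (hL : 1 < L) :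
    ∃ U ∈ 𝓝 z₀, ∀ A ⊆ frontier K ∩ U, MeasurableSet A →
      coneMeasure K A ≤ ENNReal.ofReal L ^ (2 * n) *
        (ENNReal.ofReal (inner ℝ z₀ (gaussMap K z₀)) *
          (Measure.euclideanHausdorffMeasure (n - 1) : Measure (Eucl n)) A) ∧
      ENNReal.ofReal (inner ℝ z₀ (gaussMap K z₀)) *
          (Measure.euclideanHausdorffMeasure (n - 1) : Measure (Eucl n)) A ≤
        ENNReal.ofReal L ^ (2 * n) * coneMeasure K A := by
  obtain ⟨U, hU, hUd, hUL⟩ := h.exists_centralProjection_biLipschitz hu hL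
  refine ⟨U, hU, fun A hAU hA => ?_⟩
  set ν := gaussMap K z₀ with hν
  set d : ℝ := inner ℝ z₀ ν with hd
  have hνn : ‖ν‖ = 1 := (isUnitNormal_gaussMap hu).1
  have hd0 : 0 < d := h.inner_normal_pos (isUnitNormal_gaussMap hu)
  have hL0 : 0 < L := by linarith
  have hpos : ∀ x ∈ A, 0 < (inner ℝ x ν : ℝ) := fun x hx =>
    lt_of_lt_of_le (by positivity) (hUd x (hAU hx).2).1
  set P : Eucl n → Eucl n := fun x => (d / (inner ℝ x ν : ℝ)) • x with hP
  have hPν : ∀ x ∈ A, (inner ℝ (P x) ν : ℝ) = d := fun x hx => by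
    have := (hpos x hx).ne'
    simp only [hP, real_inner_smul_left]
    field_simp
  have hinj : InjOn P A := by
    intro x hx y hy hxy
    have := (hUL x (hAU hx) y (hAU hy)).2
    have h0 : P x - P y = 0 := sub_eq_zero.2 hxy
    simp only [hP] at h0
    rw [h0, norm_zero, mul_zero] at this
    exact sub_eq_zero.1 (norm_le_zero_iff.1 this)
  have hcontP : ContinuousOn P A := by
    refine ContinuousOn.smul (continuousOn_const.div ?_ fun x hx => (hpos x hx).ne') continuousOn_id
    exact Continuous.continuousOn (by fun_prop)
  have hBm : MeasurableSet (P '' A) := hA.image_of_continuousOn_injOn hcontP hinj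
  have hBd : ∀ x ∈ P '' A, (inner ℝ x ν : ℝ) = d := by
    rintro _ ⟨x, hx, rfl⟩
    exact hPν x hx
  have hflat := volume_cone_flat hνn hd0 hBm hBd
  have hcone := h.coneMeasure_apply hA
  set CB := {x : Eucl n | 0 < (inner ℝ x ν : ℝ) ∧ (inner ℝ x ν : ℝ) ≤ d ∧
    (d / inner ℝ x ν) • x ∈ P '' A} with hCB
  set CA := {x | 0 < gauge K x ∧ gauge K x ≤ 1 ∧ (gauge K x)⁻¹ • x ∈ A} with hCA
  have hgA : ∀ z ∈ A, gauge K z = 1 := fun z hz =>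
    (gauge_eq_one_iff_mem_frontier h.convex h.nhds).2 (hAU hz).1
  -- The cone over A and the flat cone over its projection use the same rays, and their radii differ
  -- by a factor between 1/L and L. Each is thus contained in the L-dilate of the other.
  have hsub1 : CA ⊆ L • CB := by
    rintro x ⟨h1, h2, h3⟩
    rw [mem_smul_set_iff_inv_smul_mem₀ hL0.ne']
    have h4 := hpos _ h3
    have h5 := (hUd _ (hAU h3).2).2
    rw [real_inner_smul_left] at h4 h5
    have h6 : 0 < (inner ℝ x ν : ℝ) := by
      have := mul_pos h1 h4
      rwa [← mul_assoc, mul_inv_cancel₀ h1.ne', one_mul] at this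
    have h7 : (inner ℝ x ν : ℝ) ≤ L * d := by
      have : (inner ℝ x ν : ℝ) = gauge K x * ((gauge K x)⁻¹ * inner ℝ x ν) := by field_simp
      rw [this]
      nlinarith [mul_pos hL0 hd0]
    refine ⟨?_, ?_, ⟨_, h3, ?_⟩⟩
    · rw [real_inner_smul_left]; positivity
    · rw [real_inner_smul_left, inv_mul_le_iff₀ hL0]; exact h7
    · simp only [hP, real_inner_smul_left, smul_smul]
      congr 1
      field_simp
  have hsub2 : CB ⊆ L • CA := by
    rintro x ⟨h1, h2, ⟨z, hz, hzx⟩⟩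
    rw [mem_smul_set_iff_inv_smul_mem₀ hL0.ne']
    have hzν := hpos z hz
    have hx : x = ((inner ℝ x ν : ℝ) / inner ℝ z ν) • z := by
      simp only [hP] at hzx
      have h3 : x = ((inner ℝ x ν : ℝ) / d) • (d / (inner ℝ x ν : ℝ)) • x := by
        rw [smul_smul]
        have : (inner ℝ x ν : ℝ) / d * (d / inner ℝ x ν) = 1 := by field_simp
        rw [this, one_smul]
      rw [← hzx, smul_smul] at h3
      rw [h3]
      congr 1
      rw [real_inner_smul_left]
      field_simp
    have hgx : gauge K x = (inner ℝ x ν : ℝ) / inner ℝ z ν := by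
      conv_lhs => rw [hx]
      rw [ConvexNhd.gauge_smul_of_pos _ (by positivity), hgA z hz, mul_one]
    have hgp : 0 < gauge K x := by rw [hgx]; positivity
    have h8 := (hUd z (hAU hz).2).1
    rw [div_le_iff₀ hL0] at h8
    refine ⟨?_, ?_, ?_⟩
    · rw [ConvexNhd.gauge_smul_of_pos _ (by positivity)]; positivity
    · rw [ConvexNhd.gauge_smul_of_pos _ (by positivity), inv_mul_le_iff₀ hL0, mul_one, hgx,
        div_le_iff₀ hzν]
      linarith
    · rw [ConvexNhd.gauge_smul_of_pos _ (by positivity), smul_smul, mul_inv, inv_inv, mul_right_comm,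
        mul_inv_cancel₀ hL0.ne', one_mul]
      have : (gauge K x)⁻¹ • x = z := by
        rw [hgx]
        conv_lhs => rw [hx]
        rw [smul_smul]
        have h9 : ((inner ℝ (((inner ℝ x ν : ℝ) / inner ℝ z ν) • z) ν : ℝ) / inner ℝ z ν)⁻¹ *
            ((inner ℝ x ν : ℝ) / inner ℝ z ν) = 1 := by
          rw [real_inner_smul_left]; field_simp
        rw [h9, one_smul]
      rw [this]; exact hz
  have hvol : ∀ S : Set (Eucl n), volume (L • S) = ENNReal.ofReal L ^ n * volume S := by
    intro S
    rw [Measure.addHaar_smul, finrank_euclideanSpace_fin, abs_of_nonneg (by positivity),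
      ENNReal.ofReal_pow hL0.le]
  have hlip1 : LipschitzOnWith L.toNNReal P A := by
    refine LipschitzOnWith.of_dist_le_mul fun x hx y hy => ?_
    rw [dist_eq_norm, dist_eq_norm, Real.coe_toNNReal _ hL0.le]
    exact (hUL x (hAU hx) y (hAU hy)).1
  have hlip2 : LipschitzOnWith L.toNNReal (Function.invFunOn P A) (P '' A) := by
    refine LipschitzOnWith.of_dist_le_mul ?_
    rintro _ ⟨x, hx, rfl⟩ _ ⟨y, hy, rfl⟩
    rw [hinj.leftInvOn_invFunOn hx, hinj.leftInvOn_invFunOn hy, dist_eq_norm, dist_eq_norm,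
      Real.coe_toNNReal _ hL0.le]
    exact (hUL x (hAU hx) y (hAU hy)).2
  have hH1 := euclideanHausdorffMeasure_image_le (m := n - 1) hlip1
  have hH2 := euclideanHausdorffMeasure_image_le (m := n - 1) hlip2
  rw [hinj.leftInvOn_invFunOn.image_image] at hH2
  have hLe : ((L.toNNReal : NNReal) : ENNReal) = ENNReal.ofReal L := rfl
  rw [hLe] at hH1 hH2
  have hL1 : 1 ≤ ENNReal.ofReal L := by simpa using ENNReal.ofReal_le_ofReal hL.le
  -- Volume costs L^n, the surface measure of the projected set costs L^{n-1}.
  have hpow : ENNReal.ofReal L ^ n * ENNReal.ofReal L ^ (n - 1) ≤ ENNReal.ofReal L ^ (2 * n) := by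
    rw [← pow_add]
    exact pow_le_pow_right₀ hL1 (by omega)
  constructor
  · calc coneMeasure K A = n * volume CA := hcone
      _ ≤ n * (ENNReal.ofReal L ^ n * volume CB) := by
        rw [← hvol]; gcongr
      _ = ENNReal.ofReal L ^ n * (n * volume CB) := by ring
      _ ≤ ENNReal.ofReal L ^ n * (ENNReal.ofReal d * (ENNReal.ofReal L ^ (n - 1) *
          (Measure.euclideanHausdorffMeasure (n - 1) : Measure (Eucl n)) A)) := by
        rw [hflat]; gcongr
      _ = (ENNReal.ofReal L ^ n * ENNReal.ofReal L ^ (n - 1)) * (ENNReal.ofReal d *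
          (Measure.euclideanHausdorffMeasure (n - 1) : Measure (Eucl n)) A) := by ring
      _ ≤ _ := by gcongr
  · calc ENNReal.ofReal d * (Measure.euclideanHausdorffMeasure (n - 1) : Measure (Eucl n)) A
        ≤ ENNReal.ofReal d * (ENNReal.ofReal L ^ (n - 1) *
          (Measure.euclideanHausdorffMeasure (n - 1) : Measure (Eucl n)) (P '' A)) := by gcongr
      _ = ENNReal.ofReal L ^ (n - 1) * (n * volume CB) := by rw [hflat]; ring
      _ ≤ ENNReal.ofReal L ^ (n - 1) * (n * (ENNReal.ofReal L ^ n * volume CA)) := by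
        rw [← hvol]; gcongr
      _ = (ENNReal.ofReal L ^ n * ENNReal.ofReal L ^ (n - 1)) * coneMeasure K A := by
        rw [hcone]; ring
      _ ≤ _ := by gcongr

/-- The cone measure has density `⟨z, ν_K(z)⟩` with respect to the surface measure. -/
lemma ConvexNhd.coneMeasure_eq [NeZero n] (h : ConvexNhd K) :
    coneMeasure K = ((Measure.euclideanHausdorffMeasure (n - 1) : Measure (Eucl n)).restrict
      (frontier K ∩ {x | ∃! u, IsUnitNormal K x u})).withDensity
        fun x => ENNReal.ofReal (inner ℝ x (gaussMap K x)) := by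
  set H := (Measure.euclideanHausdorffMeasure (n - 1) : Measure (Eucl n)) with hH
  set S := frontier K ∩ {x | ∃! u, IsUnitNormal K x u} with hS
  have hSm : MeasurableSet S :=
    isClosed_frontier.measurableSet.inter (measurableSet_setOf_existsUnique_normal K)
  have hdm : Measurable fun x : Eucl n => ENNReal.ofReal (inner ℝ x (gaussMap K x)) :=
    (measurable_id.inner (measurable_gaussMap K)).ennreal_ofReal
  set m := (H.restrict S).withDensity fun x => ENNReal.ofReal (inner ℝ x (gaussMap K x)) with hm
  have hmA : ∀ A ⊆ S, MeasurableSet A →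
      m A = ∫⁻ x in A, ENNReal.ofReal (inner ℝ x (gaussMap K x)) ∂H := by
    intro A hAS hA
    rw [hm, withDensity_apply _ hA, Measure.restrict_restrict hA, inter_eq_left.2 hAS]
  have hlocal : ∀ c : ℝ, 1 < c → ∀ z₀ ∈ S, ∃ U ∈ 𝓝 z₀, ∀ A ⊆ S ∩ U, MeasurableSet A →
      coneMeasure K A ≤ ENNReal.ofReal c * m A ∧ m A ≤ ENNReal.ofReal c * coneMeasure K A := by
    intro c hc z₀ hz₀
    -- The comparison of measures uses L^{2n}; one more factor L pays for the variation of the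
    -- density ⟨x, ν(x)⟩ near z₀.
    obtain ⟨L, hL, hLc⟩ : ∃ L : ℝ, 1 < L ∧ L ^ (2 * n + 1) < c := by
      have hcont : ContinuousAt (fun L : ℝ => L ^ (2 * n + 1)) 1 := by fun_prop
      have h1 : ∀ᶠ L : ℝ in 𝓝[>] 1, L ^ (2 * n + 1) < c :=
        nhdsWithin_le_nhds (hcont.eventually_lt_const (by simpa using hc))
      obtain ⟨L, h1, h2⟩ := (h1.and self_mem_nhdsWithin).exists
      exact ⟨L, h2, h1⟩
    have hL0 : 0 < L := by linarith
    obtain ⟨U, hU, hUA⟩ := h.exists_coneMeasure_compare hz₀.2 hL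
    set ν := gaussMap K z₀ with hν
    set d : ℝ := inner ℝ z₀ ν with hd
    have hd0 : 0 < d := h.inner_normal_pos (isUnitNormal_gaussMap hz₀.2)
    -- Moving x and its unit normal by at most ε changes ⟨x, u⟩ by at most ε(‖z₀‖ + 1), which keeps
    -- it between d/L and Ld.
    set ε : ℝ := min (d - d / L) (L * d - d) / (‖z₀‖ + 1) with hε
    have hLd1 : d / L < d := by rw [div_lt_iff₀ hL0]; nlinarith
    have hLd2 : d < L * d := by nlinarith
    have hmin : 0 < min (d - d / L) (L * d - d) := lt_min (by linarith) (by linarith)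
    have hε0 : 0 < ε := by positivity
    have hnear : ∀ᶠ x in 𝓝 z₀, ∀ u, IsUnitNormal K x u →
        d / L ≤ (inner ℝ x u : ℝ) ∧ (inner ℝ x u : ℝ) ≤ L * d := by
      filter_upwards [eventually_normal_near hz₀.2 hε0, Metric.ball_mem_nhds z₀ hε0] with x hx hxz u hxu
      have h1 := hx u hxu
      rw [mem_ball_iff_norm] at hxz
      have h2 : (inner ℝ x u : ℝ) - d = inner ℝ (x - z₀) u + inner ℝ z₀ (u - ν) := by
        rw [inner_sub_left, inner_sub_right, hd]; ring
      have h3 : |(inner ℝ x u : ℝ) - d| ≤ ε * (‖z₀‖ + 1) := by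
        rw [h2]
        refine (abs_add_le _ _).trans ?_
        have h4 := abs_real_inner_le_norm (x - z₀) u
        have h5 := abs_real_inner_le_norm z₀ (u - ν)
        rw [hxu.1, mul_one] at h4
        have h6 : ‖z₀‖ * ‖u - ν‖ ≤ ‖z₀‖ * ε := by gcongr
        linarith
      rw [hε, div_mul_cancel₀ _ (by positivity)] at h3
      have h4 := abs_le.1 h3
      constructor
      · linarith [h4.1, min_le_left (d - d / L) (L * d - d)]
      · linarith [h4.2, min_le_right (d - d / L) (L * d - d)]
    refine ⟨_, inter_mem hU hnear, fun A hA hAm => ?_⟩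
    have hAS : A ⊆ S := fun x hx => (hA hx).1
    obtain ⟨hc1, hc2⟩ := hUA A (fun x hx => ⟨(hA hx).1.1, (hA hx).2.1⟩) hAm
    have hbd : ∀ x ∈ A, d / L ≤ (inner ℝ x (gaussMap K x) : ℝ) ∧
        (inner ℝ x (gaussMap K x) : ℝ) ≤ L * d := fun x hx =>
      (hA hx).2.2 _ (isUnitNormal_gaussMap (hA hx).1.2)
    have hm1 : m A ≤ ENNReal.ofReal L * (ENNReal.ofReal d * H A) := by
      rw [hmA A hAS hAm, ← mul_assoc, ← ENNReal.ofReal_mul hL0.le, ← setLIntegral_const]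
      exact setLIntegral_mono measurable_const fun x hx => ENNReal.ofReal_le_ofReal (hbd x hx).2
    have hm2 : ENNReal.ofReal d * H A ≤ ENNReal.ofReal L * m A := by
      rw [hmA A hAS hAm, ← setLIntegral_const, ← lintegral_const_mul _ hdm]
      refine setLIntegral_mono (hdm.const_mul _) fun x hx => ?_
      rw [← ENNReal.ofReal_mul hL0.le]
      refine ENNReal.ofReal_le_ofReal ?_
      have := (hbd x hx).1
      rw [div_le_iff₀ hL0] at this
      linarith
    have hLc' : ENNReal.ofReal L ^ (2 * n) * ENNReal.ofReal L ≤ ENNReal.ofReal c := by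
      rw [← pow_succ, ← ENNReal.ofReal_pow hL0.le]
      exact ENNReal.ofReal_le_ofReal hLc.le
    constructor
    · calc coneMeasure K A ≤ ENNReal.ofReal L ^ (2 * n) * (ENNReal.ofReal L * m A) :=
          hc1.trans (by gcongr)
        _ = (ENNReal.ofReal L ^ (2 * n) * ENNReal.ofReal L) * m A := by ring
        _ ≤ _ := by gcongr
    · calc m A ≤ ENNReal.ofReal L * (ENNReal.ofReal L ^ (2 * n) * coneMeasure K A) :=
          hm1.trans (by gcongr)
        _ = (ENNReal.ofReal L ^ (2 * n) * ENNReal.ofReal L) * coneMeasure K A := by ring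
        _ ≤ _ := by gcongr
  have hS1 : coneMeasure K Sᶜ = 0 := by
    filter_upwards [h.ae_mem_frontier, h.ae_coneMeasure_existsUnique_normal] with z h1 h2
    exact ⟨h1, h2⟩
  have hS2 : m Sᶜ = 0 := by
    refine withDensity_absolutelyContinuous _ _ ?_
    rw [Measure.restrict_apply hSm.compl, compl_inter_self, measure_empty]
  ext A hA
  have heq : coneMeasure K (A ∩ S) = m (A ∩ S) := by
    refine le_antisymm ?_ ?_
    · refine measure_le_of_local (S := S) (fun c hc z hz => ?_) (hA.inter hSm) inter_subset_right
      obtain ⟨U, hU, hUA⟩ := hlocal c hc z hz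
      exact ⟨U, hU, fun B hB hBm => (hUA B hB hBm).1⟩
    · refine measure_le_of_local (S := S) (fun c hc z hz => ?_) (hA.inter hSm) inter_subset_right
      obtain ⟨U, hU, hUA⟩ := hlocal c hc z hz
      exact ⟨U, hU, fun B hB hBm => (hUA B hB hBm).2⟩
  rwa [measure_inter_conull hS1, measure_inter_conull hS2] at heq

end HausdorffComparison


/-! ### Almost everywhere differentiability and radial continuity of φ -/

section Regularity

variable {φ : Eucl n → EReal}

/-- A convex set has interior points exactly when its affine span is everything, and a
finite-dimensional affine span is closed, so closing the domain does not enlarge it. For convex sets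
with interior points the two interiors agree. -/
lemma interior_closure_dom (hφ : IsConv φ) (hne : (interior (closure (dom φ))).Nonempty) :
    interior (closure (dom φ)) = interior (dom φ) := by
  refine hφ.convex_dom.interior_closure_eq_interior_of_nonempty_interior ?_
  rw [hφ.convex_dom.interior_nonempty_iff_affineSpan_eq_top]
  rw [hφ.convex_dom.closure.interior_nonempty_iff_affineSpan_eq_top] at hne
  rw [eq_top_iff, ← hne, affineSpan_le]
  exact closure_minimal (subset_affineSpan _ _) (affineSpan ℝ _).closed_of_finiteDimensional

lemma IsConv.coe_toReal (hφ : IsConv φ) {x : Eucl n} (hx : x ∈ dom φ) :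
    ((φ x).toReal : EReal) = φ x :=
  EReal.coe_toReal (ne_of_lt hx) (hφ.ne_bot x)

lemma IsConv.convexOn_toReal (hφ : IsConv φ) : ConvexOn ℝ (dom φ) fun z => (φ z).toReal := by
  refine ⟨hφ.convex_dom, fun x hx y hy a b ha hb hab => ?_⟩
  have h1 := hφ.convex_le ha hb hab (hφ.coe_toReal hx).ge (hφ.coe_toReal hy).ge
  rw [← hφ.coe_toReal (hφ.convex_dom hx hy ha hb hab)] at h1
  exact_mod_cast h1

lemma ae_differentiableAt_of_locallyLipschitzOn {U : Set (Eucl n)} (hU : IsOpen U)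
    {g : Eucl n → ℝ} (hg : LocallyLipschitzOn U g) :
    ∀ᵐ x, x ∈ U → DifferentiableAt ℝ g x := by
  have : volume {x | ¬ (x ∈ U → DifferentiableAt ℝ g x)} = 0 := by
    refine measure_null_of_locally_null _ fun x hx => ?_
    simp only [Classical.not_imp] at hx
    obtain ⟨C, t, ht, hC⟩ := hg hx.1
    rw [hU.nhdsWithin_eq hx.1] at ht
    refine ⟨{x | ¬ (x ∈ U → DifferentiableAt ℝ g x)} ∩ interior t,
      inter_mem self_mem_nhdsWithin (mem_nhdsWithin_of_mem_nhds (interior_mem_nhds.2 ht)), ?_⟩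
    refine measure_mono_null ?_ (hC.mono interior_subset).ae_differentiableWithinAt_of_mem
    rintro y ⟨hy, hyt⟩ hcon
    simp only [Classical.not_imp] at hy
    exact hy.2 ((hcon hyt).differentiableAt (isOpen_interior.mem_nhds hyt))
  exact this

lemma IsConv.ae_differentiableAt (hφ : IsConv φ) :
    ∀ᵐ x, x ∈ interior (dom φ) → DifferentiableAt ℝ (fun z => (φ z).toReal) x :=
  ae_differentiableAt_of_locallyLipschitzOn isOpen_interior
    hφ.convexOn_toReal.locallyLipschitzOn_interior

lemma IsConv.ae_mem_interior (hφ : IsConv φ) : ∀ᵐ x, x ∈ dom φ → x ∈ interior (dom φ) := by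
  have : ∀ᵐ x, x ∉ frontier (dom φ) := by
    rw [ae_iff]; simpa using hφ.convex_dom.addHaar_frontier volume
  filter_upwards [this] with x hx hxd
  by_contra hcon
  exact hx ⟨subset_closure hxd, hcon⟩

lemma IsConv.ae_hasGradientAt (hφ : IsConv φ) : ∀ᵐ x, x ∈ dom φ →
    x ∈ interior (dom φ) ∧ HasGradientAt (fun z => (φ z).toReal) (grad φ x) x := by
  filter_upwards [hφ.ae_differentiableAt, hφ.ae_mem_interior] with x h1 h2 hx
  exact ⟨h2 hx, (h1 (h2 hx)).hasGradientAt⟩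

lemma measurable_grad (φ : Eucl n → EReal) : Measurable (grad φ) := by
  unfold grad gradient
  exact (InnerProductSpace.toDual ℝ (Eucl n)).symm.continuous.measurable.comp (measurable_fderiv ℝ _)

lemma Dominated.ae_legendre_grad_eq {ψ : Eucl n → EReal} {β₁ β₂ : ℝ} (h : Dominated φ ψ β₁ β₂) :
    ∀ᵐ x, x ∈ dom φ → x ∈ interior (dom φ) ∧
      HasGradientAt (fun z => (φ z).toReal) (grad φ x) x ∧
      legendre ψ (grad φ x) = ((legendre ψ (grad φ x)).toReal : EReal) := by
  filter_upwards [h.conv.ae_hasGradientAt] with x hx hxd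
  obtain ⟨h1, h2⟩ := hx hxd
  obtain ⟨b, hb⟩ := h.exists_legendre_grad_eq (h.conv.coe_toReal hxd).symm h2
  exact ⟨h1, h2, by rw [hb, EReal.toReal_coe]⟩

/-- Lower semicontinuity bounds the limit from below, convexity on the segment from 0 to x from
above. At a boundary point f is therefore the radial limit of its interior values. -/
lemma IsConv.tendsto_radial (hφ : IsConv φ) (h0 : 0 ∈ dom φ) (x : Eucl n) :
    Tendsto (fun s : ℝ => φ (s • x)) (𝓝[<] 1) (𝓝 (φ x)) := by
  refine tendsto_order.2 ⟨fun c hc => ?_, fun c hc => ?_⟩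
  · have h1 : ∀ᶠ y in 𝓝 x, c < φ y := hφ.lsc x c hc
    have h2 : Tendsto (fun s : ℝ => s • x) (𝓝[<] 1) (𝓝 x) := by
      have : Tendsto (fun s : ℝ => s • x) (𝓝 1) (𝓝 ((1 : ℝ) • x)) :=
        (continuous_id.smul continuous_const).tendsto 1
      rw [one_smul] at this
      exact this.mono_left nhdsWithin_le_nhds
    exact h2.eventually h1
  · obtain ⟨a, ha⟩ := hφ.exists_coe h0
    obtain ⟨b, hb⟩ := hφ.exists_coe (x := x) (lt_of_lt_of_le hc le_top)
    have h1 : Tendsto (fun s : ℝ => (((1 - s) * a + s * b : ℝ) : EReal)) (𝓝[<] 1) (𝓝 (b : EReal)) := by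
      have : Tendsto (fun s : ℝ => (1 - s) * a + s * b) (𝓝 1) (𝓝 ((1 - 1) * a + 1 * b)) :=
        (by fun_prop : Continuous fun s : ℝ => (1 - s) * a + s * b).tendsto 1
      rw [sub_self, zero_mul, zero_add, one_mul] at this
      exact (continuous_coe_real_ereal.tendsto b).comp (this.mono_left nhdsWithin_le_nhds)
    rw [hb] at hc
    filter_upwards [h1.eventually_lt_const hc, Ioo_mem_nhdsLT (zero_lt_one : (0 : ℝ) < 1)] with s hs hs1
    refine lt_of_le_of_lt ?_ hs
    have := hφ.convex_le (sub_nonneg.2 hs1.2.le) hs1.1.le (by ring) ha.le hb.le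
    simpa using this

end Regularity

/-! ### The divergence identity along one ray -/

section RadialFTC

variable {φ : Eucl n → EReal} {α : ℝ}

/-- The integrand of the divergence identity `div (f(x) x) = n f(x) - ⟨x, ∇φ(x)⟩ f(x)^{1-α}`. -/
def eulerIntegrand (α : ℝ) (φ : Eucl n → EReal) (x : Eucl n) : ℝ :=
  n * Psi α (φ x) - inner ℝ x (grad φ x) * Psi α (φ x) ^ (1 - α)

lemma eulerIntegrand_of_top (hα0 : α < 0) {x : Eucl n} (h : φ x = ⊤) : eulerIntegrand α φ x = 0 := by
  rw [eulerIntegrand, h, Psi_top, Real.zero_rpow (by linarith)]; simp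

/-- The integrand is the derivative of r^n f(rθ) for almost every r. Since φ is convex on the ray,
this function has a right derivative at every r in (0, R), so the fundamental theorem for right
derivatives applies. -/
lemma integral_ray_of_mem_interior [NeZero n] (hα0 : α < 0) (hφ : IsConv φ) (h0 : ∀ x, 0 ≤ φ x)
    (hz : (0 : Eucl n) ∈ interior (dom φ)) {θ : Eucl n} {R : ℝ} (hR : 0 ≤ R)
    (hRθ : R • θ ∈ interior (dom φ))
    (hdiff : ∀ᵐ r : ℝ, 0 < r → r • θ ∈ interior (dom φ) →
      DifferentiableAt ℝ (fun z => (φ z).toReal) (r • θ))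
    (hint : IntegrableOn (fun r => r ^ (n - 1) * eulerIntegrand α φ (r • θ)) (Ioi 0)) :
    ∫ r in (0 : ℝ)..R, r ^ (n - 1) * eulerIntegrand α φ (r • θ) = R ^ n * Psi α (φ (R • θ)) := by
  set T : Set ℝ := (fun r : ℝ => r • θ) ⁻¹' interior (dom φ) with hT
  have hlin : IsLinearMap ℝ (fun r : ℝ => r • θ) := (LinearMap.toSpanSingleton ℝ (Eucl n) θ).isLinear
  have hTo : IsOpen T := isOpen_interior.preimage (by fun_prop)
  have hTc : Convex ℝ T := hφ.convex_dom.interior.is_linear_preimage hlin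
  have hIcc : Icc 0 R ⊆ T := hTc.ordConnected.out (by simpa [hT] using hz) hRθ
  set h : ℝ → ℝ := fun r => (φ (r • θ)).toReal with hh
  have hconv : ConvexOn ℝ T h := by
    have h1 := hφ.convexOn_toReal.subset interior_subset hφ.convex_dom.interior
    exact h1.comp_linearMap (LinearMap.toSpanSingleton ℝ (Eucl n) θ)
  have hcoe : ∀ r ∈ T, φ (r • θ) = (h r : EReal) := fun r hr =>
    (hφ.coe_toReal (interior_subset hr)).symm
  have hpos : ∀ r ∈ T, 1 / α < h r := fun r hr => by
    have := one_div_lt_of_nonneg hα0 (h0 (r • θ))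
    rw [hcoe r hr] at this; exact_mod_cast this
  have hcont : ContinuousOn h T := hconv.continuousOn hTo
  set G : ℝ → ℝ := fun r => r ^ n * Psi α (h r : EReal) with hG
  set G' : ℝ → ℝ := fun r => (n * r ^ (n - 1)) * Psi α (h r : EReal) +
    r ^ n * (-(Psi α (h r : EReal)) ^ (1 - α) * derivWithin h (Ioi r) r) with hG'
  have hGc : ContinuousOn G (Icc 0 R) := by
    refine (continuous_pow n).continuousOn.mul fun r hr => ?_
    exact (hasDerivAt_Psi hα0 (hpos r (hIcc hr))).continuousAt.comp_continuousWithinAt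
      (f := h) ((hcont r (hIcc hr)).mono hIcc)
  have hGd : ∀ r ∈ Ioo 0 R, HasDerivWithinAt G (G' r) (Ioi r) r := by
    intro r hr
    have hrT := hIcc (Ioo_subset_Icc_self hr)
    have h1 := hconv.hasDerivWithinAt_rightDeriv_of_mem_interior (x := r)
      (by rwa [hTo.interior_eq])
    have h2 := (hasDerivAt_Psi hα0 (hpos r hrT)).comp_hasDerivWithinAt r h1
    exact (hasDerivAt_pow n r).hasDerivWithinAt.mul h2
  have hae : ∀ᵐ r : ℝ, r ∈ Ioc 0 R → r ^ (n - 1) * eulerIntegrand α φ (r • θ) = G' r := by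
    filter_upwards [hdiff] with r hr hrR
    have hrT : r ∈ T := hIcc (Ioc_subset_Icc_self hrR)
    have h1 := (hr hrR.1 hrT).hasGradientAt
    have h2 : HasDerivAt h (inner ℝ (grad φ (r • θ)) θ) r := by
      have h3 : HasDerivAt (fun r : ℝ => r • θ) θ r := by
        simpa using (hasDerivAt_id r).smul_const θ
      have h4 := h1.hasFDerivAt.comp_hasDerivAt r h3
      rw [InnerProductSpace.toDual_apply_apply] at h4
      exact h4
    have h5 : derivWithin h (Ioi r) r = inner ℝ (grad φ (r • θ)) θ :=
      h2.hasDerivWithinAt.derivWithin (uniqueDiffWithinAt_Ioi r)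
    have hn : r ^ n = r ^ (n - 1) * r := by
      rw [← pow_succ, Nat.sub_add_cancel (NeZero.one_le)]
    simp only [hG', h5, eulerIntegrand, hcoe r hrT, real_inner_smul_left, hn,
      real_inner_comm θ]
    ring
  have hae' : ∀ᵐ r : ℝ, r ∈ uIoc 0 R → r ^ (n - 1) * eulerIntegrand α φ (r • θ) = G' r := by
    rwa [uIoc_of_le hR]
  have hii : IntervalIntegrable G' volume 0 R := by
    rw [intervalIntegrable_iff_integrableOn_Ioc_of_le hR]
    refine (hint.mono_set Ioc_subset_Ioi_self).congr ?_
    rw [Filter.EventuallyEq, ae_restrict_iff' measurableSet_Ioc]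
    exact hae
  rw [intervalIntegral.integral_congr_ae hae',
    intervalIntegral.integral_eq_sub_of_hasDeriv_right_of_le hR hGc hGd hii]
  simp [hG, hcoe R hRθ, NeZero.ne n]

lemma integral_ray [NeZero n] (hα0 : α < 0) (hφ : IsConv φ) (h0 : ∀ x, 0 ≤ φ x)
    (hK : ConvexNhd (closure (dom φ))) {θ : Eucl n}
    (hdiff : ∀ᵐ r : ℝ, 0 < r → r • θ ∈ interior (dom φ) →
      DifferentiableAt ℝ (fun z => (φ z).toReal) (r • θ))
    (hint : IntegrableOn (fun r => r ^ (n - 1) * eulerIntegrand α φ (r • θ)) (Ioi 0))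
    (hf : IntegrableOn (fun r => r ^ (n - 1) * Psi α (φ (r • θ))) (Ioi 0)) :
    ∫ r in Ioi (0 : ℝ), r ^ (n - 1) * eulerIntegrand α φ (r • θ) =
      if 0 < gauge (closure (dom φ)) θ then (gauge (closure (dom φ)) θ ^ n)⁻¹ *
        Psi α (φ ((gauge (closure (dom φ)) θ)⁻¹ • θ)) else 0 := by
  set p := gauge (closure (dom φ)) θ with hp
  have hp0 : 0 ≤ p := gauge_nonneg _
  have hIC := interior_closure_dom hφ ⟨0, hK.zero_mem⟩
  have hz : (0 : Eucl n) ∈ interior (dom φ) := hIC ▸ hK.zero_mem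
  have hmem : ∀ r : ℝ, 0 ≤ r → (r • θ ∈ interior (dom φ) ↔ r * p < 1) := fun r hr => by
    rw [← hIC, ← gauge_lt_one_iff_mem_interior hK.convex hK.nhds, ConvexNhd.gauge_smul_of_pos _ hr]
  set Q : ℝ → ℝ := fun r => r ^ (n - 1) * eulerIntegrand α φ (r • θ) with hQ
  have key : ∀ R : ℝ, 0 ≤ R → R * p < 1 → ∫ r in (0 : ℝ)..R, Q r = R ^ n * Psi α (φ (R • θ)) :=
    fun R hR hRp => integral_ray_of_mem_interior hα0 hφ h0 hz hR ((hmem R hR).2 hRp) hdiff hint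
  -- If the ray meets ∂K, let the endpoint tend to the exit radius from inside; beyond that radius
  -- the integrand is zero.
  split_ifs with hpos
  · set R := p⁻¹ with hR
    have hR0 : 0 < R := inv_pos.2 hpos
    have hRp : R * p = 1 := inv_mul_cancel₀ hpos.ne'
    have hzero : ∀ r : ℝ, R < r → Q r = 0 := fun r hr => by
      have h1 : φ (r • θ) = ⊤ := by
        by_contra hne
        have h2 : r • θ ∈ closure (dom φ) := subset_closure (lt_of_le_of_ne le_top hne)
        have h3 := gauge_le_one_of_mem h2
        rw [ConvexNhd.gauge_smul_of_pos _ (hR0.le.trans hr.le), ← hp] at h3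
        nlinarith
      rw [hQ]; simp only [eulerIntegrand_of_top hα0 h1, mul_zero]
    have h1 : ∫ r in Ioi (0 : ℝ), Q r = ∫ r in (0 : ℝ)..R, Q r := by
      rw [intervalIntegral.integral_of_le hR0.le]
      refine (setIntegral_eq_of_subset_of_forall_sdiff_eq_zero measurableSet_Ioi Ioc_subset_Ioi_self
        fun r hr => hzero r ?_)
      have h2 : 0 < r := hr.1
      by_contra hcon
      exact hr.2 ⟨h2, not_lt.1 hcon⟩
    rw [h1, ← inv_pow, ← hR]
    have hprim : ContinuousOn (fun b => ∫ r in (0 : ℝ)..b, Q r) (uIcc 0 R) :=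
      intervalIntegral.continuousOn_primitive_interval (by
        rw [uIcc_of_le hR0.le, integrableOn_Icc_iff_integrableOn_Ioc]
        exact hint.mono_set Ioc_subset_Ioi_self)
    have h3 : Tendsto (fun s : ℝ => s * R) (𝓝[<] 1) (𝓝[uIcc 0 R] R) := by
      refine tendsto_nhdsWithin_iff.2 ⟨?_, ?_⟩
      · have : Tendsto (fun s : ℝ => s * R) (𝓝 1) (𝓝 (1 * R)) :=
          (by fun_prop : Continuous fun s : ℝ => s * R).tendsto 1
        rw [one_mul] at this
        exact this.mono_left nhdsWithin_le_nhds
      · filter_upwards [Ioo_mem_nhdsLT (zero_lt_one : (0 : ℝ) < 1)] with s hs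
        rw [uIcc_of_le hR0.le]
        exact ⟨by nlinarith [hs.1], by nlinarith [hs.2]⟩
    have h4 := (hprim R right_mem_uIcc).tendsto.comp h3
    have h5 : Tendsto (fun s : ℝ => (s * R) ^ n * Psi α (φ (s • R • θ))) (𝓝[<] 1)
        (𝓝 (R ^ n * Psi α (φ (R • θ)))) := by
      refine Tendsto.mul ?_ ((continuousAt_Psi hα0 (one_div_lt_of_nonneg hα0 (h0 _))).tendsto.comp
        (hφ.tendsto_radial (interior_subset hz) (R • θ)))
      exact (tendsto_nhds_of_tendsto_nhdsWithin h3).pow n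
    refine tendsto_nhds_unique h4 (h5.congr' ?_)
    filter_upwards [Ioo_mem_nhdsLT (zero_lt_one : (0 : ℝ) < 1)] with s hs
    rw [Function.comp, key (s * R) (mul_nonneg hs.1.le hR0.le) (by rw [mul_assoc, hRp]; linarith [hs.2]),
      mul_smul]
  · have hp1 : p = 0 := le_antisymm (not_lt.1 hpos) hp0
    have h1 := intervalIntegral_tendsto_integral_Ioi 0 hint tendsto_id
    -- The ray never leaves K, so r^n f(rθ) → L. If L ≠ 0, then r^{n-1} f(rθ) exceeds |L|/(2r) for
    -- large r and cannot be integrable.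
    set L := ∫ r in Ioi (0 : ℝ), Q r with hL
    by_contra hne
    have h2 : ∀ᶠ R : ℝ in atTop, |L| / 2 < |∫ r in (0 : ℝ)..R, Q r| :=
      h1.abs.eventually_const_lt (by have := abs_pos.2 hne; linarith)
    obtain ⟨A, hA⟩ := (h2.and (eventually_gt_atTop 0)).exists_forall_of_atTop
    have hA0 : 0 < A := (hA A le_rfl).2
    refine not_integrableOn_Ioi_inv (a := A) ?_
    refine ((hf.mono_set (Ioi_subset_Ioi hA0.le)).norm.const_mul (2 / |L|)).mono'
      (by fun_prop) ?_
    refine (ae_restrict_iff' measurableSet_Ioi).2 (Eventually.of_forall fun r hr => ?_)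
    have hrA : A < r := hr
    obtain ⟨h3, h4⟩ := hA r hrA.le
    have hrn : r ^ n = r ^ (n - 1) * r := by rw [← pow_succ, Nat.sub_add_cancel NeZero.one_le]
    rw [key r h4.le (by simp [hp1]), hrn, mul_right_comm, abs_mul, abs_of_pos h4] at h3
    rw [Real.norm_eq_abs, abs_inv, abs_of_pos h4, inv_le_iff_one_le_mul₀ h4, Real.norm_eq_abs]
    have hL0 := abs_pos.2 hne
    rw [div_lt_iff₀ (by norm_num)] at h3
    rw [div_mul_eq_mul_div, div_mul_eq_mul_div, le_div_iff₀ hL0]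
    linarith

end RadialFTC

/-! ### The divergence theorem for the field f(x)x -/

section Euler

variable {φ : Eucl n → EReal} {α : ℝ}

lemma integrable_radialMeasure_iff {F : ℝ → ℝ} :
    Integrable F (radialMeasure n) ↔ IntegrableOn (fun r => r ^ (n - 1) * F r) (Ioi 0) := by
  rw [radialMeasure, integrable_withDensity_iff_integrable_smul' (by fun_prop)
    (Eventually.of_forall fun _ => ENNReal.ofReal_lt_top), IntegrableOn]
  refine integrable_congr ((ae_restrict_iff' measurableSet_Ioi).2 (Eventually.of_forall fun r hr => ?_))
  have hr0 : 0 < r := hr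
  simp only [smul_eq_mul]
  rw [ENNReal.toReal_ofReal (by positivity)]

lemma integral_radialMeasure (F : ℝ → ℝ) :
    ∫ r, F r ∂radialMeasure n = ∫ r in Ioi (0 : ℝ), r ^ (n - 1) * F r := by
  rw [radialMeasure, integral_withDensity_eq_integral_toReal_smul (by fun_prop)
    (Eventually.of_forall fun _ => ENNReal.ofReal_lt_top)]
  refine setIntegral_congr_fun measurableSet_Ioi fun r hr => ?_
  have hr0 : 0 < r := hr
  simp only [smul_eq_mul]
  rw [ENNReal.toReal_ofReal (by positivity)]

/-- The divergence theorem for the vector field `f(x) x`, with the boundary term written in terms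
of the cone measure. -/
lemma lintegral_coneMeasure_Psi [NeZero n] (hα0 : α < 0) (hφ : IsConv φ) (h0 : ∀ x, 0 ≤ φ x)
    (hK : ConvexNhd (closure (dom φ))) (hf : Integrable fun x => Psi α (φ x))
    (hint : Integrable (eulerIntegrand α φ)) :
    0 ≤ ∫ x, eulerIntegrand α φ x ∧
    ∫⁻ z, ENNReal.ofReal (Psi α (φ z)) ∂coneMeasure (closure (dom φ)) =
      ENNReal.ofReal (∫ x, eulerIntegrand α φ x) := by
  have hmp := measurePreserving_polar (n := n)
  have hf' := hmp.integrable_comp_of_integrable hf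
  have hint' := hmp.integrable_comp_of_integrable hint
  have hdiff : ∀ᵐ θ : USphere n ∂sphereMeasure n, ∀ᵐ r : ℝ, 0 < r →
      r • (θ : Eucl n) ∈ interior (dom φ) →
      DifferentiableAt ℝ (fun z => (φ z).toReal) (r • (θ : Eucl n)) := by
    filter_upwards [Measure.ae_ae_of_ae_prod (hmp.quasiMeasurePreserving.ae hφ.ae_differentiableAt)]
      with θ hθ
    rw [radialMeasure, ae_withDensity_iff (by fun_prop), ae_restrict_iff' measurableSet_Ioi] at hθ
    filter_upwards [hθ] with r hr hr0
    exact hr hr0 (by simpa using pow_pos hr0 (n - 1))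
  set I : USphere n → ℝ := fun θ => if 0 < gauge (closure (dom φ)) (θ : Eucl n) then
    (gauge (closure (dom φ)) (θ : Eucl n) ^ n)⁻¹ *
      Psi α (φ ((gauge (closure (dom φ)) (θ : Eucl n))⁻¹ • (θ : Eucl n))) else 0 with hI
  have hPsi : ∀ x, 0 ≤ Psi α (φ x) := fun x => Psi_nonneg hα0 (one_div_lt_of_nonneg hα0 (h0 x))
  have hI0 : ∀ θ, 0 ≤ I θ := fun θ => by
    simp only [hI]; split_ifs with h
    · exact mul_nonneg (by positivity) (hPsi _)
    · exact le_rfl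
  have hray : (fun θ : USphere n => ∫ r, eulerIntegrand α φ (r • (θ : Eucl n)) ∂radialMeasure n)
      =ᵐ[sphereMeasure n] I := by
    filter_upwards [hdiff, hint'.prod_right_ae, hf'.prod_right_ae] with θ h1 h2 h3
    rw [integral_radialMeasure]
    exact integral_ray hα0 hφ h0 hK h1 (integrable_radialMeasure_iff.1 h2)
      (integrable_radialMeasure_iff.1 h3)
  have htot : ∫ x, eulerIntegrand α φ x = ∫ θ, I θ ∂sphereMeasure n := by
    rw [← hmp.map_eq, integral_map hmp.measurable.aemeasurable
      (by rw [hmp.map_eq]; exact hint.aestronglyMeasurable)]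
    exact (integral_prod _ hint').trans (integral_congr_ae hray)
  have hIint : Integrable I (sphereMeasure n) := hint'.integral_prod_left.congr hray
  refine ⟨htot ▸ integral_nonneg hI0, ?_⟩
  rw [htot, ofReal_integral_eq_lintegral_ofReal hIint (Eventually.of_forall hI0),
    hK.lintegral_coneMeasure (F := fun z => ENNReal.ofReal (Psi α (φ z)))
      (measurable_Psi.comp hφ.lsc.measurable).ennreal_ofReal]
  refine lintegral_congr fun θ => ?_
  simp only [hI]
  split_ifs with h
  · rw [ENNReal.ofReal_mul (by positivity)]
  · simp

end Euler

/-! ### Difference quotients inside and outside K, and their limits -/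

section Variation

variable {φ ψ : Eucl n → EReal} {α β₁ β₂ : ℝ}

lemma Dominated.eventually_integrable (hα0 : α < 0) (h : Dominated φ ψ β₁ β₂)
    (hf : Integrable fun x => Psi α (φ x)) :
    ∀ᶠ t : ℝ in 𝓝[>] 0, (∀ x, ((1 / α : ℝ) : EReal) < combBase φ ψ t x) ∧
      (∀ x, Psi α (combBase φ ψ t x) ≤ Psi α (combBase φ (dilation β₁ β₂ φ) t x)) ∧
      Integrable (fun x => Psi α (combBase φ (dilation β₁ β₂ φ) t x)) ∧
      Integrable (fun x => Psi α (combBase φ ψ t x)) := by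
  obtain ⟨C, -, δ, hδ, H⟩ := exists_abs_Psi_sub_le hα0 h.pos.le β₂
  filter_upwards [Ioo_mem_nhdsGT hδ, (tendsto_integral_dilation hα0 h.conv.lsc.measurable h.nonneg hf
    h.pos β₂).1] with t ht hti
  have h1 : ∀ x, ((1 / α : ℝ) : EReal) < combBase φ (dilation β₁ β₂ φ) t x := fun x => by
    rw [combBase_dilation h.conv h.nonneg h.pos ht.1.le]
    exact (H t ht.1 ht.2 _ (h.nonneg _)).1
  have h2 : ∀ x, combBase φ (dilation β₁ β₂ φ) t x ≤ combBase φ ψ t x := fun x => by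
    rw [combBase_dilation h.conv h.nonneg h.pos ht.1.le]
    exact h.dilation_le_combBase ht.1.le x
  have h3 : Integrable (fun x => Psi α (combBase φ (dilation β₁ β₂ φ) t x)) := by
    simpa only [combBase_dilation h.conv h.nonneg h.pos ht.1.le] using hti
  refine ⟨fun x => (h1 x).trans_le (h2 x), fun x => Psi_anti hα0 (h1 x) (h2 x), h3, ?_⟩
  refine h3.mono' (measurable_Psi.comp (measurable_combBase φ ψ t)).aestronglyMeasurable
    (Eventually.of_forall fun x => ?_)
  rw [Real.norm_of_nonneg (Psi_nonneg hα0 ((h1 x).trans_le (h2 x)))]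
  exact Psi_anti hα0 (h1 x) (h2 x)

/-- The difference quotient `(f_t - f) / t + C f`. -/
def innerQuotient (α : ℝ) (φ ψ : Eucl n → EReal) (C t : ℝ) (x : Eucl n) : ENNReal :=
  ENNReal.ofReal ((Psi α (combBase φ ψ t x) - Psi α (φ x)) / t + C * Psi α (φ x))

/-- The part of `f_t` outside the support of `f`, in the coordinates `(z, τ) ↦ (1 + t τ) z`. -/
def outerQuotient (α : ℝ) (φ ψ : Eucl n → EReal) (t : ℝ) (p : Eucl n × ℝ) : ENNReal :=
  ENNReal.ofReal ((1 + t * p.2) ^ (n - 1)) * (closure (dom φ))ᶜ.indicator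
    (fun x => ENNReal.ofReal (Psi α (combBase φ ψ t x))) ((1 + t * p.2) • p.1)

/-- The limit of `innerQuotient` as `t → 0⁺`. -/
def innerLimit (α : ℝ) (φ ψ : Eucl n → EReal) (C : ℝ) (x : Eucl n) : ENNReal :=
  ENNReal.ofReal (bulkIntegrand α φ ψ (fun x => Psi α (φ x)) x + C * Psi α (φ x))

/-- The speed of the support of `f_t` at a boundary point, relative to radial dilation. -/
def boundarySpeed (φ ψ : Eucl n → EReal) (z : Eucl n) : ℝ :=
  (supportFun (closure (dom ψ)) (gaussMap (closure (dom φ)) z)).toReal /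
    inner ℝ z (gaussMap (closure (dom φ)) z)

/-- The limit of `outerQuotient` as `t → 0⁺`. -/
def outerLimit (α : ℝ) (φ ψ : Eucl n → EReal) (p : Eucl n × ℝ) : ENNReal :=
  if p.2 < boundarySpeed φ ψ p.1 then ENNReal.ofReal (Psi α (φ p.1)) else 0

lemma measurable_innerQuotient (hm : Measurable φ) (C t : ℝ) :
    Measurable (innerQuotient α φ ψ C t) := by
  have h1 := measurable_Psi (α := α).comp hm
  have h2 := measurable_Psi (α := α).comp (measurable_combBase φ ψ t)
  exact (((h2.sub h1).div_const t).add (h1.const_mul C)).ennreal_ofReal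

lemma measurable_outerQuotient (t : ℝ) : Measurable (outerQuotient α φ ψ t) := by
  have h1 : Measurable ((closure (dom φ))ᶜ.indicator
      (fun x => ENNReal.ofReal (Psi α (combBase φ ψ t x)))) :=
    (measurable_Psi.comp (measurable_combBase φ ψ t)).ennreal_ofReal.indicator
      isClosed_closure.measurableSet.compl
  exact Measurable.mul (by fun_prop) (h1.comp (by fun_prop))

lemma measurable_bulkIntegrand {f : Eucl n → ℝ} (hf : Measurable f) :
    Measurable (bulkIntegrand α φ ψ f) :=
  (measurable_ereal_toReal.comp ((measurable_legendre ψ).comp (measurable_grad φ))).mul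
    (hf.pow_const _)

lemma measurable_bdryIntegrand {K D : Set (Eucl n)} {f : Eucl n → ℝ} (hf : Measurable f) :
    Measurable (bdryIntegrand K D f) :=
  (measurable_ereal_toReal.comp ((lowerSemicontinuous_supportFun D).measurable.comp
    (measurable_gaussMap K))).mul hf

lemma measurable_innerLimit (hm : Measurable φ) (C : ℝ) : Measurable (innerLimit α φ ψ C) := by
  have h1 := measurable_Psi (α := α).comp hm
  exact ((measurable_bulkIntegrand h1).add (h1.const_mul C)).ennreal_ofReal

lemma measurable_boundarySpeed : Measurable (boundarySpeed φ ψ) := by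
  refine (measurable_ereal_toReal.comp ((lowerSemicontinuous_supportFun _).measurable.comp
    (measurable_gaussMap _))).div (Measurable.inner measurable_id (measurable_gaussMap _))

lemma measurable_outerLimit (hm : Measurable φ) : Measurable (outerLimit α φ ψ) :=
  Measurable.ite (measurableSet_lt measurable_snd (measurable_boundarySpeed.comp measurable_fst))
    ((measurable_Psi.comp hm).comp measurable_fst).ennreal_ofReal measurable_const

lemma eq_top_of_notMem_closure {x : Eucl n} (hx : x ∉ closure (dom φ)) : φ x = ⊤ := by
  by_contra hne
  exact hx (subset_closure (lt_of_le_of_ne le_top hne))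

/-- Outside K the integrand is f_t/t, because f = 0 there, and the Jacobian factor t of the exterior
coordinates cancels the 1/t. The two pieces together are one integral over the whole space. -/
lemma lintegral_quotients [NeZero n] (hK : ConvexNhd (closure (dom φ))) {C t : ℝ} (ht : 0 < t)
    (hf : Integrable fun x => Psi α (φ x)) (hft : Integrable fun x => Psi α (combBase φ ψ t x))
    (hC : ∀ x, 0 ≤ (Psi α (combBase φ ψ t x) - Psi α (φ x)) / t + C * Psi α (φ x)) :
    (∫⁻ x in closure (dom φ), innerQuotient α φ ψ C t x) +
      ∫⁻ p, outerQuotient α φ ψ t p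
        ∂((coneMeasure (closure (dom φ))).prod (volume.restrict (Ioi (0 : ℝ)))) =
    ENNReal.ofReal (((∫ x, Psi α (combBase φ ψ t x)) - ∫ x, Psi α (φ x)) / t +
      C * ∫ x, Psi α (φ x)) := by
  have hKm : MeasurableSet (closure (dom φ)) := isClosed_closure.measurableSet
  set F : Eucl n → ENNReal := (closure (dom φ))ᶜ.indicator
    (fun x => ENNReal.ofReal (Psi α (combBase φ ψ t x))) with hF
  have hFm : Measurable F :=
    (measurable_Psi.comp (measurable_combBase φ ψ t)).ennreal_ofReal.indicator hKm.compl
  have h1 : ∫⁻ x in (closure (dom φ))ᶜ, innerQuotient α φ ψ C t x =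
      ∫⁻ p, outerQuotient α φ ψ t p
        ∂((coneMeasure (closure (dom φ))).prod (volume.restrict (Ioi (0 : ℝ)))) := by
    have h2 := hK.lintegral_exterior hFm (fun x hx => by simp [hF, hx]) ht
    have h3 : ∫⁻ p, ENNReal.ofReal (t * (1 + t * p.2) ^ (n - 1)) * F ((1 + t * p.2) • p.1)
        ∂((coneMeasure (closure (dom φ))).prod (volume.restrict (Ioi (0 : ℝ)))) =
        ENNReal.ofReal t * ∫⁻ p, outerQuotient α φ ψ t p
          ∂((coneMeasure (closure (dom φ))).prod (volume.restrict (Ioi (0 : ℝ)))) := by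
      rw [← lintegral_const_mul _ (measurable_outerQuotient t)]
      refine lintegral_congr fun p => ?_
      rw [ENNReal.ofReal_mul ht.le, mul_assoc]; rfl
    rw [h3] at h2
    have h4 : ∫⁻ x in (closure (dom φ))ᶜ, innerQuotient α φ ψ C t x =
        ENNReal.ofReal t⁻¹ * ∫⁻ x, F x := by
      rw [hF, lintegral_indicator hKm.compl, ← lintegral_const_mul _
        (f := fun x => ENNReal.ofReal (Psi α (combBase φ ψ t x)))
        (measurable_Psi.comp (measurable_combBase φ ψ t)).ennreal_ofReal]
      refine setLIntegral_congr_fun hKm.compl fun x hx => ?_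
      simp only [innerQuotient, eq_top_of_notMem_closure hx, Psi_top]
      rw [← ENNReal.ofReal_mul (by positivity)]
      congr 1
      ring
    rw [h4, h2, ← mul_assoc, ← ENNReal.ofReal_mul (by positivity), inv_mul_cancel₀ ht.ne',
      ENNReal.ofReal_one, one_mul]
  rw [← h1, lintegral_add_compl _ hKm]
  have hi : Integrable fun x =>
      (Psi α (combBase φ ψ t x) - Psi α (φ x)) / t + C * Psi α (φ x) :=
    ((hft.sub hf).div_const t).add (hf.const_mul C)
  have h5 := ofReal_integral_eq_lintegral_ofReal hi (Eventually.of_forall hC)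
  have h6 : ∫ x, ((Psi α (combBase φ ψ t x) - Psi α (φ x)) / t + C * Psi α (φ x)) =
      ((∫ x, Psi α (combBase φ ψ t x)) - ∫ x, Psi α (φ x)) / t + C * ∫ x, Psi α (φ x) := by
    rw [integral_add (f := fun x => (Psi α (combBase φ ψ t x) - Psi α (φ x)) / t)
      ((hft.sub hf).div_const t) (hf.const_mul C), integral_div, integral_const_mul,
      integral_sub hft hf]
  rw [h6] at h5
  exact h5.symm

lemma ConvexNhd.ae_mem_interior_dom (hφ : IsConv φ) (hK : ConvexNhd (closure (dom φ))) :
    ∀ᵐ x ∂volume.restrict (closure (dom φ)), x ∈ dom φ := by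
  rw [ae_restrict_iff' isClosed_closure.measurableSet]
  have : ∀ᵐ x, x ∉ frontier (closure (dom φ)) := by
    rw [ae_iff]; simpa using hK.convex.addHaar_frontier volume
  filter_upwards [this] with x hx hxK
  have h1 : x ∈ interior (closure (dom φ)) := by
    by_contra hcon
    exact hx ⟨subset_closure hxK, hcon⟩
  rw [interior_closure_dom hφ ⟨x, h1⟩] at h1
  exact interior_subset h1

lemma Dominated.tendsto_innerQuotient (hα0 : α < 0) (h : Dominated φ ψ β₁ β₂)
    (hK : ConvexNhd (closure (dom φ))) (C : ℝ) :
    ∀ᵐ x ∂volume.restrict (closure (dom φ)),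
      Tendsto (fun t => innerQuotient α φ ψ C t x) (𝓝[>] 0) (𝓝 (innerLimit α φ ψ C x)) := by
  filter_upwards [hK.ae_mem_interior_dom h.conv, ae_restrict_of_ae h.ae_legendre_grad_eq] with x hx hx'
  obtain ⟨h1, h2, h3⟩ := hx' hx
  exact (ENNReal.continuous_ofReal.tendsto _).comp
    ((h.tendsto_Psi_slope hα0 (h.conv.coe_toReal hx).symm h1 h2 h3).add_const _)

/-- Two sets are discarded as null: the z without a unique normal, and for each z the single
threshold value τ = `boundarySpeed φ ψ z`. -/
lemma Dominated.ae_tendsto_outerQuotient [NeZero n] (hα0 : α < 0) (h : Dominated φ ψ β₁ β₂)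
    (hK : ConvexNhd (closure (dom φ))) :
    ∀ᵐ p ∂((coneMeasure (closure (dom φ))).prod (volume.restrict (Ioi (0 : ℝ)))),
      Tendsto (fun t => outerQuotient α φ ψ t p) (𝓝[>] 0) (𝓝 (outerLimit α φ ψ p)) := by
  have hint : interior (closure (dom φ)) ⊆ dom φ := by
    rw [interior_closure_dom h.conv ⟨0, hK.zero_mem⟩]; exact interior_subset
  have hmeas : MeasurableSet {p : Eucl n × ℝ | (p.1 ∈ frontier (closure (dom φ)) ∧
      (∃! u, IsUnitNormal (closure (dom φ)) p.1 u)) ∧ p.2 ≠ boundarySpeed φ ψ p.1 ∧ 0 < p.2} := by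
    refine MeasurableSet.inter (measurable_fst (isClosed_frontier.measurableSet.inter
      (measurableSet_setOf_existsUnique_normal _))) (MeasurableSet.inter ?_
      (measurableSet_lt measurable_const measurable_snd))
    exact (measurableSet_eq_fun measurable_snd (measurable_boundarySpeed.comp measurable_fst)).compl
  have hae : ∀ᵐ p ∂((coneMeasure (closure (dom φ))).prod (volume.restrict (Ioi (0 : ℝ)))),
      (p.1 ∈ frontier (closure (dom φ)) ∧ (∃! u, IsUnitNormal (closure (dom φ)) p.1 u)) ∧
        p.2 ≠ boundarySpeed φ ψ p.1 ∧ 0 < p.2 := by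
    refine (Measure.ae_prod_iff_ae_ae hmeas).2 ?_
    filter_upwards [hK.ae_mem_frontier, hK.ae_coneMeasure_existsUnique_normal] with z h1 h2
    filter_upwards [ae_restrict_mem measurableSet_Ioi,
      ae_restrict_of_ae (Measure.ae_ne volume (boundarySpeed φ ψ z))] with τ hτ hτ'
    exact ⟨⟨h1, h2⟩, hτ', hτ⟩
  filter_upwards [hae] with ⟨z, τ⟩ ⟨⟨hz, hu⟩, hτ, hτ0⟩
  obtain ⟨b, hb, -⟩ := h.exists_supportFun_gaussMap hu
  have hspeed : boundarySpeed φ ψ z = b / inner ℝ z (gaussMap (closure (dom φ)) z) := by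
    rw [boundarySpeed, hb, EReal.toReal_coe]
  simp only at hτ hτ0
  have h1 := h.tendsto_Psi_boundary hα0 hK hint hz hu hb (hspeed ▸ hτ)
  rw [← hspeed] at h1
  have h2 : Tendsto (fun t : ℝ => ENNReal.ofReal ((1 + t * τ) ^ (n - 1))) (𝓝[>] 0) (𝓝 1) := by
    have : Tendsto (fun t : ℝ => ENNReal.ofReal ((1 + t * τ) ^ (n - 1))) (𝓝 0)
        (𝓝 (ENNReal.ofReal ((1 + 0 * τ) ^ (n - 1)))) :=
      (ENNReal.continuous_ofReal.comp (by fun_prop :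
        Continuous fun t : ℝ => (1 + t * τ) ^ (n - 1))).tendsto 0
    simp only [zero_mul, add_zero, one_pow, ENNReal.ofReal_one] at this
    exact this.mono_left nhdsWithin_le_nhds
  have h3 := ENNReal.Tendsto.mul h2 (Or.inl one_ne_zero)
    ((ENNReal.continuous_ofReal.tendsto _).comp h1) (Or.inr ENNReal.one_ne_top)
  have h4 : 1 * ENNReal.ofReal (if τ < boundarySpeed φ ψ z then Psi α (φ z) else 0) =
      outerLimit α φ ψ (z, τ) := by
    rw [one_mul, outerLimit]; split_ifs <;> simp
  rw [h4] at h3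
  refine h3.congr' ?_
  filter_upwards [self_mem_nhdsWithin] with t ht
  have ht : 0 < t := ht
  have hout : (1 + t * τ) • z ∈ (closure (dom φ))ᶜ := by
    intro hmem
    have h5 := gauge_le_one_of_mem hmem
    rw [ConvexNhd.gauge_smul_of_pos _ (by positivity),
      (gauge_eq_one_iff_mem_frontier hK.convex hK.nhds).2 hz] at h5
    nlinarith [mul_pos ht hτ0]
  rw [outerQuotient, indicator_of_mem hout]
  rfl

lemma lintegral_outerLimit [NeZero n] (hm : Measurable φ) :
    ∫⁻ p, outerLimit α φ ψ p
      ∂((coneMeasure (closure (dom φ))).prod (volume.restrict (Ioi (0 : ℝ)))) =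
    ∫⁻ z, ENNReal.ofReal (boundarySpeed φ ψ z) * ENNReal.ofReal (Psi α (φ z))
      ∂coneMeasure (closure (dom φ)) := by
  rw [lintegral_prod _ (measurable_outerLimit hm).aemeasurable]
  refine lintegral_congr fun z => ?_
  have h1 : (fun τ : ℝ => outerLimit α φ ψ (z, τ)) =
      (Iio (boundarySpeed φ ψ z)).indicator fun _ => ENNReal.ofReal (Psi α (φ z)) := by
    ext τ; simp [outerLimit, indicator]
  rw [h1, lintegral_indicator_const measurableSet_Iio, Measure.restrict_apply measurableSet_Iio,
    inter_comm, Ioi_inter_Iio, Real.volume_Ioo, sub_zero, mul_comm]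

/-- The density ⟨z, ν⟩ of the cone measure cancels the denominator of the speed. With 0 ∈ dom ψ the
support function is nonnegative, so truncation by `ENNReal.ofReal` loses nothing. Where the normal
is not unique the Gauss map has the default value 0 and the integrand vanishes, so the surface
measure of those points is irrelevant. -/
lemma Dominated.lintegral_boundarySpeed [NeZero n] (h : Dominated φ ψ β₁ β₂)
    (hα0 : α < 0) (hK : ConvexNhd (closure (dom φ))) (h0 : 0 ∈ dom ψ) :
    (∀ z, 0 ≤ bdryIntegrand (closure (dom φ)) (closure (dom ψ)) (fun x => Psi α (φ x)) z) ∧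
    ∫⁻ z, ENNReal.ofReal (boundarySpeed φ ψ z) * ENNReal.ofReal (Psi α (φ z))
      ∂coneMeasure (closure (dom φ)) =
    ∫⁻ z, ENNReal.ofReal (bdryIntegrand (closure (dom φ)) (closure (dom ψ))
      (fun x => Psi α (φ x)) z) ∂bdryMeasure (closure (dom φ)) := by
  set K := closure (dom φ) with hKdef
  have hPsi : ∀ x, 0 ≤ Psi α (φ x) := fun x => Psi_nonneg hα0 (one_div_lt_of_nonneg hα0 (h.nonneg x))
  have hnon : ∀ z, ¬ (∃! u, IsUnitNormal K z u) →
      bdryIntegrand K (closure (dom ψ)) (fun x => Psi α (φ x)) z = 0 := fun z hz => by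
    rw [bdryIntegrand, gaussMap_eq_zero hz, supportFun_zero h.dom_nonempty'.closure]; simp
  have hpos : ∀ z, (∃! u, IsUnitNormal K z u) →
      0 ≤ (supportFun (closure (dom ψ)) (gaussMap K z)).toReal := fun z hz => by
    obtain ⟨b, hb, h1, -⟩ := h.exists_supportFun_gaussMap hz
    rw [hb, EReal.toReal_coe]
    simpa using h1 0 h0
  refine ⟨fun z => ?_, ?_⟩
  · by_cases hz : ∃! u, IsUnitNormal K z u
    · exact mul_nonneg (hpos z hz) (hPsi z)
    · rw [hnon z hz]
  have hm := measurable_Psi (α := α).comp h.conv.lsc.measurable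
  have hSm : MeasurableSet {x | ∃! u, IsUnitNormal K x u} := measurableSet_setOf_existsUnique_normal K
  rw [hK.coneMeasure_eq, lintegral_withDensity_eq_lintegral_mul _
    (f := fun z => ENNReal.ofReal (inner ℝ z (gaussMap K z)))
    (Measurable.inner measurable_id (measurable_gaussMap K)).ennreal_ofReal
    (g := fun z => ENNReal.ofReal (boundarySpeed φ ψ z) * ENNReal.ofReal (Psi α (φ z)))
    (measurable_boundarySpeed.ennreal_ofReal.mul hm.ennreal_ofReal), inter_comm,
    ← Measure.restrict_restrict hSm]
  change ∫⁻ z in {x | ∃! u, IsUnitNormal K x u}, _ ∂bdryMeasure K = _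
  rw [← lintegral_indicator hSm]
  refine lintegral_congr fun z => ?_
  by_cases hz : ∃! u, IsUnitNormal K z u
  · rw [indicator_of_mem (by exact hz)]
    have h1 := hK.inner_normal_pos (isUnitNormal_gaussMap hz)
    simp only [Pi.mul_apply]
    rw [← mul_assoc, ← ENNReal.ofReal_mul h1.le, boundarySpeed, mul_div_cancel₀ _ h1.ne',
      ← ENNReal.ofReal_mul (hpos z hz)]
    rfl
  · rw [indicator_of_notMem (by exact hz), hnon z hz, ENNReal.ofReal_zero]

lemma boundarySpeed_dilation (hφ : IsConv φ) (h0 : ∀ x, 0 ≤ φ x) (hβ : 0 < β₁)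
    (hK : ConvexNhd (closure (dom φ))) {z : Eucl n} (hz : z ∈ closure (dom φ))
    (hu : ∃! u, IsUnitNormal (closure (dom φ)) z u) :
    boundarySpeed φ (dilation β₁ β₂ φ) z = β₁ := by
  set ν := gaussMap (closure (dom φ)) z with hν
  have hpos := hK.inner_normal_pos (isUnitNormal_gaussMap hu)
  rw [← hν] at hpos
  obtain ⟨b, hb, h1, h2, -⟩ := (dominated_dilation hφ h0 hβ β₂).exists_supportFun_gaussMap hu
  rw [boundarySpeed, hb, EReal.toReal_coe, ← hν, div_eq_iff hpos.ne']
  rw [← hν] at h1 h2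
  refine le_antisymm h2 ?_
  have h3 : closure (dom φ) ⊆ {x | β₁ * inner ℝ x ν ≤ b} := by
    refine closure_minimal (fun x hx => ?_) (isClosed_le (by fun_prop) continuous_const)
    have := h1 (β₁ • x) ((mem_dom_dilation hβ hφ.ne_bot).2 (by rwa [inv_smul_smul₀ hβ.ne']))
    rwa [real_inner_smul_left] at this
  exact h3 hz

end Variation

/-! ### Integration on a disjoint union, and limits of integrals -/

section SumMeasure

variable {X Y : Type*} [MeasurableSpace X] [MeasurableSpace Y]

/-- The sum of two measures on a disjoint union. -/
def sumMeasure (μ : Measure X) (ν : Measure Y) : Measure (X ⊕ Y) :=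
  μ.map Sum.inl + ν.map Sum.inr

/-- The inner and outer quotients are placed on one measure space because for the dilation the limit
is known only for the sum of their integrals. -/
lemma lintegral_sumMeasure {μ : Measure X} {ν : Measure Y} {f : X → ENNReal} {g : Y → ENNReal}
    (hf : Measurable f) (hg : Measurable g) :
    ∫⁻ p, Sum.elim f g p ∂sumMeasure μ ν = (∫⁻ x, f x ∂μ) + ∫⁻ y, g y ∂ν := by
  rw [sumMeasure, lintegral_add_measure, lintegral_map (hf.sumElim hg) measurable_inl,
    lintegral_map (hf.sumElim hg) measurable_inr]
  rfl

lemma ae_sumMeasure {μ : Measure X} {ν : Measure Y} {P : X ⊕ Y → Prop}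
    (h1 : ∀ᵐ x ∂μ, P (Sum.inl x)) (h2 : ∀ᵐ y ∂ν, P (Sum.inr y)) : ∀ᵐ p ∂sumMeasure μ ν, P p := by
  rw [sumMeasure, ae_add_measure_iff, (MeasurableEmbedding.mk Sum.inl_injective measurable_inl
      fun _ hs => measurableSet_inl_image.2 hs).ae_map_iff,
    (MeasurableEmbedding.mk Sum.inr_injective measurable_inr
      fun _ hs => measurableSet_inr_image.2 hs).ae_map_iff]
  exact ⟨h1, h2⟩

lemma lintegral_le_of_tendsto_ae {ι : Type*} {μ : Measure X} {l : Filter ι} [l.NeBot]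
    [l.IsCountablyGenerated] {G : ι → X → ENNReal} {G₀ : X → ENNReal} {L : ENNReal}
    (hG : ∀ i, Measurable (G i)) (hl : ∀ᵐ x ∂μ, Tendsto (fun i => G i x) l (𝓝 (G₀ x)))
    (hint : Tendsto (fun i => ∫⁻ x, G i x ∂μ) l (𝓝 L)) : ∫⁻ x, G₀ x ∂μ ≤ L := by
  obtain ⟨u, hu⟩ := exists_seq_tendsto l
  calc ∫⁻ x, G₀ x ∂μ = ∫⁻ x, liminf (fun k => G (u k) x) atTop ∂μ := by
        refine lintegral_congr_ae ?_
        filter_upwards [hl] with x hx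
        exact (hx.comp hu).liminf_eq.symm
    _ ≤ liminf (fun k => ∫⁻ x, G (u k) x ∂μ) atTop := lintegral_liminf_le fun k => hG _
    _ = L := (hint.comp hu).liminf_eq

/-- Passing to a sequence leaves only countably many exceptional null sets. -/
lemma ae_le_of_tendsto_ae {ι : Type*} {μ : Measure X} {l : Filter ι} [l.NeBot]
    [l.IsCountablyGenerated] {F G : ι → X → ENNReal} {F₀ G₀ : X → ENNReal}
    (hle : ∀ᶠ i in l, ∀ᵐ x ∂μ, F i x ≤ G i x)
    (hF : ∀ᵐ x ∂μ, Tendsto (fun i => F i x) l (𝓝 (F₀ x)))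
    (hG : ∀ᵐ x ∂μ, Tendsto (fun i => G i x) l (𝓝 (G₀ x))) : ∀ᵐ x ∂μ, F₀ x ≤ G₀ x := by
  obtain ⟨u, hu⟩ := exists_seq_tendsto l
  obtain ⟨N, hN⟩ := (hu.eventually hle).exists_forall_of_atTop
  have hall : ∀ᵐ x ∂μ, ∀ k, N ≤ k → F (u k) x ≤ G (u k) x := ae_all_iff.2 fun k => by
    by_cases hk : N ≤ k
    · filter_upwards [hN k hk] with x hx _ using hx
    · exact Eventually.of_forall fun x hk' => absurd hk' hk
  filter_upwards [hall, hF, hG] with x h1 h2 h3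
  exact le_of_tendsto_of_tendsto (h2.comp hu) (h3.comp hu)
    (eventually_atTop.2 ⟨N, fun k hk => h1 k hk⟩)

end SumMeasure

/-! ### The formula when 0 lies in int K and in dom ψ -/

section Variation

variable {φ ψ : Eucl n → EReal} {α β₁ β₂ : ℝ}

lemma bulkIntegrand_of_top (hα0 : α < 0) {x : Eucl n} (hx : φ x = ⊤) :
    bulkIntegrand α φ ψ (fun x => Psi α (φ x)) x = 0 := by
  rw [bulkIntegrand, hx, Psi_top, Real.zero_rpow (by linarith), mul_zero]

lemma Dominated.ae_bulkIntegrand_nonneg (hα0 : α < 0) (h : Dominated φ ψ β₁ β₂) {C : ℝ}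
    (hC : ∀ᶠ t : ℝ in 𝓝[>] 0, ∀ x,
      0 ≤ (Psi α (combBase φ ψ t x) - Psi α (φ x)) / t + C * Psi α (φ x)) :
    ∀ᵐ x, 0 ≤ bulkIntegrand α φ ψ (fun x => Psi α (φ x)) x + C * Psi α (φ x) := by
  filter_upwards [h.ae_legendre_grad_eq] with x hx
  by_cases hxd : φ x = ⊤
  · rw [bulkIntegrand_of_top hα0 hxd, hxd, Psi_top]; simp
  · have hxd : x ∈ dom φ := lt_of_le_of_ne le_top hxd
    obtain ⟨h1, h2, h3⟩ := hx hxd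
    refine ge_of_tendsto ((h.tendsto_Psi_slope hα0 (h.conv.coe_toReal hxd).symm h1 h2 h3).add_const
      (C * Psi α (φ x))) ?_
    filter_upwards [hC] with t ht using ht x

lemma setLIntegral_innerLimit (hα0 : α < 0) (C : ℝ) :
    ∫⁻ x in closure (dom φ), innerLimit α φ ψ C x = ∫⁻ x, innerLimit α φ ψ C x := by
  rw [← lintegral_indicator isClosed_closure.measurableSet]
  refine lintegral_congr fun x => ?_
  by_cases hx : x ∈ closure (dom φ)
  · rw [indicator_of_mem hx]
  · rw [indicator_of_notMem hx, innerLimit, bulkIntegrand_of_top hα0 (eq_top_of_notMem_closure hx),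
      eq_top_of_notMem_closure hx]
    simp

lemma integrable_bulkIntegrand_of_lintegral (hα0 : α < 0) (hm : Measurable φ) {C : ℝ}
    (hf : Integrable fun x => Psi α (φ x))
    (hC : ∀ᵐ x, 0 ≤ bulkIntegrand α φ ψ (fun x => Psi α (φ x)) x + C * Psi α (φ x))
    (hfin : ∫⁻ x in closure (dom φ), innerLimit α φ ψ C x ≠ ⊤) :
    Integrable (bulkIntegrand α φ ψ fun x => Psi α (φ x)) ∧
    0 ≤ (∫ x, bulkIntegrand α φ ψ (fun x => Psi α (φ x)) x) + C * ∫ x, Psi α (φ x) ∧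
    ∫⁻ x in closure (dom φ), innerLimit α φ ψ C x =
      ENNReal.ofReal ((∫ x, bulkIntegrand α φ ψ (fun x => Psi α (φ x)) x) +
        C * ∫ x, Psi α (φ x)) := by
  have hPm := measurable_Psi (α := α).comp hm
  rw [setLIntegral_innerLimit hα0] at hfin ⊢
  have h1 : Integrable fun x => bulkIntegrand α φ ψ (fun x => Psi α (φ x)) x + C * Psi α (φ x) :=
    (lintegral_ofReal_ne_top_iff_integrable
      ((measurable_bulkIntegrand hPm).add (hPm.const_mul C)).aestronglyMeasurable hC).1 hfin
  have h2 : Integrable (bulkIntegrand α φ ψ fun x => Psi α (φ x)) := by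
    refine (h1.sub (hf.const_mul C)).congr (Eventually.of_forall fun x => ?_)
    simp only [Pi.sub_apply, add_sub_cancel_right]
  have h3 : ∫ x, (bulkIntegrand α φ ψ (fun x => Psi α (φ x)) x + C * Psi α (φ x)) =
      (∫ x, bulkIntegrand α φ ψ (fun x => Psi α (φ x)) x) + C * ∫ x, Psi α (φ x) := by
    rw [integral_add h2 (hf.const_mul C), integral_const_mul]
  refine ⟨h2, h3 ▸ integral_nonneg_of_ae hC, ?_⟩
  rw [← h3, ofReal_integral_eq_lintegral_ofReal h1 hC]
  rfl

/-- Choosing y = 0 gives φ_t ≤ φ + tψ(0), hence f_t ≥ (1 - Ct)f. Adding Cf thus makes the quotients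
nonnegative, and they can be handled by Lebesgue integrals in [0, ∞]. -/
lemma Dominated.eventually_quotient_nonneg (hα0 : α < 0) (h : Dominated φ ψ β₁ β₂)
    (hf : Integrable fun x => Psi α (φ x)) (h0 : 0 ∈ dom ψ) :
    ∃ C : ℝ, ∀ᶠ t : ℝ in 𝓝[>] 0, ∀ x,
      0 ≤ (Psi α (combBase φ ψ t x) - Psi α (φ x)) / t + C * Psi α (φ x) := by
  obtain ⟨c, hc⟩ := exists_coe_of_mem_dom h.ne_bot' h0
  obtain ⟨C, -, δ, hδ, H⟩ := exists_abs_Psi_sub_le hα0 le_rfl (-c)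
  refine ⟨C, ?_⟩
  filter_upwards [Ioo_mem_nhdsGT hδ, h.eventually_integrable hα0 hf] with t ht hti x
  have h1 := combBase_le ht.1.le (φ := φ) (x := x) (h.conv.ne_bot _) hc
  rw [smul_zero, sub_zero] at h1
  have h2 := (H t ht.1 ht.2 (φ x) (h.nonneg x)).2
  have h3 : ((1 + t * 0 : ℝ) : EReal) * φ x - ((t * -c : ℝ) : EReal) =
      φ x + ((t * c : ℝ) : EReal) := by
    rw [mul_zero, add_zero, EReal.coe_one, one_mul, mul_neg, EReal.coe_neg, sub_eq_add_neg, neg_neg]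
  rw [h3] at h2
  have h4 := Psi_anti hα0 (hti.1 x) h1
  have h5 := (abs_le.1 h2).1
  have h6 : -(C * Psi α (φ x)) ≤ (Psi α (combBase φ ψ t x) - Psi α (φ x)) / t := by
    rw [le_div_iff₀ ht.1]; linarith
  linarith

lemma Dominated.tendsto_dilation_quotient (hα0 : α < 0) (h : Dominated φ ψ β₁ β₂)
    (hf : Integrable fun x => Psi α (φ x)) :
    Integrable (fun x => (β₁ * (φ x).toReal - β₂) * Psi α (φ x) ^ (1 - α)) ∧
    Tendsto (fun t : ℝ => ((∫ x, Psi α (combBase φ (dilation β₁ β₂ φ) t x)) -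
      ∫ x, Psi α (φ x)) / t) (𝓝[>] 0) (𝓝 (n * β₁ * (∫ x, Psi α (φ x)) -
        ∫ x, (β₁ * (φ x).toReal - β₂) * Psi α (φ x) ^ (1 - α))) := by
  obtain ⟨-, h1, h2⟩ := tendsto_integral_dilation hα0 h.conv.lsc.measurable h.nonneg hf h.pos β₂
  refine ⟨h1, h2.congr' ?_⟩
  filter_upwards [self_mem_nhdsWithin] with t ht
  have ht : 0 < t := ht
  simp only [combBase_dilation h.conv h.nonneg h.pos ht.le]

/-- At ∇φ(x) the conjugate of the dilation equals β₁(⟨x, ∇φ⟩ - φ) + β₂. The right side is arranged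
so that integrability of `eulerIntegrand` can be read off from that of the other terms. -/
lemma ae_bulkIntegrand_dilation (hα0 : α < 0) (hφ : IsConv φ) (h0 : ∀ x, 0 ≤ φ x) (hβ : 0 < β₁) :
    ∀ᵐ x, bulkIntegrand α φ (dilation β₁ β₂ φ) (fun x => Psi α (φ x)) x =
      n * β₁ * Psi α (φ x) - (β₁ * (φ x).toReal - β₂) * Psi α (φ x) ^ (1 - α) -
        β₁ * eulerIntegrand α φ x := by
  filter_upwards [hφ.ae_hasGradientAt] with x hx
  by_cases hxd : φ x = ⊤
  · rw [bulkIntegrand_of_top hα0 hxd, eulerIntegrand_of_top hα0 hxd, hxd, Psi_top,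
      Real.zero_rpow (by linarith)]; simp
  · have hxd : x ∈ dom φ := lt_of_le_of_ne le_top hxd
    have h1 := (hφ.coe_toReal hxd).symm
    rw [bulkIntegrand, legendre_dilation_of_eq hφ h0 hβ h1 (hφ.legendre_grad_le h1 (hx hxd).2),
      EReal.toReal_coe, eulerIntegrand]
    ring

/-- For the dilation the boundary speed is the constant β₁, so the outer part is β₁∫f against the
cone measure. The divergence theorem turns it into β₁ times the integral of `eulerIntegrand`, which
is exactly what the bulk part lacks. -/
lemma Dominated.lintegral_dilation_limit [NeZero n] (hα0 : α < 0) (h : Dominated φ ψ β₁ β₂)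
    (hf : Integrable fun x => Psi α (φ x)) (hK : ConvexNhd (closure (dom φ))) {C : ℝ}
    (hC : ∀ᵐ x, 0 ≤ bulkIntegrand α φ (dilation β₁ β₂ φ) (fun x => Psi α (φ x)) x +
      C * Psi α (φ x))
    (hfin : ∫⁻ x in closure (dom φ), innerLimit α φ (dilation β₁ β₂ φ) C x ≠ ⊤) :
    (∫⁻ x in closure (dom φ), innerLimit α φ (dilation β₁ β₂ φ) C x) +
      ∫⁻ p, outerLimit α φ (dilation β₁ β₂ φ) p
        ∂((coneMeasure (closure (dom φ))).prod (volume.restrict (Ioi (0 : ℝ)))) =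
    ENNReal.ofReal (n * β₁ * (∫ x, Psi α (φ x)) -
        (∫ x, (β₁ * (φ x).toReal - β₂) * Psi α (φ x) ^ (1 - α)) + C * ∫ x, Psi α (φ x)) := by
  obtain ⟨h1, h2, h3⟩ := integrable_bulkIntegrand_of_lintegral hα0 h.conv.lsc.measurable hf hC hfin
  have h4 := (h.tendsto_dilation_quotient hα0 hf).1
  have hae := ae_bulkIntegrand_dilation (β₂ := β₂) hα0 h.conv h.nonneg h.pos
  have hE : Integrable (eulerIntegrand α φ) := by
    have h5 := (((hf.const_mul (n * β₁)).sub h4).sub h1).const_mul β₁⁻¹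
    refine h5.congr ?_
    filter_upwards [hae] with x hx
    simp only [Pi.sub_apply, hx]
    have := h.pos.ne'
    field_simp
    ring
  obtain ⟨h6, h7⟩ := lintegral_coneMeasure_Psi hα0 h.conv h.nonneg hK hf hE
  have h8 : ∫⁻ z, ENNReal.ofReal (boundarySpeed φ (dilation β₁ β₂ φ) z) *
      ENNReal.ofReal (Psi α (φ z)) ∂coneMeasure (closure (dom φ)) =
      ENNReal.ofReal (β₁ * ∫ x, eulerIntegrand α φ x) := by
    rw [ENNReal.ofReal_mul h.pos.le, ← h7, ← lintegral_const_mul _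
      (f := fun z => ENNReal.ofReal (Psi α (φ z)))
      (measurable_Psi.comp h.conv.lsc.measurable).ennreal_ofReal]
    refine lintegral_congr_ae ?_
    filter_upwards [hK.ae_mem_frontier, hK.ae_coneMeasure_existsUnique_normal] with z hz hu
    rw [boundarySpeed_dilation h.conv h.nonneg h.pos hK (isClosed_closure.frontier_subset hz) hu]
  have h9 : ∫ x, bulkIntegrand α φ (dilation β₁ β₂ φ) (fun x => Psi α (φ x)) x =
      n * β₁ * (∫ x, Psi α (φ x)) -
        (∫ x, (β₁ * (φ x).toReal - β₂) * Psi α (φ x) ^ (1 - α)) -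
        β₁ * ∫ x, eulerIntegrand α φ x := by
    rw [integral_congr_ae hae, integral_sub (f := fun x => n * β₁ * Psi α (φ x) -
        (β₁ * (φ x).toReal - β₂) * Psi α (φ x) ^ (1 - α)) ((hf.const_mul _).sub h4) (hE.const_mul _),
      integral_sub (hf.const_mul _) h4, integral_const_mul, integral_const_mul]
  rw [lintegral_outerLimit h.conv.lsc.measurable, h8, h3,
    ← ENNReal.ofReal_add h2 (mul_nonneg h.pos.le h6), h9]
  congr 1
  ring

/-- The variational formula when the origin is interior to the support of `f` and belongs to the
domain of `ψ`. -/
theorem Dominated.variation_of_zero_mem [NeZero n] (hα0 : α < 0) (h : Dominated φ ψ β₁ β₂)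
    (hf : Integrable fun x => Psi α (φ x)) (hK : ConvexNhd (closure (dom φ))) (h0 : 0 ∈ dom ψ) :
    Integrable (bulkIntegrand α φ ψ fun x => Psi α (φ x)) ∧
    Integrable (bdryIntegrand (closure (dom φ)) (closure (dom ψ)) fun x => Psi α (φ x))
      (bdryMeasure (closure (dom φ))) ∧
    Tendsto (fun t : ℝ => ((∫ x, Psi α (combBase φ ψ t x)) - ∫ x, Psi α (φ x)) / t) (𝓝[>] 0)
      (𝓝 ((∫ x, bulkIntegrand α φ ψ (fun x => Psi α (φ x)) x) +
        ∫ x, bdryIntegrand (closure (dom φ)) (closure (dom ψ)) (fun x => Psi α (φ x)) x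
          ∂bdryMeasure (closure (dom φ)))) := by
  have hm := h.conv.lsc.measurable
  have h' := dominated_dilation h.conv h.nonneg h.pos β₂
  obtain ⟨C, hC⟩ := h.eventually_quotient_nonneg hα0 hf h0
  have hev := h.eventually_integrable hα0 hf
  set f : Eucl n → ℝ := fun x => Psi α (φ x) with hfdef
  set I := ∫ x, f x with hI
  -- The same C serves for the dilation, whose perturbed function lies above f_t.
  have hC' : ∀ᶠ t : ℝ in 𝓝[>] 0, ∀ x,
      0 ≤ (Psi α (combBase φ (dilation β₁ β₂ φ) t x) - f x) / t + C * f x := by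
    filter_upwards [hC, hev, self_mem_nhdsWithin] with t h1 h2 ht x
    have ht : 0 < t := ht
    have h3 : (Psi α (combBase φ ψ t x) - f x) / t ≤
        (Psi α (combBase φ (dilation β₁ β₂ φ) t x) - f x) / t := by
      have := h2.2.1 x
      gcongr
    have := h1 x
    linarith
  have hb := h.ae_bulkIntegrand_nonneg hα0 hC
  have hb' := h'.ae_bulkIntegrand_nonneg hα0 hC'
  set μ := sumMeasure (volume.restrict (closure (dom φ)))
    ((coneMeasure (closure (dom φ))).prod (volume.restrict (Ioi (0 : ℝ)))) with hμ
  have htot : ∀ᶠ t : ℝ in 𝓝[>] 0,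
      ∫⁻ p, Sum.elim (innerQuotient α φ ψ C t) (outerQuotient α φ ψ t) p ∂μ =
      ENNReal.ofReal (((∫ x, Psi α (combBase φ ψ t x)) - I) / t + C * I) := by
    filter_upwards [hC, hev, self_mem_nhdsWithin] with t h1 h2 ht
    rw [lintegral_sumMeasure (measurable_innerQuotient hm C t) (measurable_outerQuotient t),
      lintegral_quotients hK ht hf h2.2.2.2 h1]
  have htot' : ∀ᶠ t : ℝ in 𝓝[>] 0,
      ∫⁻ p, Sum.elim (innerQuotient α φ (dilation β₁ β₂ φ) C t)
        (outerQuotient α φ (dilation β₁ β₂ φ) t) p ∂μ =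
      ENNReal.ofReal (((∫ x, Psi α (combBase φ (dilation β₁ β₂ φ) t x)) - I) / t + C * I) := by
    filter_upwards [hC', hev, self_mem_nhdsWithin] with t h1 h2 ht
    rw [lintegral_sumMeasure (measurable_innerQuotient hm C t) (measurable_outerQuotient t),
      lintegral_quotients hK ht hf h2.2.2.1 h1]
  have hlF : ∀ᵐ p ∂μ, Tendsto (fun t => Sum.elim (innerQuotient α φ ψ C t)
      (outerQuotient α φ ψ t) p) (𝓝[>] 0)
      (𝓝 (Sum.elim (innerLimit α φ ψ C) (outerLimit α φ ψ) p)) :=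
    ae_sumMeasure (h.tendsto_innerQuotient hα0 hK C) (h.ae_tendsto_outerQuotient hα0 hK)
  have hlG : ∀ᵐ p ∂μ, Tendsto (fun t => Sum.elim (innerQuotient α φ (dilation β₁ β₂ φ) C t)
      (outerQuotient α φ (dilation β₁ β₂ φ) t) p) (𝓝[>] 0)
      (𝓝 (Sum.elim (innerLimit α φ (dilation β₁ β₂ φ) C)
        (outerLimit α φ (dilation β₁ β₂ φ)) p)) :=
    ae_sumMeasure (h'.tendsto_innerQuotient hα0 hK C) (h'.ae_tendsto_outerQuotient hα0 hK)
  have hlimG := ((h.tendsto_dilation_quotient hα0 hf).2.add_const (C * I))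
  have hlimG' := ((ENNReal.continuous_ofReal.tendsto _).comp hlimG).congr'
    (htot'.mono fun t ht => ht.symm)
  have hmeasF : ∀ t, Measurable (Sum.elim (innerQuotient α φ ψ C t) (outerQuotient α φ ψ t)) :=
    fun t => (measurable_innerQuotient hm C t).sumElim (measurable_outerQuotient t)
  have hmeasG : ∀ t, Measurable (Sum.elim (innerQuotient α φ (dilation β₁ β₂ φ) C t)
      (outerQuotient α φ (dilation β₁ β₂ φ) t)) :=
    fun t => (measurable_innerQuotient hm C t).sumElim (measurable_outerQuotient t)
  have hsumG := lintegral_sumMeasure (μ := volume.restrict (closure (dom φ)))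
    (ν := (coneMeasure (closure (dom φ))).prod (volume.restrict (Ioi (0 : ℝ))))
    (measurable_innerLimit (α := α) (ψ := dilation β₁ β₂ φ) hm C) (measurable_outerLimit (α := α)
    (ψ := dilation β₁ β₂ φ) hm)
  have hsumF := lintegral_sumMeasure (μ := volume.restrict (closure (dom φ)))
    (ν := (coneMeasure (closure (dom φ))).prod (volume.restrict (Ioi (0 : ℝ))))
    (measurable_innerLimit (α := α) (ψ := ψ) hm C) (measurable_outerLimit (α := α)
    (ψ := ψ) hm)
  -- Fatou's lemma first shows that the limit of the majorants has finite integral. This supplies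
  -- the integrability needed for the divergence theorem, which then upgrades Fatou's inequality to
  -- the equality `hGeq`.
  have hfat := lt_of_le_of_lt (lintegral_le_of_tendsto_ae hmeasG hlG hlimG') ENNReal.ofReal_lt_top
  have hGeq := h.lintegral_dilation_limit hα0 hf hK hb'
    (ne_top_of_le_ne_top hfat.ne (by rw [hsumG]; exact le_self_add))
  rw [← hsumG] at hGeq
  rw [← hGeq] at hlimG'
  have hle : ∀ᶠ t : ℝ in 𝓝[>] 0, ∀ᵐ p ∂μ,
      Sum.elim (innerQuotient α φ ψ C t) (outerQuotient α φ ψ t) p ≤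
      Sum.elim (innerQuotient α φ (dilation β₁ β₂ φ) C t)
        (outerQuotient α φ (dilation β₁ β₂ φ) t) p := by
    filter_upwards [hev, self_mem_nhdsWithin] with t h2 ht
    have ht : 0 < t := ht
    refine Eventually.of_forall ?_
    rintro (x | p)
    · refine ENNReal.ofReal_le_ofReal ?_
      have := h2.2.1 x
      gcongr
    · exact mul_le_mul' le_rfl (indicator_le_indicator (ENNReal.ofReal_le_ofReal (h2.2.1 _)))
  have hle₀ := ae_le_of_tendsto_ae hle hlF hlG
  have hmain := tendsto_lintegral_of_le_of_tendsto hmeasF hmeasG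
    ((measurable_innerLimit hm C).sumElim (measurable_outerLimit hm)) hle hle₀ hlF hlG hlimG' hfat.ne
  have hfinF := (lt_of_le_of_lt (lintegral_mono_ae hle₀) hfat).ne
  rw [hsumF] at hfinF hmain
  obtain ⟨h1, h2, h3⟩ := integrable_bulkIntegrand_of_lintegral hα0 hm hf hb
    (ne_top_of_le_ne_top hfinF le_self_add)
  obtain ⟨h4, h5⟩ := h.lintegral_boundarySpeed hα0 hK h0
  have hfinB := ne_top_of_le_ne_top hfinF (le_add_self)
  rw [lintegral_outerLimit hm, h5] at hfinB hmain
  have h6 : Integrable (bdryIntegrand (closure (dom φ)) (closure (dom ψ)) f)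
      (bdryMeasure (closure (dom φ))) :=
    (lintegral_ofReal_ne_top_iff_integrable
      (measurable_bdryIntegrand (measurable_Psi.comp hm)).aestronglyMeasurable
      (Eventually.of_forall h4)).1 hfinB
  refine ⟨h1, h6, ?_⟩
  rw [h3, ← ofReal_integral_eq_lintegral_ofReal h6 (Eventually.of_forall h4),
    ← ENNReal.ofReal_add h2 (integral_nonneg h4)] at hmain
  have h7 := (ENNReal.tendsto_toReal ENNReal.ofReal_ne_top).comp (hmain.congr' htot)
  rw [ENNReal.toReal_ofReal (add_nonneg h2 (integral_nonneg h4))] at h7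
  have h8 := h7.sub_const (C * I)
  convert h8.congr' ?_ using 2
  · ring
  · filter_upwards [hC, hev] with t ht1 ht2
    have h9 : 0 ≤ ((∫ x, Psi α (combBase φ ψ t x)) - I) / t + C * I := by
      have : ((∫ x, Psi α (combBase φ ψ t x)) - I) / t + C * I =
          ∫ x, ((Psi α (combBase φ ψ t x) - f x) / t + C * f x) := by
        rw [integral_add (f := fun x => (Psi α (combBase φ ψ t x) - f x) / t)
          ((ht2.2.2.2.sub hf).div_const t) (hf.const_mul C), integral_div, integral_const_mul,
          integral_sub ht2.2.2.2 hf]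
      rw [this]
      exact integral_nonneg ht1
    simp only [Function.comp]
    rw [ENNReal.toReal_ofReal h9, add_sub_cancel_right]

end Variation

/-! ### Effect of translating φ and ψ -/

section Translation

variable {φ ψ : Eucl n → EReal} {α β₁ β₂ : ℝ}

/-- An extended real is determined by its real upper bounds; this reduces shift identities for
suprema to real inequalities. -/
lemma EReal_eq_add_coe {x y : EReal} {r : ℝ}
    (h : ∀ a : ℝ, x ≤ (a : EReal) ↔ y ≤ ((a - r : ℝ) : EReal)) : x = y + (r : EReal) := by
  induction y with
  | bot =>
    rw [EReal.bot_add, EReal.eq_bot_iff_forall_lt]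
    intro a
    refine lt_of_le_of_lt ((h (a - 1)).2 bot_le) ?_
    exact_mod_cast sub_one_lt a
  | top =>
    rw [EReal.top_add_coe, EReal.eq_top_iff_forall_lt]
    intro a
    by_contra hcon
    exact EReal.coe_ne_top _ (top_le_iff.1 ((h a).1 (not_lt.1 hcon)))
  | coe s =>
    rw [← EReal.coe_add]
    refine le_antisymm ((h (s + r)).2 (by simp)) ?_
    by_contra hcon
    obtain ⟨c, hc1, hc2⟩ := EReal.lt_iff_exists_real_btwn.1 (not_le.1 hcon)
    have h1 := (h c).1 hc1.le
    have h2 : s ≤ c - r := by exact_mod_cast h1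
    have h3 : c < s + r := by exact_mod_cast hc2
    linarith

lemma coe_mul_add_coe {t : ℝ} (ht : 0 < t) (s : EReal) (r : ℝ) :
    (t : EReal) * (s + (r : EReal)) = (t : EReal) * s + ((t * r : ℝ) : EReal) := by
  induction s with
  | bot => rw [EReal.bot_add, EReal.coe_mul_bot_of_pos ht, EReal.bot_add]
  | top => rw [EReal.top_add_coe, EReal.coe_mul_top_of_pos ht, EReal.top_add_coe]
  | coe s => exact_mod_cast mul_add t s r

lemma coe_sub_add_coe (u r : ℝ) (s : EReal) :
    (u : EReal) - (s + (r : EReal)) = ((u - r : ℝ) : EReal) - s := by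
  induction s with
  | bot => rw [EReal.bot_add, EReal.coe_sub_bot, EReal.coe_sub_bot]
  | top => simp
  | coe s => exact_mod_cast (by ring : u - (s + r) = u - r - s)

lemma legendre_translate (hb : ∀ x, φ x ≠ ⊥) (a q : Eucl n) :
    legendre (fun x => φ (x + a)) q = legendre φ q + ((-inner ℝ a q : ℝ) : EReal) := by
  refine EReal_eq_add_coe fun c => ?_
  rw [legendre_le_coe_iff hb, legendre_le_coe_iff fun x => hb (x + a)]
  constructor
  · intro h x r hr
    have := h (x - a) r (by rwa [sub_add_cancel])
    rw [inner_sub_left] at this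
    linarith
  · intro h x r hr
    have := h (x + a) r hr
    rw [inner_add_left] at this
    linarith

lemma combBase_translate (hb : ∀ x, φ x ≠ ⊥) (hb' : ∀ y, ψ y ≠ ⊥) (a b : Eucl n) {t : ℝ}
    (ht : 0 < t) (x : Eucl n) :
    combBase (fun x => φ (x + a)) (fun y => ψ (y + b)) t x = combBase φ ψ t (x + (a + t • b)) := by
  refine iSup_congr fun q => ?_
  beta_reduce
  rw [legendre_translate hb, legendre_translate hb', coe_mul_add_coe ht, add_add_add_comm,
    ← EReal.coe_add, coe_sub_add_coe]
  congr 2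
  rw [inner_add_right, inner_add_right, real_inner_smul_right, real_inner_comm q a,
    real_inner_comm q b]
  ring

lemma supportFun_le_coe_iff {D : Set (Eucl n)} {u : Eucl n} {c : ℝ} :
    supportFun D u ≤ (c : EReal) ↔ ∀ y ∈ D, inner ℝ u y ≤ c := by
  simp [supportFun]

lemma supportFun_translate (D : Set (Eucl n)) (b u : Eucl n) :
    supportFun ((fun y => y + b) ⁻¹' D) u = supportFun D u + ((-inner ℝ b u : ℝ) : EReal) := by
  refine EReal_eq_add_coe fun c => ?_
  rw [supportFun_le_coe_iff, supportFun_le_coe_iff]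
  constructor
  · intro h y hy
    have := h (y - b) (by simpa using hy)
    rw [inner_sub_right, real_inner_comm b u] at this
    linarith
  · intro h y hy
    have := h (y + b) hy
    rw [inner_add_right, real_inner_comm b u] at this
    linarith

lemma closure_dom_translate (φ : Eucl n → EReal) (a : Eucl n) :
    closure (dom fun x => φ (x + a)) = (fun x => x + a) ⁻¹' closure (dom φ) :=
  ((Homeomorph.addRight a).preimage_closure (dom φ)).symm

lemma isUnitNormal_translate {K : Set (Eucl n)} {a x u : Eucl n} :
    IsUnitNormal ((fun x => x + a) ⁻¹' K) x u ↔ IsUnitNormal K (x + a) u := by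
  refine and_congr_right fun _ => ⟨fun h y hy => ?_, fun h y hy => ?_⟩
  · have := h (y - a) (by simpa using hy)
    rw [inner_sub_left] at this
    rw [inner_add_left]
    linarith
  · have := h (y + a) hy
    rw [inner_add_left, inner_add_left] at this
    linarith

lemma gaussMap_translate (K : Set (Eucl n)) (a x : Eucl n) :
    gaussMap ((fun x => x + a) ⁻¹' K) x = gaussMap K (x + a) := by
  by_cases h : ∃! u, IsUnitNormal K (x + a) u
  · have h' : ∃! u, IsUnitNormal ((fun x => x + a) ⁻¹' K) x u := by
      simpa only [isUnitNormal_translate] using h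
    exact gaussMap_eq h' (isUnitNormal_translate.2 (isUnitNormal_gaussMap h))
  · rw [gaussMap_eq_zero h, gaussMap_eq_zero]
    simpa only [isUnitNormal_translate] using h

lemma measurePreserving_bdryMeasure (K : Set (Eucl n)) (a : Eucl n) :
    MeasurePreserving (fun x : Eucl n => x + a) (bdryMeasure ((fun x => x + a) ⁻¹' K))
      (bdryMeasure K) := by
  have h1 := (IsometryEquiv.addRight a).measurePreserving_euclideanHausdorffMeasure (X := Eucl n) (n - 1)
  have h2 := h1.restrict_preimage (s := frontier K) isClosed_frontier.measurableSet
  have h3 : frontier ((fun x : Eucl n => x + a) ⁻¹' K) = (fun x => x + a) ⁻¹' frontier K :=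
    ((Homeomorph.addRight a).preimage_frontier K).symm
  rw [bdryMeasure, bdryMeasure, h3]
  exact h2

lemma grad_translate (φ : Eucl n → EReal) (a x : Eucl n) :
    grad (fun x => φ (x + a)) x = grad φ (x + a) := by
  unfold grad gradient
  rw [fderiv_comp_add_right (f := fun z => (φ z).toReal)]

lemma IsConv.translate (hφ : IsConv φ) (a : Eucl n) : IsConv fun x => φ (x + a) := by
  refine ⟨fun x => hφ.ne_bot _, ?_, fun x y s r hs hr hsr => ?_, fun x c hc => ?_⟩
  · obtain ⟨x, hx⟩ := hφ.dom_nonempty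
    exact ⟨x - a, by simpa [dom] using hx⟩
  · have := hφ.convex (x + a) (y + a) s r hs hr hsr
    rwa [smul_add, smul_add, add_add_add_comm, ← add_smul, hsr, one_smul] at this
  · have h1 : ContinuousAt (fun x : Eucl n => x + a) x := by fun_prop
    exact h1.eventually (hφ.lsc (x + a) c hc)

/-- The shift of ψ has to be β₁a: then ψ* and β₁φ* both change by -β₁⟨a, q⟩ and the constants
survive. -/
lemma Dominated.translate (h : Dominated φ ψ β₁ β₂) (a : Eucl n) :
    Dominated (fun x => φ (x + a)) (fun y => ψ (y + β₁ • a)) β₁ β₂ := by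
  refine ⟨h.conv.translate a, fun x => h.nonneg _, fun y => h.ne_bot' _, ?_, h.pos, fun q => ?_⟩
  · obtain ⟨y, hy⟩ := h.dom_nonempty'
    exact ⟨y - β₁ • a, by simpa [dom] using hy⟩
  · rw [legendre_translate h.conv.ne_bot, legendre_translate h.ne_bot', coe_mul_add_coe h.pos,
      add_right_comm, real_inner_smul_left, mul_neg]
    exact add_le_add (h.le q) le_rfl

lemma IsConv.dominated_self (hφ : IsConv φ) (h0 : ∀ x, 0 ≤ φ x) : Dominated φ φ 1 0 :=
  ⟨hφ, h0, hφ.ne_bot, hφ.dom_nonempty, one_pos, fun q => by simp⟩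

lemma Dominated.ae_bulkIntegrand_translate (hα0 : α < 0) (h : Dominated φ ψ β₁ β₂)
    (a b : Eucl n) :
    ∀ᵐ x, bulkIntegrand α φ ψ (fun x => Psi α (φ x)) (x + a) =
      bulkIntegrand α (fun x => φ (x + a)) (fun y => ψ (y + b)) (fun x => Psi α (φ (x + a))) x +
        inner ℝ b (grad (fun x => φ (x + a)) x) * Psi α (φ (x + a)) ^ (1 - α) := by
  have h1 := (measurePreserving_add_right (volume : Measure (Eucl n)) a).quasiMeasurePreserving.ae
    h.ae_legendre_grad_eq
  filter_upwards [h1] with x hx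
  simp only [bulkIntegrand, grad_translate]
  by_cases hxd : φ (x + a) = ⊤
  · rw [hxd, Psi_top, Real.zero_rpow (by linarith)]; simp
  · obtain ⟨-, -, h2⟩ := hx (lt_of_le_of_ne le_top hxd)
    have h3 : (legendre (fun y => ψ (y + b)) (grad φ (x + a))).toReal =
        (legendre ψ (grad φ (x + a))).toReal - inner ℝ b (grad φ (x + a)) := by
      rw [legendre_translate h.ne_bot', h2, ← EReal.coe_add, EReal.toReal_coe, EReal.toReal_coe]
      ring
    rw [h3]
    ring

lemma Dominated.bdryIntegrand_translate (h : Dominated φ ψ β₁ β₂) (a b x : Eucl n) :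
    bdryIntegrand (closure (dom φ)) (closure (dom ψ)) (fun x => Psi α (φ x)) (x + a) =
      bdryIntegrand (closure (dom fun x => φ (x + a))) (closure (dom fun y => ψ (y + b)))
        (fun x => Psi α (φ (x + a))) x +
        inner ℝ b (gaussMap (closure (dom fun x => φ (x + a))) x) * Psi α (φ (x + a)) := by
  simp only [bdryIntegrand, closure_dom_translate, gaussMap_translate, supportFun_translate]
  have h1 : ∃ s : ℝ, supportFun (closure (dom ψ)) (gaussMap (closure (dom φ)) (x + a)) = s := by
    by_cases hu : ∃! u, IsUnitNormal (closure (dom φ)) (x + a) u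
    · obtain ⟨s, hs, -⟩ := h.exists_supportFun_gaussMap hu
      exact ⟨s, hs⟩
    · exact ⟨0, by rw [gaussMap_eq_zero hu, supportFun_zero h.dom_nonempty'.closure]; rfl⟩
  obtain ⟨s, hs⟩ := h1
  rw [hs, ← EReal.coe_add, EReal.toReal_coe, EReal.toReal_coe]
  ring

lemma integral_Psi_combBase_translate (hb : ∀ x, φ x ≠ ⊥) (hb' : ∀ y, ψ y ≠ ⊥) (a b : Eucl n)
    {t : ℝ} (ht : 0 < t) :
    ∫ x, Psi α (combBase (fun x => φ (x + a)) (fun y => ψ (y + b)) t x) =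
      ∫ x, Psi α (combBase φ ψ t x) := by
  simp only [combBase_translate hb hb' a b ht]
  exact integral_add_right_eq_self (fun x => Psi α (combBase φ ψ t x)) (a + t • b)

end Translation

/-! ### Removing the position of the origin -/

section General

variable {φ ψ : Eucl n → EReal} {α β₁ β₂ : ℝ}

/-- The conclusion of the variational formula. -/
structure HasVariation (α : ℝ) (φ ψ : Eucl n → EReal) : Prop where
  bulk : Integrable (bulkIntegrand α φ ψ fun x => Psi α (φ x))
  bdry : Integrable (bdryIntegrand (closure (dom φ)) (closure (dom ψ)) fun x => Psi α (φ x))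
      (bdryMeasure (closure (dom φ)))
  tendsto : Tendsto (fun t : ℝ => ((∫ x, Psi α (combBase φ ψ t x)) - ∫ x, Psi α (φ x)) / t)
    (𝓝[>] 0) (𝓝 ((∫ x, bulkIntegrand α φ ψ (fun x => Psi α (φ x)) x) +
        ∫ x, bdryIntegrand (closure (dom φ)) (closure (dom ψ)) (fun x => Psi α (φ x)) x
          ∂bdryMeasure (closure (dom φ))))

/-- The divergence theorem for the constant field `b`. -/
structure HasDivergence (α : ℝ) (φ : Eucl n → EReal) (b : Eucl n) : Prop where
  bulk : Integrable fun x => inner ℝ b (grad φ x) * Psi α (φ x) ^ (1 - α)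
  bdry : Integrable (fun x => inner ℝ b (gaussMap (closure (dom φ)) x) * Psi α (φ x))
    (bdryMeasure (closure (dom φ)))
  eq_zero : (∫ x, inner ℝ b (grad φ x) * Psi α (φ x) ^ (1 - α)) +
    ∫ x, inner ℝ b (gaussMap (closure (dom φ)) x) * Psi α (φ x) ∂bdryMeasure (closure (dom φ)) = 0

lemma tendsto_translate_iff (hb : ∀ x, φ x ≠ ⊥) (hb' : ∀ y, ψ y ≠ ⊥) (a b : Eucl n) {L : ℝ} :
    Tendsto (fun t : ℝ => ((∫ x, Psi α (combBase (fun x => φ (x + a)) (fun y => ψ (y + b)) t x)) -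
      ∫ x, Psi α (φ (x + a))) / t) (𝓝[>] 0) (𝓝 L) ↔
    Tendsto (fun t : ℝ => ((∫ x, Psi α (combBase φ ψ t x)) - ∫ x, Psi α (φ x)) / t)
      (𝓝[>] 0) (𝓝 L) := by
  refine tendsto_congr' ?_
  filter_upwards [self_mem_nhdsWithin] with t ht
  rw [integral_Psi_combBase_translate hb hb' a b ht,
    integral_add_right_eq_self (fun x => Psi α (φ x)) a]

lemma integral_bdryMeasure_translate (K : Set (Eucl n)) (a : Eucl n) (g : Eucl n → ℝ) :
    ∫ x, g (x + a) ∂bdryMeasure ((fun x => x + a) ⁻¹' K) = ∫ x, g x ∂bdryMeasure K :=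
  (measurePreserving_bdryMeasure K a).integral_comp (Homeomorph.addRight a).measurableEmbedding g

lemma integrable_bdryMeasure_translate (K : Set (Eucl n)) (a : Eucl n) (g : Eucl n → ℝ) :
    Integrable (fun x => g (x + a)) (bdryMeasure ((fun x => x + a) ⁻¹' K)) ↔
      Integrable g (bdryMeasure K) :=
  (measurePreserving_bdryMeasure K a).integrable_comp_emb (Homeomorph.addRight a).measurableEmbedding

lemma integrable_comp_add_right_iff (a : Eucl n) (g : Eucl n → ℝ) :
    Integrable (fun x => g (x + a)) ↔ Integrable g :=
  (measurePreserving_add_right volume a).integrable_comp_emb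
    (Homeomorph.addRight a).measurableEmbedding

lemma HasVariation.translate (hα0 : α < 0) (h : Dominated φ ψ β₁ β₂) {a b : Eucl n}
    (hv : HasVariation α (fun x => φ (x + a)) (fun y => ψ (y + b)))
    (hd : HasDivergence α (fun x => φ (x + a)) b) : HasVariation α φ ψ := by
  have h1 := h.ae_bulkIntegrand_translate hα0 a b
  have h2 := h.bdryIntegrand_translate (α := α) a b
  have hbulk := (hv.bulk.add hd.bulk).congr (h1.mono fun x hx => hx.symm)
  have hbdry := hv.bdry.add hd.bdry
  have h3 := (integral_congr_ae h1).trans (integral_add hv.bulk hd.bulk)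
  have h4 := integral_add hv.bdry hd.bdry
  simp only [← h2] at h4
  replace hbdry := hbdry.congr (Eventually.of_forall fun x => (h2 x).symm)
  rw [integral_add_right_eq_self (bulkIntegrand α φ ψ fun x => Psi α (φ x)) a] at h3
  rw [closure_dom_translate] at hbdry
  have h5 := integral_bdryMeasure_translate (closure (dom φ)) a
    (bdryIntegrand (closure (dom φ)) (closure (dom ψ)) fun x => Psi α (φ x))
  rw [← closure_dom_translate, h4] at h5
  refine ⟨(integrable_comp_add_right_iff a _).1 hbulk,
    (integrable_bdryMeasure_translate _ a _).1 hbdry, ?_⟩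
  have h6 := (tendsto_translate_iff h.conv.ne_bot h.ne_bot' a b).1 hv.tendsto
  convert h6 using 2
  rw [h3, ← h5]
  have := hd.eq_zero
  linarith

/-- Translation leaves the masses unchanged, so both formulas evaluate the same limit. Their right
sides differ by the bulk and boundary terms of the constant field b, whose sum must be zero. -/
lemma HasVariation.hasDivergence (hα0 : α < 0) (h : Dominated φ ψ β₁ β₂) {a b : Eucl n}
    (hv : HasVariation α (fun x => φ (x + a)) (fun y => ψ (y + b)))
    (hv₀ : HasVariation α φ ψ) : HasDivergence α (fun x => φ (x + a)) b := by
  have h1 := h.ae_bulkIntegrand_translate hα0 a b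
  have h2 := h.bdryIntegrand_translate (α := α) a b
  have hbulk₀ := (integrable_comp_add_right_iff a _).2 hv₀.bulk
  have hbdry₀ := (integrable_bdryMeasure_translate _ a _).2 hv₀.bdry
  rw [← closure_dom_translate] at hbdry₀
  have hbulk := (hbulk₀.sub hv.bulk).congr (h1.mono fun x hx => by
    simp only [Pi.sub_apply]; rw [hx, add_sub_cancel_left])
  have hbdry := (hbdry₀.sub hv.bdry).congr (Eventually.of_forall fun x => by
    simp only [Pi.sub_apply]; rw [h2, add_sub_cancel_left])
  refine ⟨hbulk, hbdry, ?_⟩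
  have h3 := (integral_congr_ae h1).trans (integral_add hv.bulk hbulk)
  have h4 := integral_add hv.bdry hbdry
  simp only [← h2] at h4
  rw [integral_add_right_eq_self (bulkIntegrand α φ ψ fun x => Psi α (φ x)) a] at h3
  have h5 := integral_bdryMeasure_translate (closure (dom φ)) a
    (bdryIntegrand (closure (dom φ)) (closure (dom ψ)) fun x => Psi α (φ x))
  rw [← closure_dom_translate, h4] at h5
  have h6 := tendsto_nhds_unique ((tendsto_translate_iff h.conv.ne_bot h.ne_bot' a b).1 hv.tendsto)
    hv₀.tendsto
  rw [h3, ← h5] at h6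
  linarith

lemma Dominated.hasVariation_of_zero_mem [NeZero n] (hα0 : α < 0) (h : Dominated φ ψ β₁ β₂)
    (hf : Integrable fun x => Psi α (φ x)) (hK : (0 : Eucl n) ∈ interior (closure (dom φ)))
    (h0 : 0 ∈ dom ψ) : HasVariation α φ ψ := by
  obtain ⟨h1, h2, h3⟩ := h.variation_of_zero_mem hα0 hf
    ⟨h.conv.convex_dom.closure, isClosed_closure, hK⟩ h0
  exact ⟨h1, h2, h3⟩

/-- Compare the pair (φ, φ) with the pair (χ, χ), where χ is φ translated by εb. For small ε the
origin is interior to both supports, so the special case covers both pairs; dividing by ε gives the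
field b. -/
lemma IsConv.hasDivergence [NeZero n] (hα0 : α < 0) (hφ : IsConv φ) (h0 : ∀ x, 0 ≤ φ x)
    (hf : Integrable fun x => Psi α (φ x)) (hK : (0 : Eucl n) ∈ interior (closure (dom φ)))
    (b : Eucl n) : HasDivergence α φ b := by
  have hdom : ∀ χ : Eucl n → EReal, IsConv χ → 0 ∈ interior (closure (dom χ)) → 0 ∈ dom χ :=
    fun χ hχ h => interior_subset (interior_closure_dom hχ ⟨_, h⟩ ▸ h)
  have h1 : ∀ᶠ ε : ℝ in 𝓝[>] 0, (0 : Eucl n) + -(ε • b) ∈ interior (closure (dom φ)) := by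
    have : Tendsto (fun ε : ℝ => (0 : Eucl n) + -(ε • b)) (𝓝 0) (𝓝 (0 + -((0 : ℝ) • b))) :=
      (by fun_prop : Continuous fun ε : ℝ => (0 : Eucl n) + -(ε • b)).tendsto 0
    rw [zero_smul, neg_zero, add_zero] at this
    exact (this.mono_left nhdsWithin_le_nhds).eventually (isOpen_interior.mem_nhds hK)
  obtain ⟨ε, hε, hε0⟩ := (h1.and self_mem_nhdsWithin).exists
  have hε0 : 0 < ε := hε0
  set χ : Eucl n → EReal := fun x => φ (x + -(ε • b)) with hχ
  have hχφ : (fun x => χ (x + ε • b)) = φ := by ext x; simp [hχ]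
  have hχK : (0 : Eucl n) ∈ interior (closure (dom χ)) := by
    rw [hχ, closure_dom_translate]
    exact preimage_interior_subset_interior_preimage (by fun_prop) hε
  have hcχ := hφ.translate (-(ε • b))
  have hd := hcχ.dominated_self fun x => h0 _
  have hv₀ := hd.hasVariation_of_zero_mem hα0 ((integrable_comp_add_right_iff _ _).2 hf) hχK
    (hdom χ hcχ hχK)
  have hv := (hφ.dominated_self h0).hasVariation_of_zero_mem hα0 hf hK (hdom φ hφ hK)
  have hdiv : HasDivergence α (fun x => χ (x + ε • b)) (ε • b) :=
    HasVariation.hasDivergence hα0 hd (by rw [hχφ]; exact hv) hv₀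
  rw [hχφ] at hdiv
  obtain ⟨h2, h3, h4⟩ := hdiv
  have h5 : ∀ u : Eucl n, ∀ r : ℝ, inner ℝ b u * r = ε⁻¹ * (inner ℝ (ε • b) u * r) := fun u r => by
    rw [real_inner_smul_left]; field_simp
  refine ⟨?_, ?_, ?_⟩
  · simpa only [h5] using h2.const_mul ε⁻¹
  · simpa only [h5] using h3.const_mul ε⁻¹
  · simp only [h5]
    rw [integral_const_mul, integral_const_mul, ← mul_add, h4, mul_zero]

/-- Shifting φ by a and ψ by β₁a brings the origin into int K and into dom ψ while keeping the
domination. -/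
theorem Dominated.hasVariation [NeZero n] (hα0 : α < 0) (h : Dominated φ ψ β₁ β₂)
    (hf : Integrable fun x => Psi α (φ x)) {a : Eucl n} (ha : a ∈ interior (closure (dom φ)))
    (hψ : β₁ • a ∈ dom ψ) : HasVariation α φ ψ := by
  have h' := h.translate a
  have hf' := (integrable_comp_add_right_iff a _).2 hf
  have hK : (0 : Eucl n) ∈ interior (closure (dom fun x => φ (x + a))) := by
    rw [closure_dom_translate]
    exact preimage_interior_subset_interior_preimage (by fun_prop) (by simpa using ha)
  exact (h'.hasVariation_of_zero_mem hα0 hf' hK (by simpa [dom] using hψ)).translate hα0 h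
    (h'.conv.hasDivergence hα0 h'.nonneg hf' hK _)

end General

end

end AlphaConcave

/-! ### The variational formula -/

theorem mainTheorem1 {n : ℕ} (hn : 1 ≤ n) {α : ℝ} (hα : -(1 / (n : ℝ)) < α) (hα0 : α < 0)
    (φ ψ : Eucl n → EReal) (f : Eucl n → ℝ)
    (hφ : IsConv φ) (hφ_nonneg : ∀ x, 0 ≤ φ x) (hφ_coercive : Coercive φ)
    (hf : f = fun x => Psi α (φ x))
    (hψ : IsConv ψ) (β₁ β₂ : ℝ) (hβ₁ : 0 < β₁)
    (hdom : (dom ψ ∩ interior (β₁ • tsupport f)).Nonempty)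
    (hle : ∀ y, legendre ψ y ≤ (β₁ : EReal) * legendre φ y + (β₂ : EReal)) :
    -- all the objects in the formula are well defined and finite
    (Integrable f ∧
      ∀ᶠ t : ℝ in 𝓝[>] 0, (∀ x, ((1 / α : ℝ) : EReal) < combBase φ ψ t x) ∧
        Integrable (fun x => Psi α (combBase φ ψ t x))) ∧
    ((∀ᵐ x : Eucl n, x ∈ dom φ → legendre ψ (grad φ x) ≠ ⊤) ∧
      Integrable (bulkIntegrand α φ ψ f)) ∧
    ((∀ x ∈ frontier (tsupport f),
        supportFun (closure (dom ψ)) (gaussMap (tsupport f) x) ≠ ⊤) ∧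
      Integrable (bdryIntegrand (tsupport f) (closure (dom ψ)) f) (bdryMeasure (tsupport f))) ∧
    -- the variational formula for a general `ψ`
    Tendsto (fun t : ℝ => ∫ x, (Psi α (combBase φ ψ t x) - f x) / t) (𝓝[>] 0)
      (𝓝 ((∫ x, bulkIntegrand α φ ψ f x) +
        ∫ x, bdryIntegrand (tsupport f) (closure (dom ψ)) f x ∂(bdryMeasure (tsupport f)))) ∧
    -- the first variation along `g = (1 - α ψ)^{1/α}` whenever `g` is an `α`-concave function
    (∀ g : Eucl n → ℝ, (∀ x, ((1 / α : ℝ) : EReal) < ψ x) → (g = fun x => Psi α (ψ x)) →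
      HasFirstVariation α f g
        ((∫ x, bulkIntegrand α φ ψ f x) +
          ∫ x, bdryIntegrand (tsupport f) (tsupport g) f x ∂(bdryMeasure (tsupport f)))) := by
  have : NeZero n := ⟨by omega⟩
  have hα_lt : ∀ x, ((1 / α : ℝ) : EReal) < φ x := fun x =>
    one_div_lt_of_nonneg hα0 (hφ_nonneg x)
  have hint : Integrable fun x => Psi α (φ x) :=
    integrable_Psi hn hα hα0 hφ.lsc.measurable hφ_nonneg hφ_coercive
  have hsupp : tsupport f = closure (dom φ) := by rw [hf]; exact tsupport_Psi hα0 hα_lt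
  have h : Dominated φ ψ β₁ β₂ :=
    ⟨hφ, hφ_nonneg, hψ.ne_bot, hψ.dom_nonempty, hβ₁, hle⟩
  obtain ⟨y, hy, hyK⟩ := hdom
  -- The point of dom ψ in int(β₁K) has the form β₁a with a ∈ int K; this a is the translation
  -- vector.
  rw [hsupp, interior_smul₀ hβ₁.ne'] at hyK
  obtain ⟨a, ha, rfl⟩ := hyK
  obtain ⟨hbulk, hbdry, hlim⟩ := h.hasVariation hα0 hint ha hy
  have hev := h.eventually_integrable hα0 hint
  rw [hsupp]
  subst hf
  refine ⟨⟨hint, hev.mono fun t ht => ⟨ht.1, ht.2.2.2⟩⟩, ⟨?_, hbulk⟩,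
    ⟨fun x _ => h.supportFun_gaussMap_ne_top x, hbdry⟩, ?_, ?_⟩
  · filter_upwards [h.ae_legendre_grad_eq] with x hx hxd
    rw [(hx hxd).2.2]
    exact EReal.coe_ne_top _
  · refine hlim.congr' ?_
    filter_upwards [hev] with t ht
    rw [integral_div, integral_sub ht.2.2.2 hint]
  · rintro g hψα rfl
    rw [tsupport_Psi hα0 hψα]
    unfold HasFirstVariation totalMass alphaComb
    rw [base_Psi hα0 hα_lt, base_Psi hα0 hψα]
    exact hlim
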